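/- Let $k$ be a field of characteristic zero; all spaces are $\mathbb Z/2$-graded, with the Koszul sign rule. An operad $\mathcal O$ has operations of arities $n=0,1,2,\dots$ and partial compositions $\circ_i$, without a required unit; $\mathrm{End}(W)(n)=\mathrm{Hom}(W^{\otimes n},W)$, so that $\mathrm{End}(W)(0)=W$. **Operads.** $L_\infty$ is the symmetric operad freely generated by odd operations $m_n\in L_\infty(n)$, $n\ge 1$, invariant under $S_n$, with the differential $$d(m_n)=\sum_{k=1}^n\ \sum_{\sigma\in \mathrm{Sh}(n-k+1,k-1)}\sigma\,(m_k\circ_1 m_{n-k+1}).$$ $A_\infty$ is the non-symmetric operad freely generated by odd operations $m_n\in A_\infty(n)$, $n\ge1$, with $d(m_n)=\sum_{k=1}^n\sum_{i=1}^k m_k\circ_i m_{n-k+1}$. For $\mathcal O=L_\infty$ or $A_\infty$ let $\mathcal O[x]$ be obtained by freely adjoining an even operation $x$ of arity $0$, and let $\mathcal O[[x]]=\varprojlim_N \mathcal O[x]/(x)^N$, where $(x)^N$ is spanned by the operadic monomials containing $x$ at least $N$ times, with the inverse limit topology. Put $\mathscr L_\infty=L_\infty[[x]]$ and $\mathscr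 A_\infty=A_\infty[[x]]$, with the continuous differential extending that of $L_\infty$, resp. $A_\infty$, and $$d(x)=\sum_{n\ge1}\tfrac1{n!}\,m_n\circ x^{\otimes n}\quad(\mathscr L_\infty),\qquad d(x)=\sum_{n\ge1}m_n\circ x^{\otimes n}\quad(\mathscr A_\infty).$$ **Algebras and Maurer–Cartan elements.** A formal cdga $A$ is obtained by adjoining a unit to its augmentation ideal $A_+=\varprojlim A_i$, an inverse limit of finite-dimensional nilpotent non-unital cdgas. For a dg vector space $V$ with parity reversion $\Pi V$, put $A_+\otimes\mathrm{End}(\Pi V)=\varprojlim A_i\otimes\mathrm{End}(\Pi V)$, a topological dg operad. An $A$-linear algebra structure on $V$ over a (topological) dg operad $\mathcal O$ is a continuous map of dg operads $\mathcal O\to A_+\otimes\mathrm{End}(\Pi V)$ (of non-symmetric operads if $\mathcal O$ is non-symmetric). For $\mathcal O=L_\infty$ or $A_\infty$, given such a map $\varphi$, its structure maps are $\mu_n=-\varphi(m_n):(\Pi V)^{\otimes n}\to A_+\otimes\Pi V$ (the sign is the one for which the $L_\infty$, resp. $A_\infty$, identities take the form $[d,\mu]+\mu\circ\mu=0$), and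 $\mathrm{MC}(V,A)$ is the set of even $\xi\in A_+\otimes\Pi V$ with $$d\xi+\sum_{n\ge1}\tfrac1{n!}\,\mu_n(\xi^{\otimes n})=0\quad(L_\infty),\qquad d\xi+\sum_{n\ge1}\mu_n(\xi^{\otimes n})=0\quad(A_\infty),$$ where $d=d_A\otimes\mathrm{id}+\mathrm{id}\otimes d_{\Pi V}$ and the series converges in $A_+\otimes\Pi V$. **Theorem.** Let $A$ be a formal cdga and $V$ a dg vector space. 1. If $f$ is an $A$-linear $\mathscr L_\infty$-algebra structure on $V$, then $f(x)\in\mathrm{MC}(V,A)$ for the $A$-linear $L_\infty$-algebra structure $f|_{L_\infty}$. Conversely, for every $A$-linear $L_\infty$-algebra structure $\varphi$ on $V$ and every $\xi\in\mathrm{MC}(V,A)$ there is a unique $A$-linear $\mathscr L_\infty$-algebra structure $f$ on $V$ with $f|_{L_\infty}=\varphi$ and $f(x)=\xi$. 2. If $f$ is an $A$-linear $\mathscr A_\infty$-algebra structure on $V$, then $f(x)\in\mathrm{MC}(V,A)$ for the $A$-linear $A_\infty$-algebra structure $f|_{A_\infty}$. Conversely, for every $A$-linear $A_\infty$-algebra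 structure $\varphi$ on $V$ and every $\xi\in\mathrm{MC}(V,A)$ there is a unique $A$-linear $\mathscr A_\infty$-algebra structure $f$ on $V$ with $f|_{A_\infty}=\varphi$ and $f(x)=\xi$. -/

import Mathlib

open scoped TensorProduct

universe u v w w'

namespace MCOp

/-- The sign `(-1)^p`, for `p` a parity. -/
def sg (k : Type u) [Field k] (p : ZMod 2) : k := if p = 0 then 1 else -1

/-- A dg (i.e. differential `ℤ/2`-graded) structure on a vector space `V` over a field of
characteristic zero. The `ℤ/2`-grading is recorded by the parity involution `par`, equal to `+1` on
the even part and to `-1` on the odd part; `d` is an odd differential. -/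
structure DGStructure (k : Type u) (V : Type v) [Field k] [AddCommGroup V] [Module k V] where
  par : V →ₗ[k] V
  d : V →ₗ[k] V
  par_par : ∀ v, par (par v) = v
  d_par : ∀ v, d (par v) = -par (d v)
  d_d : ∀ v, d (d v) = 0

/-- Given a parity involution, the projection onto the part of parity `p`. -/
noncomputable def hproj {k : Type u} {V : Type v} [Field k] [AddCommGroup V] [Module k V]
    (par : V →ₗ[k] V) (p : ZMod 2) : V →ₗ[k] V :=
  (2⁻¹ : k) • (LinearMap.id + sg k p • par)

/-- Given a parity involution, the operator `v ↦ (-1)^{p |v|} v`. -/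
def parPow {k : Type u} {V : Type v} [Field k] [AddCommGroup V] [Module k V]
    (par : V →ₗ[k] V) (p : ZMod 2) : V →ₗ[k] V :=
  if p = 0 then LinearMap.id else par

/-- The even part of a dg vector space. -/
def DGStructure.evenPart {k : Type u} {V : Type v} [Field k] [AddCommGroup V] [Module k V]
    (D : DGStructure k V) : Submodule k V := LinearMap.ker (D.par - LinearMap.id)

/-- The odd part of a dg vector space. -/
def DGStructure.oddPart {k : Type u} {V : Type v} [Field k] [AddCommGroup V] [Module k V]
    (D : DGStructure k V) : Submodule k V := LinearMap.ker (D.par + LinearMap.id)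

/-- In characteristic zero a parity involution is the same as a decomposition `V = V₀ ⊕ V₁`. -/
theorem DGStructure.isCompl_even_odd {k : Type u} {V : Type v} [Field k] [CharZero k]
    [AddCommGroup V] [Module k V] (D : DGStructure k V) : IsCompl D.evenPart D.oddPart := by
  constructor
  · rw [Submodule.disjoint_def]
    intro x hx hy
    simp only [evenPart, oddPart, LinearMap.mem_ker, LinearMap.sub_apply, LinearMap.add_apply,
      LinearMap.id_apply] at hx hy
    have h2 : (2 : k) • x = 0 := by
      rw [two_smul]
      have : D.par x = x := sub_eq_zero.1 hx
      rwa [this] at hy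
    exact (smul_eq_zero.1 h2).resolve_left two_ne_zero
  · rw [codisjoint_iff, eq_top_iff]
    intro x _
    rw [Submodule.mem_sup]
    refine ⟨(2⁻¹ : k) • (x + D.par x), ?_, (2⁻¹ : k) • (x - D.par x), ?_, ?_⟩
    · simp [evenPart, D.par_par, add_comm]
    · simp [oddPart, D.par_par]
    · rw [← smul_add, show x + D.par x + (x - D.par x) = (2 : k) • x by rw [two_smul]; abel,
        smul_smul, inv_mul_cancel₀ two_ne_zero, one_smul]

/-- The parity reversion `ΠV`: the same underlying space and differential, the opposite parity. -/
def DGStructure.parityShift {k : Type u} {V : Type v} [Field k] [AddCommGroup V] [Module k V]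
    (D : DGStructure k V) : DGStructure k V where
  par := -D.par
  d := D.d
  par_par v := by simp [D.par_par]
  d_par v := by simp [D.d_par]
  d_d := D.d_d

/-- A finite-dimensional nilpotent non-unital cdga. -/
structure NilpotentCDGA (k : Type u) [Field k] where
  carrier : Type v
  [ring : NonUnitalRing carrier]
  [module : Module k carrier]
  [tower : IsScalarTower k carrier carrier]
  [smulComm : SMulCommClass k carrier carrier]
  [finDim : FiniteDimensional k carrier]
  dg : DGStructure k carrier
  /-- The product is even. -/
  par_mul : ∀ a b, dg.par (a * b) = dg.par a * dg.par b
  /-- Graded commutativity, when one of the factors is even. -/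
  even_comm : ∀ a b, dg.par a = a → a * b = b * a
  /-- Graded commutativity, when both factors are odd. -/
  odd_comm : ∀ a b, dg.par a = -a → dg.par b = -b → a * b = -(b * a)
  /-- The Leibniz rule `d(ab) = d(a)b + (-1)^{|a|} a d(b)`. -/
  leibniz : ∀ a b, dg.d (a * b) = dg.d a * b + dg.par a * dg.d b
  /-- All products of sufficiently many elements vanish. -/
  nilpotent : ∃ N : ℕ, ∀ (a : carrier) (l : List carrier), l.length = N → l.foldl (· * ·) a = 0

attribute [instance] NilpotentCDGA.ring NilpotentCDGA.module NilpotentCDGA.tower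
  NilpotentCDGA.smulComm NilpotentCDGA.finDim

/-- A formal cdga `A`. By definition `A` is obtained by adjoining a unit to its augmentation ideal
`A₊`, a formal non-unital cdga, that is, the inverse limit of a system of finite-dimensional
nilpotent non-unital cdgas. The structure records this inverse system, which determines `A`. -/
structure FormalCDGA (k : Type u) [Field k] where
  I : Type w
  [preorder : Preorder I]
  [directed : IsDirectedOrder I]
  [nonempty : Nonempty I]
  alg : I → NilpotentCDGA.{u, v} k
  res : ∀ {i j : I}, i ≤ j → (alg j).carrier →ₗ[k] (alg i).carrier
  res_mul : ∀ {i j : I} (h : i ≤ j) (a b : (alg j).carrier), res h (a * b) = res h a * res h b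
  res_par : ∀ {i j : I} (h : i ≤ j) (a : (alg j).carrier),
    res h ((alg j).dg.par a) = (alg i).dg.par (res h a)
  res_d : ∀ {i j : I} (h : i ≤ j) (a : (alg j).carrier),
    res h ((alg j).dg.d a) = (alg i).dg.d (res h a)
  res_refl : ∀ (i : I) (a : (alg i).carrier), res (le_refl i) a = a
  res_res : ∀ {i j l : I} (h : i ≤ j) (h' : j ≤ l) (a : (alg l).carrier),
    res h (res h' a) = res (h.trans h') a

attribute [instance] FormalCDGA.preorder FormalCDGA.directed FormalCDGA.nonempty

/-! ### Operads -/

/-- The underlying data of a topological dg operad (without unit) in the partial composition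
format: the dg vector spaces `Ob n` of operations of arity `n = 0, 1, 2, …`, the compositions
`f ∘ᵢ g ∈ Ob (a + b - 1)` of `f ∈ Ob a` and `g ∈ Ob b` (the slot `i` is counted from `0`) and, when
`S = true`, the left actions of the symmetric groups. The case `S = true` is that of (symmetric)
operads and the case `S = false` that of non-symmetric operads. This structure only serves to
speak of maps between the specific operads constructed below. -/
structure OperadData (k : Type u) [Field k] (S : Bool) where
  Ob : ℕ → Type v
  [grp : ∀ n, AddCommGroup (Ob n)]
  [module : ∀ n, Module k (Ob n)]
  [top : ∀ n, TopologicalSpace (Ob n)]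
  par : ∀ n, Ob n →ₗ[k] Ob n
  d : ∀ n, Ob n →ₗ[k] Ob n
  comp : ∀ {a b c : ℕ}, a + b = c + 1 → Fin a → (Ob a →ₗ[k] Ob b →ₗ[k] Ob c)
  perm : S = true → ∀ {n : ℕ}, Equiv.Perm (Fin n) → (Ob n →ₗ[k] Ob n)

attribute [instance] OperadData.grp OperadData.module OperadData.top

/-- The operation `f ∘ (x ⊗ ⋯ ⊗ x)` of arity zero, for `f` of arity `n` and `x` of arity zero:
`x` is inserted in the last slot of `f`, then in the last but one, and so on. -/
def OperadData.fill {k : Type u} [Field k] {S : Bool} (P : OperadData.{u, v} k S) :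
    (n : ℕ) → P.Ob n → P.Ob 0 → P.Ob 0
  | 0, f, _ => f
  | n + 1, f, x => P.fill n (P.comp (Nat.add_zero (n + 1)) (Fin.last n) f x) x

/-- A (continuous) map of topological dg operads. -/
structure OperadHom {k : Type u} [Field k] {S : Bool} (P : OperadData.{u, v} k S)
    (Q : OperadData.{u, w} k S) where
  app : ∀ n, P.Ob n →ₗ[k] Q.Ob n
  map_par : ∀ {n} (f : P.Ob n), app n (P.par n f) = Q.par n (app n f)
  map_d : ∀ {n} (f : P.Ob n), app n (P.d n f) = Q.d n (app n f)
  map_comp : ∀ {a b c : ℕ} (h : a + b = c + 1) (i : Fin a) (f : P.Ob a) (g : P.Ob b),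
    app c (P.comp h i f g) = Q.comp h i (app a f) (app b g)
  map_perm : ∀ (hs : S = true) {n : ℕ} (σ : Equiv.Perm (Fin n)) (f : P.Ob n),
    app n (P.perm hs σ f) = Q.perm hs σ (app n f)
  cont : ∀ n, Continuous (app n)

/-- Composition of maps of operads. -/
def OperadHom.comp {k : Type u} [Field k] {S : Bool} {P : OperadData.{u, v} k S}
    {Q : OperadData.{u, w} k S} {R : OperadData.{u, w'} k S} (g : OperadHom Q R)
    (f : OperadHom P Q) : OperadHom P R where
  app n := (g.app n).comp (f.app n)
  map_par x := by simp [f.map_par, g.map_par]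
  map_d x := by simp [f.map_d, g.map_d]
  map_comp h i x y := by simp [f.map_comp, g.map_comp]
  map_perm hs _ σ x := by simp [f.map_perm, g.map_perm]
  cont n := (g.cont n).comp (f.cont n)

/-- An inverse system of topological dg operads. -/
structure OperadSystem (k : Type u) [Field k] (S : Bool) (I : Type w) [Preorder I] where
  obj : I → OperadData.{u, v} k S
  map : ∀ {i j : I}, i ≤ j → OperadHom (obj j) (obj i)
  map_refl : ∀ (i : I) {n} (f : (obj i).Ob n), (map (le_refl i)).app n f = f
  map_map : ∀ {i j l : I} (h : i ≤ j) (h' : j ≤ l) {n} (f : (obj l).Ob n),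
    (map h).app n ((map h').app n f) = (map (h.trans h')).app n f

/-- The compatible families of operations of arity `n` in an inverse system of operads. -/
def OperadSystem.limSpace {k : Type u} [Field k] {S : Bool} {I : Type w} [Preorder I]
    (Φ : OperadSystem.{u, v, w} k S I) (n : ℕ) : Submodule k (∀ i, (Φ.obj i).Ob n) where
  carrier := { f | ∀ (i j : I) (h : i ≤ j), (Φ.map h).app n (f j) = f i }
  add_mem' hf hg i j h := by simp [hf i j h, hg i j h]
  zero_mem' i j h := by simp
  smul_mem' c f hf i j h := by simp [hf i j h]

/-- The inverse limit of a system of topological dg operads: compatible families, with the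
componentwise operations and with the inverse limit topology. -/
def OperadSystem.lim {k : Type u} [Field k] {S : Bool} {I : Type w} [Preorder I]
    (Φ : OperadSystem.{u, v, w} k S I) : OperadData.{u, max v w} k S where
  Ob n := Φ.limSpace n
  top n := ⨅ i, TopologicalSpace.induced (fun f : Φ.limSpace n => f.1 i) ((Φ.obj i).top n)
  par n :=
    { toFun := fun f => ⟨fun i => (Φ.obj i).par n (f.1 i), fun i j h => by
        rw [(Φ.map h).map_par, f.2 i j h]⟩
      map_add' := fun f g => by ext i; simp
      map_smul' := fun c f => by ext i; simp }
  d n :=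
    { toFun := fun f => ⟨fun i => (Φ.obj i).d n (f.1 i), fun i j h => by
        rw [(Φ.map h).map_d, f.2 i j h]⟩
      map_add' := fun f g => by ext i; simp
      map_smul' := fun c f => by ext i; simp }
  comp {a b c} e s := LinearMap.mk₂ k
    (fun (f : Φ.limSpace a) (g : Φ.limSpace b) =>
      (⟨fun i => (Φ.obj i).comp e s (f.1 i) (g.1 i), fun i j h => by
        rw [(Φ.map h).map_comp, f.2 i j h, g.2 i j h]⟩ : Φ.limSpace c))
    (fun f f' g => by ext i; simp) (fun c f g => by ext i; simp)
    (fun f g g' => by ext i; simp) (fun c f g => by ext i; simp)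
  perm hs {n} σ :=
    { toFun := fun f => ⟨fun i => (Φ.obj i).perm hs σ (f.1 i), fun i j h => by
        rw [(Φ.map h).map_perm, f.2 i j h]⟩
      map_add' := fun f g => by ext i; simp
      map_smul' := fun c f => by ext i; simp }

/-! ### The endomorphism operad -/

/-- The arguments of `f` in the operation `f ∘ᵢ g`, evaluated at `v`: the arguments before the slot
`i` are acted upon by `s` (which accounts for the Koszul sign), and the slot `i` is filled with the
value of `g`. -/
def compArgs {k : Type u} {W : Type v} [Field k] [AddCommGroup W] [Module k W]
    {a b c : ℕ} (h : a + b = c + 1) (i : Fin a) (s : W →ₗ[k] W)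
    (g : MultilinearMap k (fun _ : Fin b => W) W) (v : Fin c → W) : Fin a → W := fun q =>
  if h₁ : q.val < i.val then s (v ⟨q.val, by omega⟩)
  else if h₂ : q.val = i.val then g (fun r : Fin b => v ⟨i.val + r.val, by omega⟩)
  else v ⟨q.val + b - 1, by omega⟩

theorem compArgs_update {k : Type u} {W : Type v} [Field k] [AddCommGroup W] [Module k W]
    {a b c : ℕ} (h : a + b = c + 1) (i : Fin a) (s : W →ₗ[k] W)
    (g : MultilinearMap k (fun _ : Fin b => W) W) (v : Fin c → W) (u : Fin c) :
    ∃ (q : Fin a) (L : W →ₗ[k] W), ∀ z,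
      compArgs h i s g (Function.update v u z) = Function.update (compArgs h i s g v) q (L z) := by
  by_cases h1 : u.val < i.val
  · refine ⟨⟨u.val, by omega⟩, s, fun z => ?_⟩
    funext q
    by_cases hq : q = ⟨u.val, by omega⟩
    · subst hq
      simp [compArgs, h1]
    · have hq' : q.val ≠ u.val := fun e => hq (Fin.ext e)
      rw [Function.update_of_ne hq]
      have e1 : ∀ r : Fin b, (⟨i.val + r.val, by omega⟩ : Fin c) ≠ u := fun r e => by
        have := congrArg Fin.val e; simp at this; omega
      unfold compArgs
      split_ifs with c1 c2
      · rw [Function.update_of_ne]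
        intro e; exact hq' (congrArg Fin.val e)
      · congr 1; funext r; rw [Function.update_of_ne (e1 r)]
      · rw [Function.update_of_ne]
        intro e; have := congrArg Fin.val e; simp at this; omega
  by_cases h2 : u.val < i.val + b
  · refine ⟨i, g.toLinearMap (fun r : Fin b => v ⟨i.val + r.val, by omega⟩)
      ⟨u.val - i.val, by omega⟩, fun z => ?_⟩
    funext q
    by_cases hq : q = i
    · subst hq
      simp only [compArgs, lt_irrefl, dite_false, dite_true, Function.update_self,
        MultilinearMap.toLinearMap_apply]
      congr 1
      funext r
      by_cases hr : r = ⟨u.val - q.val, by omega⟩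
      · subst hr
        have : (⟨q.val + (u.val - q.val), by omega⟩ : Fin c) = u := Fin.ext (by simp; omega)
        simp [this]
      · rw [Function.update_of_ne hr, Function.update_of_ne]
        intro e
        apply hr
        have := congrArg Fin.val e
        apply Fin.ext; simp at this ⊢; omega
    · have hq' : q.val ≠ i.val := fun e => hq (Fin.ext e)
      rw [Function.update_of_ne hq]
      unfold compArgs
      split_ifs with c1
      · rw [Function.update_of_ne]
        intro e; have := congrArg Fin.val e; simp at this; omega
      · rw [Function.update_of_ne]
        intro e; have := congrArg Fin.val e; simp at this; omega
  · refine ⟨⟨u.val + 1 - b, by omega⟩, LinearMap.id, fun z => ?_⟩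
    funext q
    by_cases hq : q = ⟨u.val + 1 - b, by omega⟩
    · subst hq
      rw [Function.update_self]
      have c1 : ¬ u.val + 1 - b < i.val := by omega
      have c2 : ¬ u.val + 1 - b = i.val := by omega
      have : (⟨u.val + 1 - b + b - 1, by omega⟩ : Fin c) = u := Fin.ext (by simp; omega)
      simp [compArgs, c1, c2, this]
    · have hq' : q.val ≠ u.val + 1 - b := fun e => hq (Fin.ext e)
      rw [Function.update_of_ne hq]
      unfold compArgs
      split_ifs with c1 c2
      · rw [Function.update_of_ne]
        intro e; have := congrArg Fin.val e; simp at this; omega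
      · congr 1; funext r
        rw [Function.update_of_ne]
        intro e; have := congrArg Fin.val e; simp at this; omega
      · rw [Function.update_of_ne]
        intro e; have := congrArg Fin.val e; simp at this; omega

/-- The multilinear map `v ↦ f (s v₀, …, s v_{i-1}, g (v_i, …, v_{i+b-1}), v_{i+b}, …)`. -/
def insertAt {k : Type u} {W : Type v} [Field k] [AddCommGroup W] [Module k W]
    {a b c : ℕ} (h : a + b = c + 1) (i : Fin a) (s : W →ₗ[k] W)
    (f : MultilinearMap k (fun _ : Fin a => W) W) (g : MultilinearMap k (fun _ : Fin b => W) W) :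
    MultilinearMap k (fun _ : Fin c => W) W where
  toFun v := f (compArgs h i s g v)
  map_update_add' {inst} v u z z' := by
    rw [Subsingleton.elim inst (instDecidableEqFin c)]
    obtain ⟨q, L, hL⟩ := compArgs_update h i s g v u
    simp [hL]
  map_update_smul' {inst} v u r z := by
    rw [Subsingleton.elim inst (instDecidableEqFin c)]
    obtain ⟨q, L, hL⟩ := compArgs_update h i s g v u
    simp [hL]

theorem compArgs_eq_update {k : Type u} {W : Type v} [Field k] [AddCommGroup W] [Module k W]
    {a b c : ℕ} (h : a + b = c + 1) (i : Fin a) (s : W →ₗ[k] W)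
    (g : MultilinearMap k (fun _ : Fin b => W) W) (v : Fin c → W) :
    compArgs h i s g v = Function.update (compArgs h i s 0 v) i
      (g (fun r : Fin b => v ⟨i.val + r.val, by omega⟩)) := by
  funext q
  by_cases hq : q = i
  · subst hq; simp [compArgs]
  · have hq' : q.val ≠ i.val := fun e => hq (Fin.ext e)
    rw [Function.update_of_ne hq]
    simp [compArgs, hq']

/-- `insertAt` as a bilinear map. -/
def insertAtₗ {k : Type u} {W : Type v} [Field k] [AddCommGroup W] [Module k W]
    {a b c : ℕ} (h : a + b = c + 1) (i : Fin a) (s : W →ₗ[k] W) :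
    MultilinearMap k (fun _ : Fin a => W) W →ₗ[k]
      MultilinearMap k (fun _ : Fin b => W) W →ₗ[k] MultilinearMap k (fun _ : Fin c => W) W :=
  LinearMap.mk₂ k (insertAt h i s)
    (fun f f' g => by ext v; simp [insertAt])
    (fun r f g => by ext v; simp [insertAt])
    (fun f g g' => by
      ext v
      simp only [insertAt, MultilinearMap.coe_mk, add_apply]
      rw [compArgs_eq_update h i s (g + g'), compArgs_eq_update h i s g,
        compArgs_eq_update h i s g']
      simp)
    (fun r f g => by
      ext v
      simp only [insertAt, MultilinearMap.coe_mk, smul_apply]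
      rw [compArgs_eq_update h i s (r • g), compArgs_eq_update h i s g]
      simp)

/-- The Koszul sign of the rearrangement `v₀ ⊗ ⋯ ⊗ v_{n-1} ↦ v_{σ 0} ⊗ ⋯ ⊗ v_{σ (n-1)}` of
elements `v_q` of parity `p q`. -/
def koszulSign (k : Type u) [Field k] {n : ℕ} (σ : Equiv.Perm (Fin n)) (p : Fin n → ZMod 2) : k :=
  ∏ q : Fin n, ∏ r : Fin n,
    if q < r ∧ σ r < σ q then sg k (p (σ q) * p (σ r)) else 1

/-- The parity involution of `Hom(W^{⊗ n}, W)`. -/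
def endPar {k : Type u} {W : Type v} [Field k] [AddCommGroup W] [Module k W]
    (D : DGStructure k W) {n : ℕ} :
    MultilinearMap k (fun _ : Fin n => W) W →ₗ[k] MultilinearMap k (fun _ : Fin n => W) W where
  toFun f := D.par.compMultilinearMap (f.compLinearMap fun _ => D.par)
  map_add' f g := by ext v; simp
  map_smul' r f := by ext v; simp

/-- The differential of `Hom(W^{⊗ n}, W)`. -/
def endDiff {k : Type u} {W : Type v} [Field k] [AddCommGroup W] [Module k W]
    (D : DGStructure k W) {n : ℕ} :
    MultilinearMap k (fun _ : Fin n => W) W →ₗ[k] MultilinearMap k (fun _ : Fin n => W) W where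
  toFun f := D.d.compMultilinearMap f -
    ∑ q : Fin n, (endPar D f).compLinearMap fun r =>
      if r < q then D.par else if r = q then D.d else LinearMap.id
  map_add' f g := by ext v; simp [Finset.sum_add_distrib]; abel
  map_smul' r f := by ext v; simp [Finset.smul_sum, smul_sub]

/-- The action of `σ` on `Hom(W^{⊗ n}, W)`; a general argument is decomposed into its even and odd
parts, to which the Koszul sign rule is applied. -/
noncomputable def endPerm {k : Type u} {W : Type v} [Field k] [AddCommGroup W] [Module k W]
    (D : DGStructure k W) {n : ℕ} (σ : Equiv.Perm (Fin n)) :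
    MultilinearMap k (fun _ : Fin n => W) W →ₗ[k] MultilinearMap k (fun _ : Fin n => W) W where
  toFun f := ∑ p : Fin n → ZMod 2, koszulSign k σ p •
    (f.domDomCongr σ).compLinearMap fun q => hproj D.par (p q)
  map_add' f g := by
    rw [← Finset.sum_add_distrib]
    refine Finset.sum_congr rfl fun p _ => ?_
    ext v; simp
  map_smul' r f := by
    simp only [Finset.smul_sum, RingHom.id_apply]
    refine Finset.sum_congr rfl fun p _ => ?_
    ext v; simp [smul_smul, mul_comm]

/-- The endomorphism operad `End(W)` of a dg vector space `W`, with
`End(W)(n) = Hom(W^{⊗ n}, W)` for `n = 0, 1, 2, …` (so that `End(W)(0) = W`):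
* `(par f)(v) = (-1)^{|f|} f(v)`;
* `(d f)(v) = d (f v) - (-1)^{|f|} ∑_q (-1)^{|v_0| + ⋯ + |v_{q-1}|} f (…, d v_q, …)`;
* `(f ∘ᵢ g)(v) = (-1)^{|g| (|v_0| + ⋯ + |v_{i-1}|)} f (…, v_{i-1}, g (v_i, …), …)`;
* `(σ f)(v) = ± f (v_{σ 0}, …, v_{σ (n-1)})`, with the Koszul sign.
The topology is discrete. -/
noncomputable def endOperad {k : Type u} {W : Type v} [Field k] [AddCommGroup W] [Module k W]
    (D : DGStructure k W) (S : Bool) : OperadData.{u, v} k S where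
  Ob n := MultilinearMap k (fun _ : Fin n => W) W
  top _ := ⊥
  par _ := endPar D
  d _ := endDiff D
  comp h i := ∑ p : ZMod 2, (insertAtₗ h i (parPow D.par p)).compl₂ (hproj (endPar D) p)
  perm _ _ σ := endPerm D σ

/-- The differential `d (a ⊗ f) = d a ⊗ f + (-1)^{|a|} a ⊗ d f` of `A ⊗ P`. -/
noncomputable def tensorDiff {k : Type u} [Field k] (A : NilpotentCDGA.{u, v} k) {S : Bool}
    (P : OperadData.{u, w} k S) (n : ℕ) :
    A.carrier ⊗[k] P.Ob n →ₗ[k] A.carrier ⊗[k] P.Ob n :=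
  TensorProduct.map A.dg.d LinearMap.id + TensorProduct.map A.dg.par (P.d n)

/-- The composition `(a ⊗ f) ∘ᵢ (b ⊗ g) = (-1)^{|f| |b|} a b ⊗ (f ∘ᵢ g)` of `A ⊗ P`. -/
noncomputable def tensorComp {k : Type u} [Field k] (A : NilpotentCDGA.{u, v} k) {S : Bool}
    (P : OperadData.{u, w} k S) {a b c : ℕ} (h : a + b = c + 1) (i : Fin a) :
    A.carrier ⊗[k] P.Ob a →ₗ[k] A.carrier ⊗[k] P.Ob b →ₗ[k] A.carrier ⊗[k] P.Ob c :=
  ∑ p : ZMod 2, TensorProduct.map₂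
    ((LinearMap.mul k A.carrier).compl₂ (hproj A.dg.par p))
    ((P.comp h i).comp (parPow (P.par a) p))

/-- The operad `A ⊗ P`, for a non-unital cdga `A` and an operad `P`, with the discrete topology. -/
noncomputable def tensorOperad {k : Type u} [Field k] (A : NilpotentCDGA.{u, v} k) {S : Bool}
    (P : OperadData.{u, w} k S) : OperadData.{u, max v w} k S where
  Ob n := A.carrier ⊗[k] P.Ob n
  top _ := ⊥
  par n := TensorProduct.map A.dg.par (P.par n)
  d n := tensorDiff A P n
  comp h i := tensorComp A P h i
  perm hs _ σ := TensorProduct.map LinearMap.id (P.perm hs σ)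

theorem tensorComp_map {k : Type u} [Field k] {A B : NilpotentCDGA.{u, v} k}
    (φ : A.carrier →ₗ[k] B.carrier) (φ_mul : ∀ a b, φ (a * b) = φ a * φ b)
    (φ_par : ∀ a, φ (A.dg.par a) = B.dg.par (φ a)) {S : Bool} (P : OperadData.{u, w} k S)
    {a b c : ℕ} (h : a + b = c + 1) (i : Fin a) (f : A.carrier ⊗[k] P.Ob a)
    (g : A.carrier ⊗[k] P.Ob b) :
    TensorProduct.map φ LinearMap.id (tensorComp A P h i f g) =
      tensorComp B P h i (TensorProduct.map φ LinearMap.id f)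
        (TensorProduct.map φ LinearMap.id g) := by
  induction f with
  | zero => simp
  | add x y hx hy => simp only [map_add, LinearMap.add_apply, hx, hy]
  | tmul a f =>
    induction g with
    | zero => simp
    | add x y hx hy => simp only [map_add, hx, hy]
    | tmul b g =>
      simp [tensorComp, LinearMap.sum_apply, hproj, φ_par, φ_mul]

/-- The map `A ⊗ P → B ⊗ P` induced by a map `A → B` of non-unital cdgas. -/
noncomputable def tensorHom {k : Type u} [Field k] {A B : NilpotentCDGA.{u, v} k}
    (φ : A.carrier →ₗ[k] B.carrier) (φ_mul : ∀ a b, φ (a * b) = φ a * φ b)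
    (φ_par : ∀ a, φ (A.dg.par a) = B.dg.par (φ a)) (φ_d : ∀ a, φ (A.dg.d a) = B.dg.d (φ a))
    {S : Bool} (P : OperadData.{u, w} k S) : OperadHom (tensorOperad A P) (tensorOperad B P) where
  app n := (TensorProduct.map φ LinearMap.id : A.carrier ⊗[k] P.Ob n →ₗ[k] B.carrier ⊗[k] P.Ob n)
  map_par {n} f := LinearMap.congr_fun
    (show (TensorProduct.map φ LinearMap.id).comp (TensorProduct.map A.dg.par (P.par n)) =
      (TensorProduct.map B.dg.par (P.par n)).comp (TensorProduct.map φ LinearMap.id) from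
        TensorProduct.ext' fun a f => by simp [φ_par]) f
  map_d {n} f := LinearMap.congr_fun
    (show (TensorProduct.map φ LinearMap.id).comp (tensorDiff A P n) =
      (tensorDiff B P n).comp (TensorProduct.map φ LinearMap.id) from
        TensorProduct.ext' fun a f => by simp [tensorDiff, φ_par, φ_d]) f
  map_comp {a b c} e s f g := tensorComp_map φ φ_mul φ_par P e s f g
  map_perm hs n σ f := LinearMap.congr_fun
    (show (TensorProduct.map φ LinearMap.id).comp
        (TensorProduct.map LinearMap.id (P.perm hs σ)) =
      (TensorProduct.map LinearMap.id (P.perm hs σ)).comp (TensorProduct.map φ LinearMap.id) from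
        TensorProduct.ext' fun a f => by simp) f
  cont n := continuous_bot

/-- The system of the operads `A_i ⊗ End(W)`, where `A₊` is the inverse limit of the `A_i`. -/
noncomputable def coeffSystem {k : Type u} {W : Type v} [Field k] [AddCommGroup W] [Module k W]
    (A : FormalCDGA.{u, w, w'} k) (D : DGStructure k W) (S : Bool) :
    OperadSystem.{u, max w v, w'} k S A.I where
  obj i := tensorOperad (A.alg i) (endOperad D S)
  map h := tensorHom (A.res h) (A.res_mul h) (A.res_par h) (A.res_d h) (endOperad D S)
  map_refl i n f := LinearMap.congr_fun
    (show (TensorProduct.map (A.res (le_refl i)) LinearMap.id :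
      (A.alg i).carrier ⊗[k] (endOperad D S).Ob n →ₗ[k] _) = LinearMap.id from
        TensorProduct.ext' fun a f => by simp [A.res_refl]) f
  map_map {i j l} h h' n f := LinearMap.congr_fun
    (show (TensorProduct.map (A.res h) LinearMap.id).comp (TensorProduct.map (A.res h')
        (LinearMap.id : (endOperad D S).Ob n →ₗ[k] _)) =
      TensorProduct.map (A.res (h.trans h')) LinearMap.id from
        TensorProduct.ext' fun a f => by simp [A.res_res]) f

/-- The topological dg operad `A₊ ⊗ End(W)`, the inverse limit of the operads `A_i ⊗ End(W)`, where
`A₊` is the inverse limit of the finite-dimensional nilpotent cdgas `A_i`. Its space of operations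
of arity zero is `A₊ ⊗ W`. -/
noncomputable def coeffOperad {k : Type u} {W : Type v} [Field k] [AddCommGroup W] [Module k W]
    (A : FormalCDGA.{u, w, w'} k) (D : DGStructure k W) (S : Bool) :
    OperadData.{u, max w v w'} k S := (coeffSystem A D S).lim

/-! ### The operads `L_∞`, `A_∞` and their extensions by a variable `x` -/

/-- Formal operadic monomials of arity `n` in the operations `m₁, m₂, …` (the constructor `m n` is
`m_{n+1}`), the variable `x` of arity zero (present when `X = true`), and, when `S = true`, the
actions of permutations. -/
inductive Mono (S X : Bool) : ℕ → Type
  | m (n : ℕ) : Mono S X (n + 1)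
  | x (hX : X = true) : Mono S X 0
  | comp {a b c : ℕ} (h : a + b = c + 1) (i : Fin a) (f : Mono S X a) (g : Mono S X b) : Mono S X c
  | perm (hS : S = true) {n : ℕ} (σ : Equiv.Perm (Fin n)) (f : Mono S X n) : Mono S X n

namespace Mono

variable {S X : Bool}

/-- The parity of a monomial: each `m_n` is odd and `x` is even. -/
def deg : {n : ℕ} → Mono S X n → ZMod 2
  | _, m _ => 1
  | _, x _ => 0
  | _, comp _ _ f g => f.deg + g.deg
  | _, perm _ _ f => f.deg

/-- The number of occurrences of `x` in a monomial. -/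
def wt : {n : ℕ} → Mono S X n → ℕ
  | _, m _ => 0
  | _, x _ => 1
  | _, comp _ _ f g => f.wt + g.wt
  | _, perm _ _ f => f.wt

/-- The monomial `f ∘ (u ⊗ ⋯ ⊗ u)` of arity zero. -/
def fill : (n : ℕ) → Mono S X n → Mono S X 0 → Mono S X 0
  | 0, f, _ => f
  | n + 1, f, u => fill n (comp (Nat.add_zero (n + 1)) (Fin.last n) f u) u

end Mono

/-- In `f ∘ᵢ g`, with `g` of arity `b`, the position of the input of `f` numbered `q ≠ i`. -/
def outerPos (i b q : ℕ) : ℕ := if q < i then q else q + b - 1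

/-- `ρ` is the permutation for which `(σ f) ∘_{σ i} (τ g) = ρ (f ∘ᵢ g)`: it permutes the inputs of
`g`, which form a block, by `τ`, and it permutes this block and the other inputs of `f` by `σ`. -/
def IsBlockPerm {a b c : ℕ} (i : Fin a) (σ : Equiv.Perm (Fin a)) (τ : Equiv.Perm (Fin b))
    (ρ : Equiv.Perm (Fin c)) : Prop :=
  (∀ (s : Fin b) (u : Fin c), u.val = i.val + s.val → (ρ u).val = (σ i).val + (τ s).val) ∧
  (∀ (q : Fin a) (u : Fin c), q ≠ i → u.val = outerPos i.val b q.val →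
    (ρ u).val = outerPos (σ i).val b (σ q).val)

/-- The defining relations of the free operad: `Rel f g s` stands for the relation
`f = (-1)^s g`. These are the operad axioms, the invariance of the `m_n` under permutations, and
their consequences under compositions and permutations. -/
inductive Rel {S X : Bool} : {n : ℕ} → Mono S X n → Mono S X n → ZMod 2 → Prop
  | seq {a b c e e' r : ℕ} (h₁ : a + b = e + 1) (h₂ : e + c = r + 1) (h₃ : b + c = e' + 1)
      (h₄ : a + e' = r + 1) (i : Fin a) (j : Fin b) (p : Fin e) (hp : p.val = i.val + j.val)
      (f : Mono S X a) (g : Mono S X b) (h : Mono S X c) :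
      Rel (.comp h₂ p (.comp h₁ i f g) h) (.comp h₄ i f (.comp h₃ j g h)) 0
  | par {a b c e e' r : ℕ} (h₁ : a + b = e + 1) (h₂ : e + c = r + 1) (h₃ : a + c = e' + 1)
      (h₄ : e' + b = r + 1) (i j : Fin a) (hij : i < j) (p : Fin e) (hp : p.val + 1 = j.val + b)
      (q : Fin e') (hq : q.val = i.val)
      (f : Mono S X a) (g : Mono S X b) (h : Mono S X c) :
      Rel (.comp h₂ p (.comp h₁ i f g) h) (.comp h₄ q (.comp h₃ j f h) g) (g.deg * h.deg)
  | equivariant {a b c : ℕ} (hS : S = true) (h₁ : a + b = c + 1) (i : Fin a)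
      (σ : Equiv.Perm (Fin a)) (τ : Equiv.Perm (Fin b)) (ρ : Equiv.Perm (Fin c))
      (hρ : IsBlockPerm i σ τ ρ) (f : Mono S X a) (g : Mono S X b) :
      Rel (.comp h₁ (σ i) (.perm hS σ f) (.perm hS τ g)) (.perm hS ρ (.comp h₁ i f g)) 0
  | perm_mul {n : ℕ} (hS : S = true) (σ τ : Equiv.Perm (Fin n)) (f : Mono S X n) :
      Rel (.perm hS σ (.perm hS τ f)) (.perm hS (σ * τ) f) 0
  | perm_one {n : ℕ} (hS : S = true) (f : Mono S X n) : Rel (.perm hS 1 f) f 0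
  | perm_m (hS : S = true) (n : ℕ) (σ : Equiv.Perm (Fin (n + 1))) :
      Rel (.perm hS σ (.m n)) (.m n) 0
  | comp_left {a b c : ℕ} (h : a + b = c + 1) (i : Fin a) {f f' : Mono S X a} (g : Mono S X b)
      {s : ZMod 2} : Rel f f' s → Rel (.comp h i f g) (.comp h i f' g) s
  | comp_right {a b c : ℕ} (h : a + b = c + 1) (i : Fin a) (f : Mono S X a) {g g' : Mono S X b}
      {s : ZMod 2} : Rel g g' s → Rel (.comp h i f g) (.comp h i f g') s
  | perm_congr {n : ℕ} (hS : S = true) (σ : Equiv.Perm (Fin n)) {f f' : Mono S X n}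
      {s : ZMod 2} : Rel f f' s → Rel (.perm hS σ f) (.perm hS σ f') s

theorem Rel.deg_eq {S X : Bool} {n : ℕ} {f g : Mono S X n} {s : ZMod 2} (h : Rel f g s) :
    f.deg = g.deg := by
  induction h <;> simp_all [Mono.deg] <;> ring

theorem Rel.wt_eq {S X : Bool} {n : ℕ} {f g : Mono S X n} {s : ZMod 2} (h : Rel f g s) :
    f.wt = g.wt := by
  induction h <;> simp_all [Mono.wt] <;> ring

/-- The linear combinations of monomials that vanish in the free operad modulo `(x)^N`. -/
noncomputable def relSpace (k : Type u) [Field k] (S X : Bool) (N : ℕ∞) (n : ℕ) :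
    Submodule k (Mono S X n →₀ k) :=
  Submodule.span k
    ({ z | ∃ (f g : Mono S X n) (s : ZMod 2), Rel f g s ∧
        z = Finsupp.single f 1 - sg k s • Finsupp.single g 1 } ∪
      { z | ∃ f : Mono S X n, N ≤ (f.wt : ℕ∞) ∧ z = Finsupp.single f 1 })

/-- The operations of arity `n` in the free operad on the odd operations `m₁, m₂, …` and, when
`X = true`, on the variable `x`, modulo the power `(x)^N` of the ideal `(x)`, which is spanned by
the monomials with at least `N` occurrences of `x`. For `N = ⊤` there is no truncation. When
`S = true` this is a symmetric operad and `m_n` is invariant under the symmetric group `S_n`; when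
`S = false` this is a non-symmetric operad. -/
abbrev FreeOp (k : Type u) [Field k] (S X : Bool) (N : ℕ∞) (n : ℕ) : Type u :=
  (Mono S X n →₀ k) ⧸ relSpace k S X N n

namespace FreeOp

variable {k : Type u} [Field k] {S X : Bool} {N : ℕ∞}

/-- The class of a monomial. -/
noncomputable def mk (N : ℕ∞) {n : ℕ} (f : Mono S X n) : FreeOp k S X N n :=
  (relSpace k S X N n).mkQ (Finsupp.single f 1)

theorem mk_rel {n : ℕ} {f g : Mono S X n} {s : ZMod 2} (h : Rel f g s) :
    (mk N f : FreeOp k S X N n) = sg k s • mk N g := by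
  rw [mk, mk, ← map_smul, ← sub_eq_zero, ← map_sub, Submodule.mkQ_apply,
    Submodule.Quotient.mk_eq_zero]
  exact Submodule.subset_span (Or.inl ⟨f, g, s, h, rfl⟩)

theorem mk_wt {n : ℕ} {f : Mono S X n} (h : N ≤ (f.wt : ℕ∞)) :
    (mk N f : FreeOp k S X N n) = 0 := by
  rw [mk, Submodule.mkQ_apply, Submodule.Quotient.mk_eq_zero]
  exact Submodule.subset_span (Or.inr ⟨f, h, rfl⟩)

/-- Linear maps out of `FreeOp` are given by their values on monomials. -/
noncomputable def lift {M : Type v} [AddCommGroup M] [Module k M] {n : ℕ} (φ : Mono S X n → M)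
    (h₁ : ∀ f g s, Rel f g s → φ f = sg k s • φ g) (h₂ : ∀ f, N ≤ (f.wt : ℕ∞) → φ f = 0) :
    FreeOp k S X N n →ₗ[k] M :=
  (relSpace k S X N n).liftQ (Finsupp.linearCombination k φ) (by
    rw [relSpace, Submodule.span_le]
    rintro z (⟨f, g, s, h, rfl⟩ | ⟨f, h, rfl⟩)
    · simp [h₁ f g s h]
    · simp [h₂ f h])

@[simp] theorem lift_mk {M : Type v} [AddCommGroup M] [Module k M] {n : ℕ} (φ : Mono S X n → M)
    (h₁ : ∀ f g s, Rel f g s → φ f = sg k s • φ g) (h₂ : ∀ f, N ≤ (f.wt : ℕ∞) → φ f = 0)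
    (f : Mono S X n) : lift φ h₁ h₂ (mk N f) = φ f := by
  rw [mk, lift, Submodule.mkQ_apply, Submodule.liftQ_apply]
  simp

theorem ext {M : Type v} [AddCommGroup M] [Module k M] {n : ℕ} {φ ψ : FreeOp k S X N n →ₗ[k] M}
    (h : ∀ f, φ (mk N f) = ψ (mk N f)) : φ = ψ := by
  apply Submodule.linearMap_qext
  apply Finsupp.lhom_ext'
  intro f
  apply LinearMap.ext_ring
  simpa [mk] using h f

/-- The parity involution. -/
noncomputable def par (n : ℕ) : FreeOp k S X N n →ₗ[k] FreeOp k S X N n :=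
  lift (fun f => sg k f.deg • mk N f)
    (fun _ _ _ h => by rw [mk_rel h, h.deg_eq, smul_comm])
    (fun _ h => by rw [mk_wt h, smul_zero])

/-- The action of permutations. -/
noncomputable def perm (hS : S = true) {n : ℕ} (σ : Equiv.Perm (Fin n)) :
    FreeOp k S X N n →ₗ[k] FreeOp k S X N n :=
  lift (fun f => mk N (.perm hS σ f))
    (fun _ _ _ h => mk_rel (h.perm_congr hS σ))
    (fun _ h => mk_wt h)

/-- The composition `∘ᵢ`. -/
noncomputable def comp {a b c : ℕ} (h : a + b = c + 1) (i : Fin a) :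
    FreeOp k S X N a →ₗ[k] FreeOp k S X N b →ₗ[k] FreeOp k S X N c :=
  lift (fun f => lift (fun g => mk N (.comp h i f g))
      (fun g g' s hg => mk_rel (hg.comp_right h i f))
      (fun g hg => mk_wt (hg.trans (by simp [Mono.wt]))))
    (fun f f' s hf => ext fun g => by simpa using mk_rel (hf.comp_left h i g))
    (fun f hf => ext fun g => by simpa using mk_wt (hf.trans (by simp [Mono.wt])))

@[simp] theorem par_mk {n : ℕ} (f : Mono S X n) :
    par n (mk N f : FreeOp k S X N n) = sg k f.deg • mk N f := by simp [par]

@[simp] theorem perm_mk (hS : S = true) {n : ℕ} (σ : Equiv.Perm (Fin n)) (f : Mono S X n) :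
    perm hS σ (mk N f : FreeOp k S X N n) = mk N (.perm hS σ f) := by simp [perm]

@[simp] theorem comp_mk {a b c : ℕ} (h : a + b = c + 1) (i : Fin a) (f : Mono S X a)
    (g : Mono S X b) :
    comp h i (mk N f : FreeOp k S X N a) (mk N g) = mk N (.comp h i f g) := by simp [comp]

end FreeOp

/-- `σ` is a `(p, n - p)`-shuffle: it is increasing on the first `p` and on the last `n - p`
elements. -/
def IsShuffle {n : ℕ} (p : ℕ) (σ : Equiv.Perm (Fin n)) : Prop :=
  ∀ q r : Fin n, q < r → (r.val < p ∨ p ≤ q.val) → σ q < σ r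

instance {n : ℕ} (p : ℕ) : DecidablePred (IsShuffle (n := n) p) := fun σ => by
  unfold IsShuffle; infer_instance

namespace FreeOp

variable {k : Type u} [Field k] {S X : Bool} {N : ℕ∞}

/-- The differential of `m_{n+1}`. In the non-symmetric case,
`d m_{n+1} = ∑_{a + b = n} ∑_{i} m_{a+1} ∘ᵢ m_{b+1}`; in the symmetric case,
`d m_{n+1} = ∑_{a + b = n} ∑_σ σ (m_{a+1} ∘₁ m_{b+1})`, over all `(b + 1, a)`-shuffles `σ`. -/
noncomputable def diffM (k : Type u) [Field k] (S X : Bool) (N : ℕ∞) (n : ℕ) :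
    FreeOp k S X N (n + 1) :=
  if hS : S = true then
    ∑ a : Fin (n + 1), ∑ σ : Equiv.Perm (Fin (n + 1)) with IsShuffle (n - a.val + 1) σ,
      mk N (.perm hS σ (.comp (by omega) 0 (.m a.val) (.m (n - a.val))))
  else
    ∑ a : Fin (n + 1), ∑ i : Fin (a.val + 1),
      mk N (.comp (by omega) i (.m a.val) (.m (n - a.val)))

/-- The coefficient of `m_n ∘ (x ⊗ ⋯ ⊗ x)` in the differential of `x`: `1 / n!` in the symmetric
case, `1` in the non-symmetric case. -/
noncomputable def coeff (k : Type u) [Field k] (S : Bool) (n : ℕ) : k :=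
  if S = true then (n.factorial : k)⁻¹ else 1

/-- The differential `d x = ∑_{n ≥ 1} c_n m_n ∘ (x ⊗ ⋯ ⊗ x)`, with `c_n = 1 / n!` in the symmetric
case and `c_n = 1` in the non-symmetric case, modulo `(x)^N`: the terms with `n > N` vanish. -/
noncomputable def diffX (k : Type u) [Field k] (S X : Bool) (hX : X = true) (N : ℕ∞) :
    FreeOp k S X N 0 :=
  ∑ n ∈ Finset.range N.toNat, coeff k S (n + 1) • mk N (Mono.fill (n + 1) (.m n) (.x hX))

/-- The differential of a monomial, by the Leibniz rule
`d (f ∘ᵢ g) = d f ∘ᵢ g + (-1)^{|f|} f ∘ᵢ d g`. -/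
noncomputable def diffMono (k : Type u) [Field k] {S X : Bool} (N : ℕ∞) :
    {n : ℕ} → Mono S X n → FreeOp k S X N n
  | _, .m n => diffM k S X N n
  | _, .x hX => diffX k S X hX N
  | _, .comp h i f g =>
      comp h i (diffMono k N f) (mk N g) + sg k f.deg • comp h i (mk N f) (diffMono k N g)
  | _, .perm hS σ f => perm hS σ (diffMono k N f)

end FreeOp
theorem sg_add (k : Type u) [Field k] (p q : ZMod 2) : sg k (p + q) = sg k p * sg k q := by
  have h : (1 : ZMod 2) + 1 = 0 := by decide
  have h01 : ∀ r : ZMod 2, r = 0 ∨ r = 1 := by decide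
  rcases h01 p with rfl | rfl <;> rcases h01 q with rfl | rfl <;> simp [sg, h]

theorem sg_mul_self (k : Type u) [Field k] (p : ZMod 2) : sg k p * sg k p = 1 := by
  unfold sg; split_ifs <;> simp

theorem sg_one (k : Type u) [Field k] : sg k 1 = -1 := by simp [sg]

theorem sg_zero (k : Type u) [Field k] : sg k 0 = 1 := by simp [sg]

namespace FreeOp

variable {k : Type u} [Field k] {S X : Bool} {N : ℕ∞}

@[elab_as_elim]
theorem induction {n : ℕ} {p : FreeOp k S X N n → Prop} (u : FreeOp k S X N n) (zero : p 0)
    (mk : ∀ f, p (mk N f)) (add : ∀ u v, p u → p v → p (u + v))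
    (smul : ∀ (c : k) u, p u → p (c • u)) : p u := by
  obtain ⟨z, rfl⟩ := Submodule.mkQ_surjective _ u
  induction z using Finsupp.induction_linear with
  | zero => rwa [map_zero]
  | add f g hf hg => rw [map_add]; exact add _ _ hf hg
  | single f c =>
    have : Finsupp.single f c = c • Finsupp.single f (1 : k) := by simp
    rw [this, map_smul]
    exact smul _ _ (mk f)

/-! #### The operad axioms in the free operads -/

theorem comp_seq {a b c e e' r : ℕ} (h₁ : a + b = e + 1) (h₂ : e + c = r + 1) (h₃ : b + c = e' + 1)
    (h₄ : a + e' = r + 1) (i : Fin a) (j : Fin b) (p : Fin e) (hp : p.val = i.val + j.val)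
    (u : FreeOp k S X N a) (v : FreeOp k S X N b) (w : FreeOp k S X N c) :
    comp h₂ p (comp h₁ i u v) w = comp h₄ i u (comp h₃ j v w) := by
  induction u using induction with
  | zero => simp
  | add u u' hu hu' => simp only [map_add, LinearMap.add_apply, hu, hu']
  | smul t u hu => simp only [map_smul, LinearMap.smul_apply, hu]
  | mk f =>
    induction v using induction with
    | zero => simp
    | add u u' hu hu' => simp only [map_add, LinearMap.add_apply, hu, hu']
    | smul t u hu => simp only [map_smul, LinearMap.smul_apply, hu]
    | mk g =>
      induction w using induction with
      | zero => simp
      | add u u' hu hu' => simp only [map_add, hu, hu']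
      | smul t u hu => simp only [map_smul, hu]
      | mk h => simpa [sg_zero] using mk_rel (k := k) (N := N) (Rel.seq h₁ h₂ h₃ h₄ i j p hp f g h)

theorem comp_par {a b c e e' r : ℕ} (h₁ : a + b = e + 1) (h₂ : e + c = r + 1) (h₃ : a + c = e' + 1)
    (h₄ : e' + b = r + 1) (i j : Fin a) (hij : i < j) (p : Fin e) (hp : p.val + 1 = j.val + b)
    (q : Fin e') (hq : q.val = i.val) (u : FreeOp k S X N a) (g : Mono S X b) (h : Mono S X c) :
    comp h₂ p (comp h₁ i u (mk N g)) (mk N h) =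
      sg k (g.deg * h.deg) • comp h₄ q (comp h₃ j u (mk N h)) (mk N g) := by
  induction u using induction with
  | zero => simp
  | add u u' hu hu' => simp only [map_add, LinearMap.add_apply, hu, hu', smul_add]
  | smul t u hu => simp only [map_smul, LinearMap.smul_apply, hu, smul_comm t]
  | mk f => simpa using mk_rel (k := k) (N := N) (Rel.par h₁ h₂ h₃ h₄ i j hij p hp q hq f g h)

theorem parPow_mk (s : ZMod 2) {n : ℕ} (f : Mono S X n) :
    parPow (par n) s (mk N f : FreeOp k S X N n) = sg k (s * f.deg) • mk N f := by
  have h01 : s = 0 ∨ s = 1 := by revert s; decide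
  rcases h01 with rfl | rfl <;> simp [parPow, sg_zero]

theorem parPow_of (s t : ZMod 2) {n : ℕ} (u : FreeOp k S X N n) (hu : par n u = sg k t • u) :
    parPow (par n) s u = sg k (s * t) • u := by
  have h01 : s = 0 ∨ s = 1 := by revert s; decide
  rcases h01 with rfl | rfl <;> simp [parPow, sg_zero, hu]

theorem comp_par_left {a b c e e' r : ℕ} (h₁ : a + b = e + 1) (h₂ : e + c = r + 1)
    (h₃ : a + c = e' + 1) (h₄ : e' + b = r + 1) (i j : Fin a) (hij : i < j) (p : Fin e)
    (hp : p.val + 1 = j.val + b) (q : Fin e') (hq : q.val = i.val) (f : Mono S X a)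
    (v : FreeOp k S X N b) (h : Mono S X c) :
    comp h₂ p (comp h₁ i (mk N f) v) (mk N h) =
      comp h₄ q (comp h₃ j (mk N f) (mk N h)) (parPow (par b) h.deg v) := by
  induction v using induction with
  | zero => simp
  | add u u' hu hu' => simp only [map_add, LinearMap.add_apply, hu, hu']
  | smul t u hu => simp only [map_smul, LinearMap.smul_apply, hu]
  | mk g => rw [comp_par h₁ h₂ h₃ h₄ i j hij p hp q hq, parPow_mk, map_smul, mul_comm]

theorem comp_par_right {a b c e e' r : ℕ} (h₁ : a + b = e + 1) (h₂ : e + c = r + 1)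
    (h₃ : a + c = e' + 1) (h₄ : e' + b = r + 1) (i j : Fin a) (hij : i < j) (p : Fin e)
    (hp : p.val + 1 = j.val + b) (q : Fin e') (hq : q.val = i.val) (f : Mono S X a)
    (g : Mono S X b) (w : FreeOp k S X N c) :
    comp h₂ p (comp h₁ i (mk N f) (mk N g)) w =
      comp h₄ q (comp h₃ j (mk N f) (parPow (par c) g.deg w)) (mk N g) := by
  induction w using induction with
  | zero => simp
  | add u u' hu hu' => simp only [map_add, LinearMap.add_apply, hu, hu']
  | smul t u hu => simp only [map_smul, LinearMap.smul_apply, hu]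
  | mk h => rw [comp_par h₁ h₂ h₃ h₄ i j hij p hp q hq, parPow_mk, map_smul, map_smul,
      LinearMap.smul_apply]

theorem comp_equivariant {a b c : ℕ} (hS : S = true) (h₁ : a + b = c + 1) (i : Fin a)
    (σ : Equiv.Perm (Fin a)) (τ : Equiv.Perm (Fin b)) (ρ : Equiv.Perm (Fin c))
    (hρ : IsBlockPerm i σ τ ρ) (u : FreeOp k S X N a) (v : FreeOp k S X N b) :
    comp h₁ (σ i) (perm hS σ u) (perm hS τ v) = perm hS ρ (comp h₁ i u v) := by
  induction u using induction with
  | zero => simp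
  | add u u' hu hu' => simp only [map_add, LinearMap.add_apply, hu, hu']
  | smul t u hu => simp only [map_smul, LinearMap.smul_apply, hu]
  | mk f =>
    induction v using induction with
    | zero => simp
    | add u u' hu hu' => simp only [map_add, hu, hu']
    | smul t u hu => simp only [map_smul, hu]
    | mk g => simpa [sg_zero] using
        mk_rel (k := k) (N := N) (Rel.equivariant hS h₁ i σ τ ρ hρ f g)

theorem perm_perm (hS : S = true) {n : ℕ} (σ τ : Equiv.Perm (Fin n)) (u : FreeOp k S X N n) :
    perm hS σ (perm hS τ u) = perm hS (σ * τ) u := by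
  induction u using induction with
  | zero => simp
  | add u u' hu hu' => simp only [map_add, hu, hu']
  | smul t u hu => simp only [map_smul, hu]
  | mk f => simpa [sg_zero] using mk_rel (k := k) (N := N) (Rel.perm_mul hS σ τ f)

theorem perm_one (hS : S = true) {n : ℕ} (u : FreeOp k S X N n) : perm hS 1 u = u := by
  induction u using induction with
  | zero => simp
  | add u u' hu hu' => simp only [map_add, hu, hu']
  | smul t u hu => simp only [map_smul, hu]
  | mk f => simpa [sg_zero] using mk_rel (k := k) (N := N) (Rel.perm_one hS f)

theorem par_comp {a b c : ℕ} (h : a + b = c + 1) (i : Fin a) (u : FreeOp k S X N a)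
    (v : FreeOp k S X N b) : par c (comp h i u v) = comp h i (par a u) (par b v) := by
  induction u using induction with
  | zero => simp
  | add u u' hu hu' => simp only [map_add, LinearMap.add_apply, hu, hu']
  | smul t u hu => simp only [map_smul, LinearMap.smul_apply, hu]
  | mk f =>
    induction v using induction with
    | zero => simp
    | add u u' hu hu' => simp only [map_add, hu, hu']
    | smul t u hu => simp only [map_smul, hu]
    | mk g => simp [Mono.deg, sg_add, smul_smul, mul_comm]

theorem par_perm (hS : S = true) {n : ℕ} (σ : Equiv.Perm (Fin n)) (u : FreeOp k S X N n) :
    par n (perm hS σ u) = perm hS σ (par n u) := by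
  induction u using induction with
  | zero => simp
  | add u u' hu hu' => simp only [map_add, hu, hu']
  | smul t u hu => simp only [map_smul, hu]
  | mk f => simp [Mono.deg]

/-! #### The differential is homogeneous and does not decrease the number of occurrences of `x` -/

theorem par_diffM (n : ℕ) : par (n + 1) (diffM k S X N n) = diffM k S X N n := by
  have h2 : (1 : ZMod 2) + 1 = 0 := by decide
  unfold diffM
  split_ifs with hS <;> simp [Mono.deg, h2, sg_zero]

theorem deg_fill (n : ℕ) (f : Mono S X n) (u : Mono S X 0) (hu : u.deg = 0) :
    (Mono.fill n f u).deg = f.deg := by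
  induction n with
  | zero => rfl
  | succ n ih => rw [Mono.fill, ih]; simp [Mono.deg, hu]

theorem wt_fill (n : ℕ) (f : Mono S X n) (u : Mono S X 0) :
    (Mono.fill n f u).wt = f.wt + n * u.wt := by
  induction n with
  | zero => simp [Mono.fill]
  | succ n ih => rw [Mono.fill, ih]; simp [Mono.wt]; ring

theorem par_diffX (hX : X = true) : par 0 (diffX k S X hX N) = -diffX k S X hX N := by
  have h (n : ℕ) : (Mono.fill (n + 1) (.m n) (.x hX) : Mono S X 0).deg = 1 := deg_fill _ _ _ rfl
  simp [diffX, h, sg_one]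

theorem par_diffMono {n : ℕ} (f : Mono S X n) :
    par n (diffMono k N f) = sg k (f.deg + 1) • diffMono k N f := by
  have h2 : (1 : ZMod 2) + 1 = 0 := by decide
  induction f with
  | m n => simp [diffMono, par_diffM, Mono.deg, h2, sg_zero]
  | x hX => simp [diffMono, par_diffX, Mono.deg, sg_one]
  | comp h i f g hf hg =>
    simp only [diffMono, Mono.deg, map_add, map_smul, par_comp, hf, hg, par_mk,
      LinearMap.smul_apply, smul_add, smul_smul, sg_add]
    congr 2 <;> ring
  | perm hS σ f hf => simp [diffMono, par_perm, hf, Mono.deg]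

/-- The span of the monomials with at least `w` occurrences of `x`. -/
noncomputable def filt (k : Type u) [Field k] (S X : Bool) (N : ℕ∞) (w n : ℕ) :
    Submodule k (FreeOp k S X N n) :=
  Submodule.span k { u | ∃ f : Mono S X n, w ≤ f.wt ∧ u = mk N f }

theorem mk_mem_filt {n w : ℕ} {f : Mono S X n} (h : w ≤ f.wt) :
    (mk N f : FreeOp k S X N n) ∈ filt k S X N w n := Submodule.subset_span ⟨f, h, rfl⟩

theorem filt_eq_bot {n w : ℕ} (h : N ≤ (w : ℕ∞)) : filt k S X N w n = ⊥ := by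
  rw [filt, Submodule.span_eq_bot]
  rintro _ ⟨f, hf, rfl⟩
  exact mk_wt (h.trans (by exact_mod_cast hf))

theorem comp_mem_filt {a b c w w' : ℕ} (h : a + b = c + 1) (i : Fin a) {u : FreeOp k S X N a}
    {v : FreeOp k S X N b} (hu : u ∈ filt k S X N w a) (hv : v ∈ filt k S X N w' b) :
    comp h i u v ∈ filt k S X N (w + w') c := by
  induction hu using Submodule.span_induction with
  | zero => simp
  | add u u' _ _ hu hu' =>
    rw [map_add, LinearMap.add_apply]; exact Submodule.add_mem _ hu hu'
  | smul t u _ hu => rw [map_smul, LinearMap.smul_apply]; exact Submodule.smul_mem _ _ hu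
  | mem u hu =>
    obtain ⟨f, hf, rfl⟩ := hu
    induction hv using Submodule.span_induction with
    | zero => simp
    | add u u' _ _ hu hu' => rw [map_add]; exact Submodule.add_mem _ hu hu'
    | smul t u _ hu => rw [map_smul]; exact Submodule.smul_mem _ _ hu
    | mem v hv =>
      obtain ⟨g, hg, rfl⟩ := hv
      rw [comp_mk]
      exact mk_mem_filt (by simp only [Mono.wt]; omega)

theorem perm_mem_filt (hS : S = true) {n w : ℕ} (σ : Equiv.Perm (Fin n)) {u : FreeOp k S X N n}
    (hu : u ∈ filt k S X N w n) : perm hS σ u ∈ filt k S X N w n := by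
  induction hu using Submodule.span_induction with
  | zero => simp
  | add u u' _ _ hu hu' => rw [map_add]; exact Submodule.add_mem _ hu hu'
  | smul t u _ hu => rw [map_smul]; exact Submodule.smul_mem _ _ hu
  | mem u hu =>
    obtain ⟨f, hf, rfl⟩ := hu
    rw [perm_mk]
    exact mk_mem_filt (by simpa only [Mono.wt] using hf)

theorem mem_filt_zero {n : ℕ} (u : FreeOp k S X N n) : u ∈ filt k S X N 0 n := by
  induction u using induction with
  | zero => simp
  | add u u' hu hu' => exact Submodule.add_mem _ hu hu'
  | smul t u hu => exact Submodule.smul_mem _ _ hu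
  | mk f => exact mk_mem_filt (Nat.zero_le _)

theorem diffMono_mem_filt {n : ℕ} (f : Mono S X n) :
    diffMono k N f ∈ filt k S X N f.wt n := by
  induction f with
  | m n => exact mem_filt_zero _
  | x hX =>
    change diffX k S X hX N ∈ _
    rw [diffX]
    refine Submodule.sum_mem _ fun n _ => Submodule.smul_mem _ _ (mk_mem_filt ?_)
    rw [wt_fill]; simp [Mono.wt]
  | comp h i f g hf hg =>
    exact Submodule.add_mem _ (comp_mem_filt h i hf (mk_mem_filt (k := k) le_rfl))
      (Submodule.smul_mem _ _ (comp_mem_filt h i (mk_mem_filt (k := k) le_rfl) hg))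
  | perm hS σ f hf => exact perm_mem_filt hS σ hf

/-! #### The symmetry of the differential of `m_n` -/

/-- A permutation preserving the first `b + 1` elements acts trivially on `m_{a+1} ∘₁ m_{b+1}`. -/
theorem perm_m_comp_m (hS : S = true) {n a b : ℕ} (hab : (a + 1) + (b + 1) = n + 1)
    (h : Equiv.Perm (Fin n)) (hh : ∀ q, (h q).val < b + 1 ↔ q.val < b + 1) :
    perm hS h (mk N (.comp hab 0 (.m a) (.m b)) : FreeOp k S X N n) =
      mk N (.comp hab 0 (.m a) (.m b)) := by
  let τ₀ : Fin (b + 1) → Fin (b + 1) := fun q =>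
    ⟨(h ⟨q.val, by omega⟩).val, (hh _).2 q.isLt⟩
  have hτ₀ : Function.Injective τ₀ := fun q r e => by
    have e1 := congrArg Fin.val e
    have e2 := congrArg Fin.val (h.injective (Fin.ext e1))
    exact Fin.ext e2
  let τ : Equiv.Perm (Fin (b + 1)) :=
    Equiv.ofBijective τ₀ (Finite.injective_iff_bijective.1 hτ₀)
  let σ₀ : Fin (a + 1) → Fin (a + 1) := fun q =>
    if hq : q.val = 0 then 0 else ⟨(h ⟨q.val + b, by omega⟩).val - b, by
      have := (h ⟨q.val + b, by omega⟩).isLt; omega⟩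
  have hge : ∀ (q : Fin (a + 1)) (hq : q.val ≠ 0), b + 1 ≤ (h ⟨q.val + b, by omega⟩).val := by
    intro q hq
    by_contra hlt
    have := (hh _).1 (not_le.1 hlt)
    simp only at this
    omega
  have hσ₀ : Function.Injective σ₀ := fun q r e => by
    have e1 := congrArg Fin.val e
    simp only [σ₀] at e1
    split_ifs at e1 with h1 h2 h2
    · exact Fin.ext (h1.trans h2.symm)
    · have := hge r h2
      simp at e1; omega
    · have := hge q h1
      simp at e1; omega
    · have g1 := hge q h1
      have g2 := hge r h2
      simp only at e1
      have e2 := congrArg Fin.val (h.injective (Fin.ext (by omega :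
        (h ⟨q.val + b, _⟩).val = (h ⟨r.val + b, _⟩).val)))
      simp only at e2
      exact Fin.ext (by omega)
  let σ : Equiv.Perm (Fin (a + 1)) :=
    Equiv.ofBijective σ₀ (Finite.injective_iff_bijective.1 hσ₀)
  have hσ : ∀ q, σ q = σ₀ q := fun q => rfl
  have hτ : ∀ q, τ q = τ₀ q := fun q => rfl
  have hσ0 : σ 0 = 0 := by simp [hσ, σ₀]
  have hb : IsBlockPerm (0 : Fin (a + 1)) σ τ h := by
    constructor
    · intro s u hu
      have : u = ⟨s.val, by omega⟩ := Fin.ext (by simpa using hu)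
      rw [this, hσ0, hτ]
      simp [τ₀]
    · intro q u hq hu
      have hq0 : q.val ≠ 0 := fun e => hq (Fin.ext e)
      have hu' : u = ⟨q.val + b, by omega⟩ := Fin.ext (by
        rw [hu]; simp [outerPos])
      have := hge q hq0
      have e : (σ q).val = (h ⟨q.val + b, by omega⟩).val - b := by simp [hσ, σ₀, hq]
      rw [hu', hσ0, outerPos, e]
      simp only [Fin.val_zero, not_lt_zero, if_false]
      omega
  have := comp_equivariant (k := k) (N := N) (X := X) hS hab 0 σ τ h hb (mk N (.m a)) (mk N (.m b))
  rw [hσ0, perm_mk, perm_mk, mk_rel (Rel.perm_m hS a σ), mk_rel (Rel.perm_m hS b τ), sg_zero,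
    one_smul, one_smul, comp_mk] at this
  exact this.symm

/-- The representative of the coset of `π` that is a shuffle. -/
def shuffleRep {n : ℕ} (p : ℕ) (π : Equiv.Perm (Fin n)) : Equiv.Perm (Fin n) :=
  Tuple.sort fun i => decide (p ≤ (π⁻¹ i).val)

theorem shuffleRep_spec {n : ℕ} (p : ℕ) (π : Equiv.Perm (Fin n)) (q : Fin n) :
    p ≤ (π⁻¹ (shuffleRep p π q)).val ↔ p ≤ q.val := by
  have h := Tuple.unique_monotone (f := fun i => decide (p ≤ (π⁻¹ i).val))
    (σ := Tuple.sort fun i => decide (p ≤ (π⁻¹ i).val)) (τ := π) (Tuple.monotone_sort _) (by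
      intro q r hqr
      have hπ : ∀ i, π⁻¹ (π i) = i := fun i => by simp
      simp only [Function.comp, hπ]
      by_cases h : p ≤ q.val
      · have : p ≤ r.val := h.trans hqr
        simp [h, this]
      · simp [h])
  have := congrFun h q
  simpa [shuffleRep] using this

theorem shuffleRep_isShuffle {n : ℕ} (p : ℕ) (π : Equiv.Perm (Fin n)) :
    IsShuffle p (shuffleRep p π) := by
  intro q r hqr hs
  have h := (Tuple.eq_sort_iff (f := fun i => decide (p ≤ (π⁻¹ i).val))
    (σ := shuffleRep p π)).1 rfl
  refine h.2 q r hqr ?_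
  have hqr' : q.val < r.val := hqr
  have h1 := shuffleRep_spec p π q
  have h2 := shuffleRep_spec p π r
  simp only [decide_eq_decide]
  rw [h1, h2]
  omega

theorem shuffleRep_mul {n p : ℕ} {σ : Equiv.Perm (Fin n)} (hσ : IsShuffle p σ)
    {π : Equiv.Perm (Fin n)} (h : ∀ q, p ≤ (π⁻¹ (σ q)).val ↔ p ≤ q.val) : shuffleRep p π = σ := by
  symm
  rw [shuffleRep, Tuple.eq_sort_iff]
  constructor
  · intro q r hqr
    have hqr' : q.val ≤ r.val := hqr
    simp only [Function.comp, h]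
    by_cases h : p ≤ q.val
    · have : p ≤ r.val := h.trans hqr
      simp [h, this]
    · simp [h]
  · intro q r hqr he
    rw [decide_eq_decide, h, h] at he
    exact hσ q r hqr (by omega)

theorem shuffle_sum (hS : S = true) {n p : ℕ} (τ : Equiv.Perm (Fin n)) (u : FreeOp k S X N n)
    (hu : ∀ h : Equiv.Perm (Fin n), (∀ q, (h q).val < p ↔ q.val < p) → perm hS h u = u) :
    ∑ σ : Equiv.Perm (Fin n) with IsShuffle p σ, perm hS (τ * σ) u =
      ∑ σ : Equiv.Perm (Fin n) with IsShuffle p σ, perm hS σ u := by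
  have back : ∀ (ρ σ : Equiv.Perm (Fin n)), IsShuffle p σ →
      shuffleRep p (ρ⁻¹ * shuffleRep p (ρ * σ)) = σ := fun ρ σ hσ =>
    shuffleRep_mul hσ fun q => by
      have := shuffleRep_spec p (ρ * σ) ((shuffleRep p (ρ * σ))⁻¹ (ρ (σ q)))
      simp only [mul_inv_rev, Equiv.Perm.mul_apply] at this ⊢
      simpa using this.symm
  refine Finset.sum_bij' (fun σ _ => shuffleRep p (τ * σ)) (fun σ _ => shuffleRep p (τ⁻¹ * σ))
    (fun σ _ => by simpa using shuffleRep_isShuffle p _)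
    (fun σ _ => by simpa using shuffleRep_isShuffle p _)
    (fun σ hσ => back τ σ (by simpa using hσ))
    (fun σ hσ => by simpa using back τ⁻¹ σ (by simpa using hσ)) ?_
  intro σ _
  have e : (τ * σ) * ((τ * σ)⁻¹ * shuffleRep p (τ * σ)) = shuffleRep p (τ * σ) := by group
  have e' := perm_perm hS (τ * σ) ((τ * σ)⁻¹ * shuffleRep p (τ * σ)) u
  rw [e, hu] at e'
  · exact e'
  · intro q
    have := shuffleRep_spec p (τ * σ) q
    rw [Equiv.Perm.mul_apply]
    omega

theorem perm_diffM (hS : S = true) {n : ℕ} (τ : Equiv.Perm (Fin (n + 1))) :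
    perm hS τ (diffM k S X N n) = diffM k S X N n := by
  rw [diffM, dif_pos hS, map_sum]
  refine Finset.sum_congr rfl fun a _ => ?_
  simp only [← perm_mk, map_sum, perm_perm]
  exact shuffle_sum hS τ _ fun h hh => perm_m_comp_m hS _ h hh

theorem diffMono_rel {n : ℕ} {f g : Mono S X n} {s : ZMod 2} (h : Rel f g s) :
    diffMono k N f = sg k s • diffMono k N g := by
  induction h with
  | seq h₁ h₂ h₃ h₄ i j p hp f g h =>
    simp only [diffMono, map_add, map_smul, LinearMap.add_apply, LinearMap.smul_apply, sg_zero,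
      one_smul, ← comp_mk, comp_seq h₁ h₂ h₃ h₄ i j p hp, Mono.deg, sg_add, smul_add, smul_smul,
      one_mul, add_assoc]
  | par h₁ h₂ h₃ h₄ i j hij p hp q hq f g h =>
    simp only [diffMono, map_add, map_smul, LinearMap.add_apply, LinearMap.smul_apply,
      ← comp_mk, Mono.deg, sg_add, smul_add, smul_smul]
    rw [comp_par h₁ h₂ h₃ h₄ i j hij p hp q hq, comp_par_left h₁ h₂ h₃ h₄ i j hij p hp q hq,
      comp_par_right h₁ h₂ h₃ h₄ i j hij p hp q hq, parPow_of _ _ _ (par_diffMono g),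
      parPow_of _ _ _ (par_diffMono h)]
    simp only [map_smul, LinearMap.smul_apply, smul_smul, mul_add, mul_one, sg_add]
    rw [mul_comm h.deg g.deg, add_assoc, add_assoc, add_comm (_ • comp h₄ q _ (diffMono k N g))]
    congr 3
    · rw [mul_assoc, mul_comm (sg k (g.deg * h.deg)), ← mul_assoc, ← mul_assoc]
      rw [mul_assoc (sg k f.deg), sg_mul_self]; ring
    · ring
  | equivariant hS h₁ i σ τ ρ hρ f g =>
    simp only [diffMono, map_add, map_smul, ← perm_mk,
      comp_equivariant hS h₁ i σ τ ρ hρ, Mono.deg, sg_zero, one_smul]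
  | perm_mul hS σ τ f => simp [diffMono, perm_perm, sg_zero]
  | perm_one hS f => simp [diffMono, perm_one, sg_zero]
  | perm_m hS n σ => simp [diffMono, perm_diffM, sg_zero]
  | comp_left h i g hf ih =>
    simp only [diffMono, ih, mk_rel hf, hf.deg_eq, map_smul, LinearMap.smul_apply, smul_add]
    rw [smul_comm]
  | comp_right h i f hg ih =>
    simp only [diffMono, ih, mk_rel hg, map_smul, smul_add]
    rw [smul_comm]
  | perm_congr hS σ hf ih => simp [diffMono, ih]

/-- The differential. -/
noncomputable def diff (n : ℕ) : FreeOp k S X N n →ₗ[k] FreeOp k S X N n :=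
  lift (diffMono k N) (fun _ _ _ h => diffMono_rel h) (fun f h => by
    have := diffMono_mem_filt (k := k) (N := N) f
    rwa [filt_eq_bot h, Submodule.mem_bot] at this)

@[simp] theorem diff_mk {n : ℕ} (f : Mono S X n) :
    diff n (mk N f : FreeOp k S X N n) = diffMono k N f := by simp [diff]

end FreeOp
/-- The operad `FreeOp`, with the discrete topology. -/
noncomputable def freeOperad (k : Type u) [Field k] (S X : Bool) (N : ℕ∞) :
    OperadData.{u, u} k S where
  Ob n := FreeOp k S X N n
  top _ := ⊥
  par n := FreeOp.par n
  d n := FreeOp.diff n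
  comp h i := FreeOp.comp h i
  perm hS _ σ := FreeOp.perm hS σ

/-- A monomial without `x` as a monomial in which `x` is allowed. -/
def Mono.incl {S X X' : Bool} (hX : X = true → X' = true) : {n : ℕ} → Mono S X n → Mono S X' n
  | _, .m n => .m n
  | _, .x h => .x (hX h)
  | _, .comp h i f g => .comp h i (f.incl hX) (g.incl hX)
  | _, .perm hS σ f => .perm hS σ (f.incl hX)

namespace FreeOp

variable {k : Type u} [Field k] {S X X' : Bool} {N N' : ℕ∞}

theorem incl_deg (hX : X = true → X' = true) {n : ℕ} (f : Mono S X n) :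
    (f.incl hX).deg = f.deg := by
  induction f <;> simp_all [Mono.incl, Mono.deg]

theorem incl_wt (hX : X = true → X' = true) {n : ℕ} (f : Mono S X n) :
    (f.incl hX).wt = f.wt := by
  induction f <;> simp_all [Mono.incl, Mono.wt]

theorem incl_rel (hX : X = true → X' = true) {n : ℕ} {f g : Mono S X n} {s : ZMod 2}
    (h : Rel f g s) : Rel (f.incl hX) (g.incl hX) s := by
  induction h with
  | seq h₁ h₂ h₃ h₄ i j p hp f g h => exact .seq h₁ h₂ h₃ h₄ i j p hp _ _ _
  | par h₁ h₂ h₃ h₄ i j hij p hp q hq f g h =>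
    rw [← incl_deg hX g, ← incl_deg hX h]
    exact .par h₁ h₂ h₃ h₄ i j hij p hp q hq _ _ _
  | equivariant hS h₁ i σ τ ρ hρ f g => exact .equivariant hS h₁ i σ τ ρ hρ _ _
  | perm_mul hS σ τ f => exact .perm_mul hS σ τ _
  | perm_one hS f => exact .perm_one hS _
  | perm_m hS n σ => exact .perm_m hS n σ
  | comp_left h i g _ ih => exact .comp_left h i _ ih
  | comp_right h i f _ ih => exact .comp_right h i _ ih
  | perm_congr hS σ _ ih => exact .perm_congr hS σ ih

theorem incl_fill (hX : X = true → X' = true) (n : ℕ) (f : Mono S X n) (u : Mono S X 0) :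
    (Mono.fill n f u).incl hX = Mono.fill n (f.incl hX) (u.incl hX) := by
  induction n with
  | zero => rfl
  | succ n ih => rw [Mono.fill, ih]; rfl

/-- The linear map induced by the inclusion of monomials, for `N' ≤ N`. -/
noncomputable def inclMap (hX : X = true → X' = true) (hN : N' ≤ N) (n : ℕ) :
    FreeOp k S X N n →ₗ[k] FreeOp k S X' N' n :=
  lift (fun f => mk N' (f.incl hX)) (fun _ _ _ h => mk_rel (incl_rel hX h))
    (fun f h => mk_wt (by rw [incl_wt]; exact hN.trans h))

@[simp] theorem inclMap_mk (hX : X = true → X' = true) (hN : N' ≤ N) {n : ℕ} (f : Mono S X n) :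
    inclMap hX hN n (mk N f : FreeOp k S X N n) = mk N' (f.incl hX) := by simp [inclMap]

theorem inclMap_comp (hX : X = true → X' = true) (hN : N' ≤ N) {a b c : ℕ} (h : a + b = c + 1)
    (i : Fin a) (u : FreeOp k S X N a) (v : FreeOp k S X N b) :
    inclMap hX hN c (comp h i u v) = comp h i (inclMap hX hN a u) (inclMap hX hN b v) := by
  induction u using induction with
  | zero => simp
  | add u u' hu hu' => simp only [map_add, LinearMap.add_apply, hu, hu']
  | smul t u hu => simp only [map_smul, LinearMap.smul_apply, hu]
  | mk f =>
    induction v using induction with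
    | zero => simp
    | add u u' hu hu' => simp only [map_add, hu, hu']
    | smul t u hu => simp only [map_smul, hu]
    | mk g => simp [Mono.incl]

theorem inclMap_perm (hX : X = true → X' = true) (hN : N' ≤ N) (hS : S = true) {n : ℕ}
    (σ : Equiv.Perm (Fin n)) (u : FreeOp k S X N n) :
    inclMap hX hN n (perm hS σ u) = perm hS σ (inclMap hX hN n u) := by
  induction u using induction with
  | zero => simp
  | add u u' hu hu' => simp only [map_add, hu, hu']
  | smul t u hu => simp only [map_smul, hu]
  | mk f => simp [Mono.incl]

theorem inclMap_par (hX : X = true → X' = true) (hN : N' ≤ N) {n : ℕ} (u : FreeOp k S X N n) :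
    inclMap hX hN n (par n u) = par n (inclMap hX hN n u) := by
  induction u using induction with
  | zero => simp
  | add u u' hu hu' => simp only [map_add, hu, hu']
  | smul t u hu => simp only [map_smul, hu]
  | mk f => simp [incl_deg]

theorem inclMap_diffX (hX : X = true → X' = true) (hN : N' ≤ N) (h : X = true) (hN₀ : N ≠ ⊤) :
    inclMap hX hN 0 (diffX k S X h N) = diffX k S X' (hX h) N' := by
  lift N to ℕ using hN₀
  lift N' to ℕ using ne_top_of_le_ne_top (ENat.natCast_ne_top N) hN
  have hN' : N' ≤ N := by exact_mod_cast hN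
  simp only [diffX, map_sum, map_smul, inclMap_mk, incl_fill, Mono.incl, ENat.toNat_natCast]
  symm
  refine Finset.sum_subset (Finset.range_mono hN') fun n _ hn => ?_
  rw [mk_wt, smul_zero]
  rw [wt_fill]
  simp only [Finset.mem_range, not_lt, Mono.wt] at hn ⊢
  norm_cast
  omega

theorem inclMap_diff (hX : X = true → X' = true) (hN : N' ≤ N) (hN₀ : X = true → N ≠ ⊤) {n : ℕ}
    (u : FreeOp k S X N n) : inclMap hX hN n (diff n u) = diff n (inclMap hX hN n u) := by
  induction u using induction with
  | zero => simp
  | add u u' hu hu' => simp only [map_add, hu, hu']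
  | smul t u hu => simp only [map_smul, hu]
  | mk f =>
    rw [inclMap_mk, diff_mk, diff_mk]
    induction f with
    | m n =>
      simp only [diffMono, Mono.incl, diffM]
      split_ifs with hS <;> simp [Mono.incl]
    | x h => exact inclMap_diffX hX hN h (hN₀ h)
    | comp h i f g hf hg =>
      simp only [diffMono, Mono.incl, map_add, map_smul, inclMap_comp, inclMap_mk, hf, hg, incl_deg]
    | perm hS σ f hf => simp only [diffMono, Mono.incl, inclMap_perm, hf]

/-- `inclMap` as a map of operads. -/
noncomputable def inclHom (k : Type u) [Field k] (S : Bool) (hX : X = true → X' = true)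
    (hN : N' ≤ N) (hN₀ : X = true → N ≠ ⊤) :
    OperadHom (freeOperad k S X N) (freeOperad k S X' N') where
  app n := inclMap hX hN n
  map_par u := inclMap_par hX hN u
  map_d u := inclMap_diff hX hN hN₀ u
  map_comp h i u v := inclMap_comp hX hN h i u v
  map_perm hS _ σ u := inclMap_perm hX hN hS σ u
  cont _ := continuous_bot

theorem incl_incl {X'' : Bool} (hX : X = true → X' = true) (hX' : X' = true → X'' = true) {n : ℕ}
    (f : Mono S X n) : (f.incl hX).incl hX' = f.incl (fun h => hX' (hX h)) := by
  induction f <;> simp_all [Mono.incl]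

theorem incl_self (hX : X = true → X = true) {n : ℕ} (f : Mono S X n) : f.incl hX = f := by
  induction f <;> simp_all [Mono.incl]

theorem inclMap_inclMap {X'' : Bool} {N'' : ℕ∞} (hX : X = true → X' = true)
    (hX' : X' = true → X'' = true) (hN : N' ≤ N) (hN' : N'' ≤ N') {n : ℕ} (u : FreeOp k S X N n) :
    inclMap hX' hN' n (inclMap hX hN n u) =
      inclMap (fun h => hX' (hX h)) (hN'.trans hN) n u := by
  induction u using induction with
  | zero => simp
  | add u u' hu hu' => simp only [map_add, hu, hu']
  | smul t u hu => simp only [map_smul, hu]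
  | mk f => simp [incl_incl]

theorem inclMap_self (hX : X = true → X = true) (hN : N ≤ N) {n : ℕ} (u : FreeOp k S X N n) :
    inclMap hX hN n u = u := by
  induction u using induction with
  | zero => simp
  | add u u' hu hu' => simp only [map_add, hu, hu']
  | smul t u hu => simp only [map_smul, hu]
  | mk f => simp [incl_self]

end FreeOp

/-- The system of the dg operads `O[x]/(x)^N`, `N = 0, 1, 2, …`, for `O = L_∞` (`S = true`) or
`O = A_∞` (`S = false`). -/
noncomputable def truncSystem (k : Type u) [Field k] (S : Bool) :
    OperadSystem.{u, u, 0} k S ℕ where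
  obj N := freeOperad k S true (N : ℕ∞)
  map h := FreeOp.inclHom k S id (by exact_mod_cast h) (fun _ => ENat.natCast_ne_top _)
  map_refl _ _ f := FreeOp.inclMap_self _ le_rfl f
  map_map h h' _ f := FreeOp.inclMap_inclMap id id (by exact_mod_cast h') (by exact_mod_cast h) f

/-- The operad without the variable `x`: `L_∞` if `S = true`, `A_∞` if `S = false`. -/
noncomputable def infOperad (k : Type u) [Field k] (S : Bool) : OperadData.{u, u} k S :=
  freeOperad k S false ⊤

/-- The completed operad `O[[x]] = lim O[x]/(x)^N`, for `O = L_∞` (`S = true`) or `O = A_∞`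
(`S = false`), with `d x = ∑_{n ≥ 1} c_n m_n ∘ (x ⊗ ⋯ ⊗ x)`. -/
noncomputable def infOperadX (k : Type u) [Field k] (S : Bool) : OperadData.{u, u} k S :=
  (truncSystem k S).lim

/-- The generator `m_{n+1}` of `L_∞` or `A_∞`. -/
noncomputable def genM (k : Type u) [Field k] (S : Bool) (n : ℕ) : (infOperad k S).Ob (n + 1) :=
  FreeOp.mk ⊤ (.m n)

/-- The variable `x` of `L_∞[[x]]` or `A_∞[[x]]`. -/
noncomputable def genX (k : Type u) [Field k] (S : Bool) : (infOperadX k S).Ob 0 :=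
  ⟨fun N => (FreeOp.mk (N : ℕ∞) (.x rfl) : FreeOp k S true (N : ℕ∞) 0),
    fun _ _ h => FreeOp.inclMap_mk id (by exact_mod_cast h) _⟩

/-- The inclusion `L_∞ → L_∞[[x]]` or `A_∞ → A_∞[[x]]`. -/
noncomputable def inclX (k : Type u) [Field k] (S : Bool) :
    OperadHom (infOperad k S) (infOperadX k S) where
  app n :=
    { toFun := fun f => ⟨fun N => FreeOp.inclMap (X := false) (X' := true) (N' := (N : ℕ∞))
          (fun _ => rfl) le_top n f,
        fun _ _ h => FreeOp.inclMap_inclMap _ id le_top (by exact_mod_cast h) f⟩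
      map_add' := fun f g => Subtype.ext (funext fun N => map_add _ f g)
      map_smul' := fun c f => Subtype.ext (funext fun N => map_smul _ c f) }
  map_par f := Subtype.ext (funext fun N => FreeOp.inclMap_par _ _ f)
  map_d f := Subtype.ext (funext fun N => FreeOp.inclMap_diff _ _ (by simp) f)
  map_comp h i f g := Subtype.ext (funext fun N => FreeOp.inclMap_comp _ _ h i f g)
  map_perm hS _ σ f := Subtype.ext (funext fun N => FreeOp.inclMap_perm _ _ hS σ f)
  cont _ := continuous_bot

/-! ### Algebras and Maurer–Cartan elements -/

/-- An `A`-linear algebra structure on the dg vector space `(V, D)` over an operad `P`: a continuous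
map of dg operads `P → A₊ ⊗ End(ΠV)`. -/
abbrev LinearAlgebra {k : Type u} {V : Type v} [Field k] [AddCommGroup V] [Module k V] {S : Bool}
    (P : OperadData.{u, u} k S) (A : FormalCDGA.{u, w, w'} k) (D : DGStructure k V) :=
  OperadHom P (coeffOperad A D.parityShift S)

/-- The structure map `m_{n+1} : (ΠV)^{⊗ (n+1)} → A₊ ⊗ ΠV` of an `A`-linear `L_∞` or `A_∞` algebra.
The operations of the operad satisfy `d m = ∑ m ∘ m`, whereas the `L_∞` and `A_∞` identities for
structure maps, in the normalization `[d, m] + ∑ m ∘ m = 0` (that is, `(d + m)² = 0`) in which the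
Maurer–Cartan equation reads `d ξ + ∑ c_n m_n (ξ, …, ξ) = 0`, differ from this by the sign of `m`.
Hence the structure map is minus the image of the generator. -/
noncomputable def structureMap {k : Type u} {V : Type v} [Field k] [AddCommGroup V] [Module k V]
    {S : Bool} {A : FormalCDGA.{u, w, w'} k} {D : DGStructure k V}
    (m : LinearAlgebra (infOperad k S) A D) (n : ℕ) :
    (coeffOperad A D.parityShift S).Ob (n + 1) := -(m.app (n + 1) (genM k S n))

/-- The set `MC(V, A)` of Maurer–Cartan elements of an `A`-linear `L_∞` or `A_∞` algebra: the even
elements `ξ` of `A₊ ⊗ ΠV` with `d ξ + ∑_{n ≥ 1} c_n m_n (ξ, …, ξ) = 0`, where `c_n = 1 / n!` in the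
`L_∞` case and `c_n = 1` in the `A_∞` case, and `d = d_A ⊗ id + id ⊗ d_{ΠV}`. -/
def MC {k : Type u} {V : Type v} [Field k] [AddCommGroup V] [Module k V]
    {S : Bool} {A : FormalCDGA.{u, w, w'} k} {D : DGStructure k V}
    (m : LinearAlgebra (infOperad k S) A D) : Set ((coeffOperad A D.parityShift S).Ob 0) :=
  { ξ | (coeffOperad A D.parityShift S).par 0 ξ = ξ ∧
    ∃ s, HasSum (fun n : ℕ => FreeOp.coeff k S (n + 1) •
        (coeffOperad A D.parityShift S).fill (n + 1) (structureMap m n) ξ) s ∧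
      (coeffOperad A D.parityShift S).d 0 ξ + s = 0 }

/-- The dg operad `L_∞`. -/
noncomputable abbrev LInf (k : Type u) [Field k] : OperadData.{u, u} k true := infOperad k true

/-- The topological dg operad `L_∞[[x]]`. -/
noncomputable abbrev LInfX (k : Type u) [Field k] : OperadData.{u, u} k true := infOperadX k true

/-- The non-symmetric dg operad `A_∞`. -/
noncomputable abbrev AInf (k : Type u) [Field k] : OperadData.{u, u} k false := infOperad k false

/-- The topological non-symmetric dg operad `A_∞[[x]]`. -/
noncomputable abbrev AInfX (k : Type u) [Field k] : OperadData.{u, u} k false := infOperadX k false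

end MCOp

namespace MCOp

/-! ### Signs and homogeneous elements -/

/-! The operad `O[x]` is free on the `m_n` and `x`, so a map out of it is fixed by an `O`-structure
`φ` together with an even element `ξ`, the image of `x`. Only the differential restricts the choice.
By the Leibniz rule it is enough that the map commutes with `d` on generators. On the `m_n` this
holds because `φ` is a dg map. On `x` it reads `d ξ = ∑ c_n φ(m_n)(ξ, …, ξ)`, which is the
Maurer–Cartan equation once `μ_n = -φ(m_n)` is substituted (`mem_MC_iff`). Both parts of the theorem
are one argument, with `S` deciding whether permutations are present.

The completion is handled one component `A_i` at a time. Each occurrence of `x` contributes a factor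
from the nilpotent algebra `A_i`, so monomials with many `x` evaluate to zero in `A_i ⊗ End(ΠV)`
(`exists_evalMono_eq_zero`). Evaluation into this component therefore factors through some
`O[x]/(x)^N`. These factorizations are compatible and assemble into a continuous map on `O[[x]]`
(`OperadHom.exists_extension`).

Uniqueness holds because the span of the monomials is dense in `O[[x]]` and the target is an inverse
limit of discrete spaces (`OperadHom.ext_infOperadX`). For the direct implication, a continuous map
of operads is applied to the convergent series for `d x` (`hasSum_d_genX`, `app_genX_mem_MC`).

What remains is to know that the target satisfies the operad axioms with Koszul signs, so that
evaluation respects the relations of the free operad. This is `isDGOperad_endOperad` followed by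
`isDGOperad_tensorOperad`. Compositions and permutations are defined through sums over parities, so
the identities are checked on homogeneous elements, where each sum has a single surviving term and
signs become exponents in `ZMod 2`. -/

theorem zmod_two_cases (s : ZMod 2) : s = 0 ∨ s = 1 := by revert s; decide

section Homogeneous

variable {k : Type u} [Field k] {V : Type v} [AddCommGroup V] [Module k V] {par : V →ₗ[k] V}

theorem par_hproj (hp : ∀ v, par (par v) = v) (p : ZMod 2) (v : V) :
    par (hproj par p v) = sg k p • hproj par p v := by
  simp only [hproj, LinearMap.smul_apply, LinearMap.add_apply, LinearMap.id_apply, map_smul,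
    map_add, hp]
  rw [smul_comm (sg k p) (2⁻¹ : k), smul_add (sg k p), smul_smul (sg k p) (sg k p), sg_mul_self,
    one_smul, add_comm]

theorem hproj_of_eq [CharZero k] {s : ZMod 2} {v : V} (hv : par v = sg k s • v) :
    hproj par s v = v := by
  simp only [hproj, LinearMap.smul_apply, LinearMap.add_apply, LinearMap.id_apply, hv]
  rw [smul_smul, sg_mul_self, one_smul, ← two_smul k v, smul_smul, inv_mul_cancel₀ two_ne_zero,
    one_smul]

theorem hproj_of_ne {s p : ZMod 2} (h : p ≠ s) {v : V} (hv : par v = sg k s • v) :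
    hproj par p v = 0 := by
  simp only [hproj, LinearMap.smul_apply, LinearMap.add_apply, LinearMap.id_apply, hv]
  rcases zmod_two_cases p with rfl | rfl <;> rcases zmod_two_cases s with rfl | rfl <;>
    simp_all [sg]

theorem sum_hproj [CharZero k] (par : V →ₗ[k] V) (v : V) : ∑ p : ZMod 2, hproj par p v = v := by
  have : ∑ p : ZMod 2, hproj par p v = hproj par 0 v + hproj par 1 v :=
    Fin.sum_univ_two (fun p : ZMod 2 => hproj par p v)
  rw [this]
  simp only [hproj, LinearMap.smul_apply, LinearMap.add_apply, LinearMap.id_apply, sg_zero, sg_one]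
  rw [← smul_add, show v + (1 : k) • par v + (v + (-1 : k) • par v) = (2 : k) • v by
    rw [two_smul]; module, smul_smul, inv_mul_cancel₀ two_ne_zero, one_smul]

theorem hproj_zero_add_hproj_one [CharZero k] (par : V →ₗ[k] V) (v : V) :
    hproj par 0 v + hproj par 1 v = v := by
  conv_rhs => rw [← sum_hproj par v]
  exact (Fin.sum_univ_two (fun p : ZMod 2 => hproj par p v)).symm

theorem parPow_of_eq {s : ZMod 2} {v : V} (p : ZMod 2) (hv : par v = sg k s • v) :
    parPow par p v = sg k (p * s) • v := by
  rcases zmod_two_cases p with rfl | rfl <;> simp [parPow, sg_zero, hv]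

theorem parPow_one (v : V) : parPow par 1 v = par v := by simp [parPow]

theorem parPow_add (hp : ∀ v, par (par v) = v) (p q : ZMod 2) (v : V) :
    parPow par (p + q) v = parPow par p (parPow par q v) := by
  have h2 : (1 : ZMod 2) + 1 = 0 := by decide
  rcases zmod_two_cases p with rfl | rfl <;> rcases zmod_two_cases q with rfl | rfl <;>
    simp [parPow, hp, h2]

theorem parPow_comm (p q : ZMod 2) (v : V) :
    parPow par p (parPow par q v) = parPow par q (parPow par p v) := by
  rcases zmod_two_cases p with rfl | rfl <;> rcases zmod_two_cases q with rfl | rfl <;>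
    simp [parPow]

theorem par_parPow (p : ZMod 2) (v : V) : par (parPow par p v) = parPow par p (par v) := by
  rcases zmod_two_cases p with rfl | rfl <;> simp [parPow]

theorem parPow_map {V' : Type w} [AddCommGroup V'] [Module k V'] {par' : V' →ₗ[k] V'}
    {L : V → V'} (hL : ∀ v, L (par v) = par' (L v)) (p : ZMod 2) (v : V) :
    L (parPow par p v) = parPow par' p (L v) := by
  rcases zmod_two_cases p with rfl | rfl <;> simp [parPow, hL]

theorem odd_parPow {L : V →ₗ[k] V} (hL : ∀ v, L (par v) = -par (L v)) (p : ZMod 2) (v : V) :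
    L (parPow par p v) = sg k p • parPow par p (L v) := by
  rcases zmod_two_cases p with rfl | rfl <;> simp [parPow, hL, sg_zero, sg_one]

theorem odd_of_eq {L : V →ₗ[k] V} (hL : ∀ v, L (par v) = -par (L v)) {s : ZMod 2} {v : V}
    (hv : par v = sg k s • v) : par (L v) = sg k (s + 1) • L v := by
  have := hL v
  rw [hv, map_smul] at this
  rw [sg_add, sg_one, mul_neg_one, neg_smul, this, neg_neg]

/-- Since `2` is invertible, every vector is the sum of its even and odd projections. This reduces
additive identities to homogeneous vectors, on which `hproj` is the identity or zero and `parPow` is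
a sign. -/
theorem homogeneous_induction [CharZero k] (hp : ∀ v, par (par v) = v) {motive : V → Prop} (v : V)
    (add : ∀ a b, motive a → motive b → motive (a + b))
    (homog : ∀ s a, par a = sg k s • a → motive a) : motive v := by
  rw [← hproj_zero_add_hproj_one par v]
  exact add _ _ (homog _ _ (par_hproj hp _ _)) (homog _ _ (par_hproj hp _ _))

end Homogeneous

/-! ### The axioms of dg operads -/

/-- The axioms of a dg operad (without unit), for the partial compositions. -/
structure IsDGOperad {k : Type u} [Field k] {S : Bool} (P : OperadData.{u, v} k S) : Prop where
  par_par : ∀ {n} (f : P.Ob n), P.par n (P.par n f) = f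
  d_par : ∀ {n} (f : P.Ob n), P.d n (P.par n f) = -P.par n (P.d n f)
  par_comp : ∀ {a b c : ℕ} (h : a + b = c + 1) (i : Fin a) (f : P.Ob a) (g : P.Ob b),
    P.par c (P.comp h i f g) = P.comp h i (P.par a f) (P.par b g)
  par_perm : ∀ (hS : S = true) {n : ℕ} (σ : Equiv.Perm (Fin n)) (f : P.Ob n),
    P.par n (P.perm hS σ f) = P.perm hS σ (P.par n f)
  comp_seq : ∀ {a b c e e' r : ℕ} (h₁ : a + b = e + 1) (h₂ : e + c = r + 1) (h₃ : b + c = e' + 1)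
    (h₄ : a + e' = r + 1) (i : Fin a) (j : Fin b) (p : Fin e) (_ : p.val = i.val + j.val)
    (f : P.Ob a) (g : P.Ob b) (h : P.Ob c),
    P.comp h₂ p (P.comp h₁ i f g) h = P.comp h₄ i f (P.comp h₃ j g h)
  comp_par : ∀ {a b c e e' r : ℕ} (h₁ : a + b = e + 1) (h₂ : e + c = r + 1) (h₃ : a + c = e' + 1)
    (h₄ : e' + b = r + 1) (i j : Fin a) (_ : i < j) (p : Fin e) (_ : p.val + 1 = j.val + b)
    (q : Fin e') (_ : q.val = i.val) (f : P.Ob a) (g : P.Ob b) (h : P.Ob c) (s t : ZMod 2)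
    (_ : P.par b g = sg k s • g) (_ : P.par c h = sg k t • h),
    P.comp h₂ p (P.comp h₁ i f g) h = sg k (s * t) • P.comp h₄ q (P.comp h₃ j f h) g
  leibniz : ∀ {a b c : ℕ} (h : a + b = c + 1) (i : Fin a) (f : P.Ob a) (g : P.Ob b),
    P.d c (P.comp h i f g) = P.comp h i (P.d a f) g + P.comp h i (P.par a f) (P.d b g)
  comp_equivariant : ∀ {a b c : ℕ} (hS : S = true) (h₁ : a + b = c + 1) (i : Fin a)
    (σ : Equiv.Perm (Fin a)) (τ : Equiv.Perm (Fin b)) (ρ : Equiv.Perm (Fin c))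
    (_ : IsBlockPerm i σ τ ρ) (f : P.Ob a) (g : P.Ob b),
    P.comp h₁ (σ i) (P.perm hS σ f) (P.perm hS τ g) = P.perm hS ρ (P.comp h₁ i f g)
  perm_mul : ∀ (hS : S = true) {n : ℕ} (σ τ : Equiv.Perm (Fin n)) (f : P.Ob n),
    P.perm hS σ (P.perm hS τ f) = P.perm hS (σ * τ) f
  perm_one : ∀ (hS : S = true) {n : ℕ} (f : P.Ob n), P.perm hS 1 f = f
  d_perm : ∀ (hS : S = true) {n : ℕ} (σ : Equiv.Perm (Fin n)) (f : P.Ob n),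
    P.d n (P.perm hS σ f) = P.perm hS σ (P.d n f)

/-! ### The tensor product of a cdga and an operad -/

section Tensor

variable {k : Type u} [Field k] {A : NilpotentCDGA.{u, v} k} {S : Bool}
  {P : OperadData.{u, w} k S}

theorem tensor_homogeneous_induction [CharZero k] (hP : IsDGOperad P) {n : ℕ}
    {motive : A.carrier ⊗[k] P.Ob n → Prop} (G : A.carrier ⊗[k] P.Ob n) (zero : motive 0)
    (add : ∀ a b, motive a → motive b → motive (a + b))
    (tmul : ∀ (β s : ZMod 2) (b : A.carrier) (g : P.Ob n), A.dg.par b = sg k β • b →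
      P.par n g = sg k s • g → motive (b ⊗ₜ g)) : motive G := by
  induction G with
  | zero => exact zero
  | add x y hx hy => exact add _ _ hx hy
  | tmul b g =>
    induction b using homogeneous_induction A.dg.par_par with
    | add x y hx hy => rw [TensorProduct.add_tmul]; exact add _ _ hx hy
    | homog β b hb =>
      induction g using homogeneous_induction hP.par_par with
      | add x y hx hy => rw [TensorProduct.tmul_add]; exact add _ _ hx hy
      | homog s g hg => exact tmul β s b g hb hg

theorem tensor_par_of_eq {n : ℕ} {β s : ZMod 2} {b : A.carrier} {g : P.Ob n}
    (hb : A.dg.par b = sg k β • b) (hg : P.par n g = sg k s • g) :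
    TensorProduct.map A.dg.par (P.par n) (b ⊗ₜ[k] g) = sg k (β + s) • (b ⊗ₜ[k] g) := by
  rw [TensorProduct.map_tmul, hb, hg, TensorProduct.smul_tmul_smul, sg_add]

/-- A tensor of total parity `t` is a sum of pure tensors `b ⊗ g` with `|b| + |g| = t`. Ordinary
induction would lose the parity of the whole, which the exchange axiom `tensor_comp_par` needs for
its sign. -/
theorem tensor_fixed_parity_induction [CharZero k] (hP : IsDGOperad P) {n : ℕ} {t : ZMod 2}
    {motive : A.carrier ⊗[k] P.Ob n → Prop} (G : A.carrier ⊗[k] P.Ob n)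
    (hG : TensorProduct.map A.dg.par (P.par n) G = sg k t • G) (zero : motive 0)
    (add : ∀ a b, motive a → motive b → motive (a + b))
    (tmul : ∀ (β s : ZMod 2) (b : A.carrier) (g : P.Ob n), β + s = t →
      A.dg.par b = sg k β • b → P.par n g = sg k s • g → motive (b ⊗ₜ g)) : motive G := by
  -- With `G` replaced by its own projection, the parity hypothesis can be dropped and the induction
  -- runs over arbitrary tensors: the projection keeps the pure tensors of parity `t` and kills the
  -- others.
  rw [← hproj_of_eq hG]
  clear hG
  induction G using tensor_homogeneous_induction hP with
  | zero => rw [map_zero]; exact zero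
  | add a b ha hb => rw [map_add]; exact add _ _ ha hb
  | tmul β s b g hb hg =>
    by_cases h : t = β + s
    · subst h
      rw [hproj_of_eq (tensor_par_of_eq hb hg)]
      exact tmul β s b g rfl hb hg
    · rw [hproj_of_ne h (tensor_par_of_eq hb hg)]; exact zero

/-- Only the summand `p = β` survives. The Koszul sign is kept as an operator on `f`, so `f` itself
need not be homogeneous. -/
theorem tensorComp_tmul [CharZero k] {a b c : ℕ} (h : a + b = c + 1) (i : Fin a) (x y : A.carrier)
    (f : P.Ob a) (g : P.Ob b) {β : ZMod 2} (hy : A.dg.par y = sg k β • y) :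
    tensorComp A P h i (x ⊗ₜ f) (y ⊗ₜ g) =
      (x * y) ⊗ₜ P.comp h i (parPow (P.par a) β f) g := by
  simp only [tensorComp, LinearMap.sum_apply, TensorProduct.map₂_apply_tmul,
    LinearMap.comp_apply, TensorProduct.map_tmul, LinearMap.compl₂_apply, LinearMap.mul_apply']
  rw [Finset.sum_eq_single β]
  · rw [hproj_of_eq hy]
  · intro p _ hp
    rw [hproj_of_ne hp hy, mul_zero, TensorProduct.zero_tmul]
  · simp

theorem NilpotentCDGA.par_mul_of_eq {x y : A.carrier} {α β : ZMod 2}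
    (hx : A.dg.par x = sg k α • x) (hy : A.dg.par y = sg k β • y) :
    A.dg.par (x * y) = sg k (α + β) • (x * y) := by
  rw [A.par_mul, hx, hy, smul_mul_smul_comm, sg_add]

theorem NilpotentCDGA.mul_comm_of_eq {x y : A.carrier} {α β : ZMod 2}
    (hx : A.dg.par x = sg k α • x) (hy : A.dg.par y = sg k β • y) :
    x * y = sg k (α * β) • (y * x) := by
  rcases zmod_two_cases α with rfl | rfl
  · simpa [sg_zero] using A.even_comm x y (by simpa [sg_zero] using hx)
  rcases zmod_two_cases β with rfl | rfl
  · simpa [sg_zero] using (A.even_comm y x (by simpa [sg_zero] using hy)).symm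
  · simpa [sg_one] using A.odd_comm x y (by simpa [sg_one] using hx) (by simpa [sg_one] using hy)

theorem IsDGOperad.parPow_comp (hP : IsDGOperad P) {a b c : ℕ} (h : a + b = c + 1) (i : Fin a)
    (s : ZMod 2) (f : P.Ob a) (g : P.Ob b) : parPow (P.par c) s (P.comp h i f g) =
      P.comp h i (parPow (P.par a) s f) (parPow (P.par b) s g) := by
  rcases zmod_two_cases s with rfl | rfl <;> simp [parPow, hP.par_comp]

variable [CharZero k]

theorem tensor_par_comp (hP : IsDGOperad P) {a b c : ℕ} (h : a + b = c + 1) (i : Fin a)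
    (F : A.carrier ⊗[k] P.Ob a) (G : A.carrier ⊗[k] P.Ob b) :
    TensorProduct.map A.dg.par (P.par c) (tensorComp A P h i F G) =
      tensorComp A P h i (TensorProduct.map A.dg.par (P.par a) F)
        (TensorProduct.map A.dg.par (P.par b) G) := by
  induction F using tensor_homogeneous_induction hP with
  | zero => simp
  | add x y hx hy => simp only [map_add, LinearMap.add_apply, hx, hy]
  | tmul α s x f hx hf =>
    induction G using tensor_homogeneous_induction hP with
    | zero => simp
    | add x y hx hy => simp only [map_add, hx, hy]
    | tmul β t y g hy hg =>
      have hy' : A.dg.par (A.dg.par y) = sg k β • A.dg.par y := by rw [hy, map_smul, hy]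
      simp only [TensorProduct.map_tmul]
      rw [tensorComp_tmul h i x y f g hy, tensorComp_tmul h i _ _ _ _ hy', TensorProduct.map_tmul,
        A.par_mul, hP.par_comp, par_parPow]

theorem tensor_comp_seq (hP : IsDGOperad P) {a b c e e' r : ℕ} (h₁ : a + b = e + 1)
    (h₂ : e + c = r + 1) (h₃ : b + c = e' + 1) (h₄ : a + e' = r + 1) (i : Fin a) (j : Fin b)
    (p : Fin e) (hp : p.val = i.val + j.val) (F : A.carrier ⊗[k] P.Ob a)
    (G : A.carrier ⊗[k] P.Ob b) (H : A.carrier ⊗[k] P.Ob c) :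
    tensorComp A P h₂ p (tensorComp A P h₁ i F G) H =
      tensorComp A P h₄ i F (tensorComp A P h₃ j G H) := by
  induction F using tensor_homogeneous_induction hP with
  | zero => simp
  | add x y hx hy => simp only [map_add, LinearMap.add_apply, hx, hy]
  | tmul α s x f hx hf =>
    induction G using tensor_homogeneous_induction hP with
    | zero => simp
    | add x y hx hy => simp only [map_add, LinearMap.add_apply, hx, hy]
    | tmul β t y g hy hg =>
      induction H using tensor_homogeneous_induction hP with
      | zero => simp
      | add x y hx hy => simp only [map_add, hx, hy]
      | tmul γ t' z h hz hh =>
        rw [tensorComp_tmul h₁ i x y f g hy, tensorComp_tmul h₂ p _ _ _ _ hz,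
          tensorComp_tmul h₃ j y z g h hz,
          tensorComp_tmul h₄ i _ _ _ _ (NilpotentCDGA.par_mul_of_eq hy hz), hP.parPow_comp,
          hP.comp_seq h₁ h₂ h₃ h₄ i j p hp, mul_assoc, add_comm, parPow_add hP.par_par]

/-- Writing `G = y ⊗ g` and `H = z ⊗ h`, with parities `β, s'` and `γ, t'`, the sign is `(β + s')(γ
+ t')`. Its four products come from `y` past `z`, `z` past `g`, `y` past `h`, and `g` past `h`. -/
theorem tensor_comp_par (hP : IsDGOperad P) {a b c e e' r : ℕ} (h₁ : a + b = e + 1)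
    (h₂ : e + c = r + 1) (h₃ : a + c = e' + 1) (h₄ : e' + b = r + 1) (i j : Fin a) (hij : i < j)
    (p : Fin e) (hp : p.val + 1 = j.val + b) (q : Fin e') (hq : q.val = i.val)
    (F : A.carrier ⊗[k] P.Ob a) (G : A.carrier ⊗[k] P.Ob b) (H : A.carrier ⊗[k] P.Ob c)
    (s t : ZMod 2) (hG : TensorProduct.map A.dg.par (P.par b) G = sg k s • G)
    (hH : TensorProduct.map A.dg.par (P.par c) H = sg k t • H) :
    tensorComp A P h₂ p (tensorComp A P h₁ i F G) H =
      sg k (s * t) • tensorComp A P h₄ q (tensorComp A P h₃ j F H) G := by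
  induction F using tensor_homogeneous_induction hP with
  | zero => simp
  | add x y hx hy => simp only [map_add, LinearMap.add_apply, hx, hy, smul_add]
  | tmul α u x f hx hf =>
    refine tensor_fixed_parity_induction hP (motive := fun G =>
      tensorComp A P h₂ p (tensorComp A P h₁ i (x ⊗ₜ f) G) H =
        sg k (s * t) • tensorComp A P h₄ q (tensorComp A P h₃ j (x ⊗ₜ f) H) G) G hG ?_ ?_ ?_
    · simp
    · intro x y hx hy
      simp only [map_add, LinearMap.add_apply, hx, hy, smul_add]
    intro β s' y g hs hy hg
    refine tensor_fixed_parity_induction hP (motive := fun H =>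
      tensorComp A P h₂ p (tensorComp A P h₁ i (x ⊗ₜ f) (y ⊗ₜ g)) H =
        sg k (s * t) • tensorComp A P h₄ q (tensorComp A P h₃ j (x ⊗ₜ f) H) (y ⊗ₜ g)) H hH ?_ ?_ ?_
    · simp
    · intro x y hx hy
      simp only [map_add, LinearMap.add_apply, hx, hy, smul_add]
    intro γ t' z h ht hz hh
    rw [tensorComp_tmul h₁ i x y f g hy, tensorComp_tmul h₂ p _ _ _ _ hz,
      tensorComp_tmul h₃ j x z f h hz, tensorComp_tmul h₄ q _ _ _ _ hy,
      hP.parPow_comp, hP.parPow_comp, parPow_of_eq γ hg, parPow_of_eq β hh]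
    simp only [map_smul, LinearMap.smul_apply]
    rw [
      hP.comp_par h₁ h₂ h₃ h₄ i j hij p hp q hq _ g h s' t' hg hh, mul_assoc,
      NilpotentCDGA.mul_comm_of_eq hy hz, mul_smul_comm, ← mul_assoc, parPow_comm,
      ← hs, ← ht]
    simp only [TensorProduct.tmul_smul, ← TensorProduct.smul_tmul', smul_smul, mul_add,
      add_mul, sg_add]
    congr 1
    rw [mul_comm s' γ]
    -- The exponent `β t'` occurs twice on the right, once in the total sign and once from moving
    -- `y` past `h`, and so drops out.
    linear_combination (-sg k (β * γ) * sg k (γ * s') * sg k (s' * t')) *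
      sg_mul_self k (β * t')

/-- Two sign cancellations make the rule work. Moving `d` through `parPow β` on `f` gives `(-1)^β`,
which meets the same sign from `par y`. In the term with `d y`, the parity `β + 1` supplies an extra
involution that undoes the `par` already applied to `f`. -/
theorem tensor_leibniz (hP : IsDGOperad P) {a b c : ℕ} (h : a + b = c + 1) (i : Fin a)
    (F : A.carrier ⊗[k] P.Ob a) (G : A.carrier ⊗[k] P.Ob b) :
    tensorDiff A P c (tensorComp A P h i F G) =
      tensorComp A P h i (tensorDiff A P a F) G +
        tensorComp A P h i (TensorProduct.map A.dg.par (P.par a) F) (tensorDiff A P b G) := by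
  induction F using tensor_homogeneous_induction hP with
  | zero => simp
  | add x y hx hy => simp only [map_add, LinearMap.add_apply, hx, hy]; abel
  | tmul α s x f hx hf =>
    induction G using tensor_homogeneous_induction hP with
    | zero => simp
    | add x y hx hy => simp only [map_add, hx, hy]; abel
    | tmul β t y g hy hg =>
      have hdy := odd_of_eq A.dg.d_par hy
      have hy' : A.dg.par (A.dg.par y) = sg k β • A.dg.par y := by rw [hy, map_smul, hy]
      rw [tensorComp_tmul h i x y f g hy]
      simp only [tensorDiff, LinearMap.add_apply, TensorProduct.map_tmul, LinearMap.id_apply,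
        map_add]
      rw [tensorComp_tmul h i _ _ _ _ hy, tensorComp_tmul h i _ _ _ _ hy,
        tensorComp_tmul h i _ _ _ _ hdy, tensorComp_tmul h i _ _ _ _ hy', A.leibniz, hP.leibniz,
        A.par_mul, odd_parPow hP.d_par, parPow_add hP.par_par, parPow_one, hP.par_par,
        par_parPow, hy]
      simp only [TensorProduct.tmul_add, TensorProduct.add_tmul, map_smul, LinearMap.smul_apply,
        TensorProduct.tmul_smul, ← TensorProduct.smul_tmul', mul_smul_comm, smul_smul,
        sg_mul_self, one_smul]
      abel

theorem tensor_comp_equivariant (hP : IsDGOperad P) {a b c : ℕ} (hS : S = true)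
    (h₁ : a + b = c + 1) (i : Fin a) (σ : Equiv.Perm (Fin a)) (τ : Equiv.Perm (Fin b))
    (ρ : Equiv.Perm (Fin c)) (hρ : IsBlockPerm i σ τ ρ) (F : A.carrier ⊗[k] P.Ob a)
    (G : A.carrier ⊗[k] P.Ob b) :
    tensorComp A P h₁ (σ i) (TensorProduct.map LinearMap.id (P.perm hS σ) F)
      (TensorProduct.map LinearMap.id (P.perm hS τ) G) =
        TensorProduct.map LinearMap.id (P.perm hS ρ) (tensorComp A P h₁ i F G) := by
  induction F using tensor_homogeneous_induction hP with
  | zero => simp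
  | add x y hx hy => simp only [map_add, LinearMap.add_apply, hx, hy]
  | tmul α s x f hx hf =>
    induction G using tensor_homogeneous_induction hP with
    | zero => simp
    | add x y hx hy => simp only [map_add, hx, hy]
    | tmul β t y g hy hg =>
      simp only [TensorProduct.map_tmul, LinearMap.id_apply]
      rw [tensorComp_tmul h₁ _ _ _ _ _ hy, tensorComp_tmul h₁ _ _ _ _ _ hy,
        TensorProduct.map_tmul, ← hP.comp_equivariant hS h₁ i σ τ ρ hρ,
        parPow_map (L := P.perm hS σ) fun f => (hP.par_perm hS σ f).symm]
      rfl

theorem isDGOperad_tensorOperad (hP : IsDGOperad P) : IsDGOperad (tensorOperad A P) where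
  par_par {n} F := LinearMap.congr_fun
    (show (TensorProduct.map A.dg.par (P.par n)).comp (TensorProduct.map A.dg.par (P.par n)) =
      LinearMap.id from TensorProduct.ext' fun a f => by simp [A.dg.par_par, hP.par_par]) F
  d_par {n} F := LinearMap.congr_fun
    (show (tensorDiff A P n).comp (TensorProduct.map A.dg.par (P.par n)) =
      -(TensorProduct.map A.dg.par (P.par n)).comp (tensorDiff A P n) from
        TensorProduct.ext' fun a f => by
          simp [tensorDiff, A.dg.d_par, hP.d_par, A.dg.par_par, TensorProduct.neg_tmul,
            TensorProduct.tmul_neg]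
          abel) F
  par_comp := tensor_par_comp hP
  par_perm hS n σ F := LinearMap.congr_fun
    (show (TensorProduct.map A.dg.par (P.par n)).comp
        (TensorProduct.map LinearMap.id (P.perm hS σ)) =
      (TensorProduct.map LinearMap.id (P.perm hS σ)).comp
        (TensorProduct.map A.dg.par (P.par n)) from
        TensorProduct.ext' fun a f => by simp [hP.par_perm]) F
  comp_seq := tensor_comp_seq hP
  comp_par := tensor_comp_par hP
  leibniz := tensor_leibniz hP
  comp_equivariant := tensor_comp_equivariant hP
  perm_mul hS n σ τ F := LinearMap.congr_fun
    (show (TensorProduct.map LinearMap.id (P.perm hS σ)).comp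
        (TensorProduct.map LinearMap.id (P.perm hS τ)) =
      (TensorProduct.map LinearMap.id (P.perm hS (σ * τ)) :
        A.carrier ⊗[k] P.Ob n →ₗ[k] A.carrier ⊗[k] P.Ob n) from
        TensorProduct.ext' fun a f => by simp [hP.perm_mul]) F
  perm_one hS n F := LinearMap.congr_fun
    (show (TensorProduct.map LinearMap.id (P.perm hS 1) :
        A.carrier ⊗[k] P.Ob n →ₗ[k] A.carrier ⊗[k] P.Ob n) = LinearMap.id from
        TensorProduct.ext' fun a f => by simp [hP.perm_one]) F
  d_perm hS n σ F := LinearMap.congr_fun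
    (show (tensorDiff A P n).comp (TensorProduct.map LinearMap.id (P.perm hS σ)) =
      (TensorProduct.map LinearMap.id (P.perm hS σ)).comp (tensorDiff A P n) from
        TensorProduct.ext' fun a f => by simp [tensorDiff, hP.d_perm]) F

end Tensor

end MCOp

namespace MCOp

/-! ### Evaluation of operadic monomials -/

section Eval

variable {k : Type u} [Field k] {S X : Bool} {P : OperadData.{u, v} k S}

/-- The value of a monomial in an operad, given the values of the generators. -/
def evalMono (P : OperadData.{u, v} k S) (μ : ∀ n, P.Ob (n + 1)) (ξ : P.Ob 0) :
    {n : ℕ} → Mono S X n → P.Ob n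
  | _, .m n => μ n
  | _, .x _ => ξ
  | _, .comp h i f g => P.comp h i (evalMono P μ ξ f) (evalMono P μ ξ g)
  | _, .perm hS σ f => P.perm hS σ (evalMono P μ ξ f)

theorem OperadHom.map_evalMono {Q : OperadData.{u, w} k S} (φ : OperadHom P Q)
    (μ : ∀ n, P.Ob (n + 1)) (ξ : P.Ob 0) {n : ℕ} (f : Mono S X n) :
    φ.app n (evalMono P μ ξ f) = evalMono Q (fun n => φ.app (n + 1) (μ n)) (φ.app 0 ξ) f := by
  induction f with
  | m n => rfl
  | x h => rfl
  | comp h i f g hf hg => simp only [evalMono, φ.map_comp, hf, hg]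
  | perm hS σ f hf => simp only [evalMono, φ.map_perm, hf]

theorem OperadHom.map_fill {Q : OperadData.{u, w} k S} (φ : OperadHom P Q) (n : ℕ) (f : P.Ob n)
    (x : P.Ob 0) : φ.app 0 (P.fill n f x) = Q.fill n (φ.app n f) (φ.app 0 x) := by
  induction n with
  | zero => rfl
  | succ n ih => rw [OperadData.fill, ih, φ.map_comp]; rfl

theorem OperadData.fill_neg (P : OperadData.{u, v} k S) (n : ℕ) (f : P.Ob n) (x : P.Ob 0) :
    P.fill n (-f) x = -P.fill n f x := by
  induction n with
  | zero => rfl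
  | succ n ih => rw [OperadData.fill, map_neg, LinearMap.neg_apply, ih]; rfl

theorem evalMono_fill (μ : ∀ n, P.Ob (n + 1)) (ξ : P.Ob 0) (n : ℕ) (f : Mono S X n)
    (u : Mono S X 0) :
    evalMono P μ ξ (Mono.fill n f u) = P.fill n (evalMono P μ ξ f) (evalMono P μ ξ u) := by
  induction n with
  | zero => rfl
  | succ n ih => rw [Mono.fill, ih]; rfl

theorem par_evalMono (hP : IsDGOperad P) {μ : ∀ n, P.Ob (n + 1)} {ξ : P.Ob 0}
    (hμ : ∀ n, P.par _ (μ n) = -μ n) (hξ : P.par 0 ξ = ξ) {n : ℕ} (f : Mono S X n) :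
    P.par n (evalMono P μ ξ f) = sg k f.deg • evalMono P μ ξ f := by
  induction f with
  | m n => simp [evalMono, Mono.deg, hμ, sg_one]
  | x h => simp [evalMono, Mono.deg, hξ, sg_zero]
  | comp h i f g hf hg =>
    simp only [evalMono, hP.par_comp, hf, hg, Mono.deg, map_smul, LinearMap.smul_apply, smul_smul,
      sg_add, mul_comm]
  | perm hS σ f hf => simp only [evalMono, hP.par_perm, hf, Mono.deg, map_smul]

/-- This is the universal property of the free operad: each constructor of `Rel` is an axiom of
`IsDGOperad`, the invariance of `μ`, or a congruence. The exchange relation uses parities of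
monomials, which are parities of their values by `par_evalMono`. -/
theorem evalMono_rel (hP : IsDGOperad P) {μ : ∀ n, P.Ob (n + 1)} {ξ : P.Ob 0}
    (hμ : ∀ n, P.par _ (μ n) = -μ n) (hξ : P.par 0 ξ = ξ)
    (hμS : ∀ (hS : S = true) (n : ℕ) (σ : Equiv.Perm (Fin (n + 1))), P.perm hS σ (μ n) = μ n)
    {n : ℕ} {f g : Mono S X n} {s : ZMod 2} (h : Rel f g s) :
    evalMono P μ ξ f = sg k s • evalMono P μ ξ g := by
  induction h with
  | seq h₁ h₂ h₃ h₄ i j p hp f g h =>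
    rw [sg_zero, one_smul]; exact hP.comp_seq h₁ h₂ h₃ h₄ i j p hp _ _ _
  | par h₁ h₂ h₃ h₄ i j hij p hp q hq f g h =>
    exact hP.comp_par h₁ h₂ h₃ h₄ i j hij p hp q hq _ _ _ _ _ (par_evalMono hP hμ hξ g)
      (par_evalMono hP hμ hξ h)
  | equivariant hS h₁ i σ τ ρ hρ f g =>
    rw [sg_zero, one_smul]; exact hP.comp_equivariant hS h₁ i σ τ ρ hρ _ _
  | perm_mul hS σ τ f => rw [sg_zero, one_smul]; exact hP.perm_mul hS σ τ _
  | perm_one hS f => rw [sg_zero, one_smul]; exact hP.perm_one hS _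
  | perm_m hS n σ => rw [sg_zero, one_smul]; exact hμS hS n σ
  | comp_left h i g hf ih =>
    simp only [evalMono, ih, map_smul, LinearMap.smul_apply]
  | comp_right h i f hg ih => simp only [evalMono, ih, map_smul]
  | perm_congr hS σ hf ih => simp only [evalMono, ih, map_smul]

/-- Admissible values of the generators for a map from the free operad modulo `(x)^N` to `P`. -/
structure IsEvaluation (P : OperadData.{u, v} k S) (X : Bool) (N : ℕ∞) (μ : ∀ n, P.Ob (n + 1))
    (ξ : P.Ob 0) : Prop where
  operad : IsDGOperad P
  odd : ∀ n, P.par _ (μ n) = -μ n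
  even : P.par 0 ξ = ξ
  symm : ∀ (hS : S = true) (n : ℕ) (σ : Equiv.Perm (Fin (n + 1))), P.perm hS σ (μ n) = μ n
  vanish : ∀ {n : ℕ} (f : Mono S X n), N ≤ (f.wt : ℕ∞) → evalMono P μ ξ f = 0

variable {N : ℕ∞} {μ : ∀ n, P.Ob (n + 1)} {ξ : P.Ob 0}

/-- The map from the free operad modulo `(x)^N` determined by the values of the generators. -/
noncomputable def IsEvaluation.eval (h : IsEvaluation P X N μ ξ) (n : ℕ) :
    FreeOp k S X N n →ₗ[k] P.Ob n :=
  FreeOp.lift (evalMono P μ ξ) (fun _ _ _ hr => evalMono_rel h.operad h.odd h.even h.symm hr)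
    h.vanish

@[simp] theorem IsEvaluation.eval_mk (h : IsEvaluation P X N μ ξ) {n : ℕ} (f : Mono S X n) :
    h.eval n (FreeOp.mk N f) = evalMono P μ ξ f := FreeOp.lift_mk _ _ _ f

theorem IsEvaluation.eval_comp (hE : IsEvaluation P X N μ ξ) {a b c : ℕ} (h : a + b = c + 1)
    (i : Fin a) (u : FreeOp k S X N a) (v : FreeOp k S X N b) :
    hE.eval c (FreeOp.comp h i u v) = P.comp h i (hE.eval a u) (hE.eval b v) := by
  induction u using FreeOp.induction with
  | zero => simp
  | add u u' hu hu' => simp only [map_add, LinearMap.add_apply, hu, hu']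
  | smul t u hu => simp only [map_smul, LinearMap.smul_apply, hu]
  | mk f =>
    induction v using FreeOp.induction with
    | zero => simp
    | add u u' hu hu' => simp only [map_add, hu, hu']
    | smul t u hu => simp only [map_smul, hu]
    | mk g => simp [evalMono]

theorem IsEvaluation.eval_perm (hE : IsEvaluation P X N μ ξ) (hS : S = true) {n : ℕ}
    (σ : Equiv.Perm (Fin n)) (u : FreeOp k S X N n) :
    hE.eval n (FreeOp.perm hS σ u) = P.perm hS σ (hE.eval n u) := by
  induction u using FreeOp.induction with
  | zero => simp
  | add u u' hu hu' => simp only [map_add, hu, hu']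
  | smul t u hu => simp only [map_smul, hu]
  | mk f => simp [evalMono]

theorem IsEvaluation.eval_par (hE : IsEvaluation P X N μ ξ) {n : ℕ} (u : FreeOp k S X N n) :
    hE.eval n (FreeOp.par n u) = P.par n (hE.eval n u) := by
  induction u using FreeOp.induction with
  | zero => simp
  | add u u' hu hu' => simp only [map_add, hu, hu']
  | smul t u hu => simp only [map_smul, hu]
  | mk f => simp [par_evalMono hE.operad hE.odd hE.even]

/-- Both differentials obey the Leibniz rule and commute with permutations, so agreement on the
generators propagates to all monomials. The hypothesis `hx` is where the Maurer–Cartan equation will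
be used. -/
theorem IsEvaluation.eval_diff (hE : IsEvaluation P X N μ ξ)
    (hm : ∀ n, hE.eval (n + 1) (FreeOp.diffM k S X N n) = P.d (n + 1) (μ n))
    (hx : ∀ hX : X = true, hE.eval 0 (FreeOp.diffX k S X hX N) = P.d 0 ξ)
    {n : ℕ} (u : FreeOp k S X N n) :
    hE.eval n (FreeOp.diff n u) = P.d n (hE.eval n u) := by
  induction u using FreeOp.induction with
  | zero => simp
  | add u u' hu hu' => simp only [map_add, hu, hu']
  | smul t u hu => simp only [map_smul, hu]
  | mk f =>
    rw [FreeOp.diff_mk, hE.eval_mk]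
    induction f with
    | m n => exact hm n
    | x hX => exact hx hX
    | comp h i f g hf hg =>
      simp only [FreeOp.diffMono, map_add, map_smul, hE.eval_comp, hE.eval_mk, hf, hg, evalMono,
        hE.operad.leibniz, par_evalMono hE.operad hE.odd hE.even, LinearMap.smul_apply]
    | perm hS σ f hf =>
      simp only [FreeOp.diffMono, hE.eval_perm, hf, evalMono, hE.operad.d_perm]

/-- Serves two purposes: independence of the truncation level (`X = X'`), and the comparison of `O`
with `O[x]/(x)^N` (`X = false`, `N = ⊤`). -/
theorem IsEvaluation.eval_inclMap {X' : Bool} {N' : ℕ∞} (hE : IsEvaluation P X N μ ξ)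
    (hE' : IsEvaluation P X' N' μ ξ) (hX : X = true → X' = true) (hN : N' ≤ N) {n : ℕ}
    (u : FreeOp k S X N n) : hE'.eval n (FreeOp.inclMap hX hN n u) = hE.eval n u := by
  induction u using FreeOp.induction with
  | zero => simp
  | add u u' hu hu' => simp only [map_add, hu, hu']
  | smul t u hu => simp only [map_smul, hu]
  | mk f =>
    rw [FreeOp.inclMap_mk, hE'.eval_mk, hE.eval_mk]
    induction f with
    | m n => rfl
    | x h => rfl
    | comp h i f g hf hg => simp only [evalMono, Mono.incl, hf, hg]
    | perm hS σ f hf => simp only [evalMono, Mono.incl, hf]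

end Eval

/-! ### Nilpotency -/

section Nilpotent

variable {k : Type u} [Field k] (A : NilpotentCDGA.{u, v} k)

/-- The span of the products of at least `n + 1` elements. -/
def NilpotentCDGA.pow : ℕ → Submodule k A.carrier
  | 0 => ⊤
  | n + 1 => Submodule.span k { z | ∃ a ∈ pow n, ∃ b, z = a * b }

theorem NilpotentCDGA.pow_succ_le (n : ℕ) : A.pow (n + 1) ≤ A.pow n := by
  induction n with
  | zero => exact le_top
  | succ n ih =>
    refine Submodule.span_mono ?_
    rintro _ ⟨a, ha, b, rfl⟩
    exact ⟨a, ih ha, b, rfl⟩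

theorem NilpotentCDGA.pow_antitone : Antitone A.pow := antitone_nat_of_succ_le A.pow_succ_le

/-- The index is one less than the number of factors: `(p + 1) + (q + 1)` factors give the index `p
+ q + 1`. -/
theorem NilpotentCDGA.mul_mem_pow {p q : ℕ} {a b : A.carrier} (ha : a ∈ A.pow p)
    (hb : b ∈ A.pow q) : a * b ∈ A.pow (p + q + 1) := by
  induction q generalizing b with
  | zero => exact Submodule.subset_span ⟨a, ha, b, rfl⟩
  | succ q ih =>
    rw [NilpotentCDGA.pow] at hb
    induction hb using Submodule.span_induction with
    | zero => simp
    | add u u' _ _ hu hu' => rw [mul_add]; exact Submodule.add_mem _ hu hu'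
    | smul t u _ hu => rw [mul_smul_comm]; exact Submodule.smul_mem _ _ hu
    | mem u hu =>
      obtain ⟨b, hb, c, rfl⟩ := hu
      rw [← mul_assoc]
      exact Submodule.subset_span ⟨a * b, ih hb, c, rfl⟩

theorem NilpotentCDGA.par_mem_pow {p : ℕ} {a : A.carrier} (ha : a ∈ A.pow p) :
    A.dg.par a ∈ A.pow p := by
  induction p generalizing a with
  | zero => exact Submodule.mem_top
  | succ p ih =>
    rw [NilpotentCDGA.pow] at ha
    induction ha using Submodule.span_induction with
    | zero => simp
    | add u u' _ _ hu hu' => rw [map_add]; exact Submodule.add_mem _ hu hu'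
    | smul t u _ hu => rw [map_smul]; exact Submodule.smul_mem _ _ hu
    | mem u hu =>
      obtain ⟨b, hb, c, rfl⟩ := hu
      rw [A.par_mul]
      exact Submodule.subset_span ⟨_, ih hb, _, rfl⟩

theorem NilpotentCDGA.hproj_mem_pow {p : ℕ} {a : A.carrier} (ha : a ∈ A.pow p) (s : ZMod 2) :
    hproj A.dg.par s a ∈ A.pow p :=
  Submodule.smul_mem _ _ (Submodule.add_mem _ ha (Submodule.smul_mem _ _ (A.par_mem_pow ha)))

/-- Connects the recursive ideals with the left folds in terms of which nilpotency is stated.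
Multiplying on the right by one more element appends it to the list. -/
theorem NilpotentCDGA.pow_le_span_foldl (n : ℕ) : A.pow n ≤ Submodule.span k
    { z | ∃ (a : A.carrier) (l : List A.carrier), l.length = n ∧ z = l.foldl (· * ·) a } := by
  induction n with
  | zero => exact fun a _ => Submodule.subset_span ⟨a, [], rfl, rfl⟩
  | succ n ih =>
    refine Submodule.span_le.2 ?_
    rintro _ ⟨a, ha, b, rfl⟩
    have ha' := ih ha
    simp only [SetLike.mem_coe]
    clear ha
    induction ha' using Submodule.span_induction with
    | zero => simp
    | add u u' _ _ hu hu' => rw [add_mul]; exact Submodule.add_mem _ hu hu'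
    | smul t u _ hu => rw [smul_mul_assoc]; exact Submodule.smul_mem _ _ hu
    | mem u hu =>
      obtain ⟨c, l, hl, rfl⟩ := hu
      exact Submodule.subset_span ⟨c, l ++ [b], by simp [hl], by simp⟩

theorem NilpotentCDGA.exists_pow_eq_bot : ∃ n, A.pow n = ⊥ := by
  obtain ⟨n, hn⟩ := A.nilpotent
  refine ⟨n, ?_⟩
  rw [eq_bot_iff]
  refine (A.pow_le_span_foldl n).trans (Submodule.span_le.2 ?_)
  rintro _ ⟨a, l, hl, rfl⟩
  simpa using hn a l hl

variable {A} {S X : Bool} (P : OperadData.{u, w} k S)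

/-- The part of `A ⊗ P` with coefficients in `A.pow p`. -/
def tensorPow (A : NilpotentCDGA.{u, v} k) (p n : ℕ) : Submodule k (A.carrier ⊗[k] P.Ob n) :=
  Submodule.span k { z | ∃ a ∈ A.pow p, ∃ f, z = a ⊗ₜ f }

theorem mem_tensorPow_zero {n : ℕ} (F : A.carrier ⊗[k] P.Ob n) : F ∈ tensorPow P A 0 n := by
  suffices h : ⊤ ≤ tensorPow P A 0 n from h Submodule.mem_top
  rw [← TensorProduct.span_tmul_eq_top]
  refine Submodule.span_mono ?_
  rintro _ ⟨a, f, rfl⟩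
  exact ⟨a, Submodule.mem_top, f, rfl⟩

theorem tensorPow_antitone (n : ℕ) : Antitone fun p => tensorPow P A p n := by
  intro p q hpq
  refine Submodule.span_mono ?_
  rintro _ ⟨a, ha, f, rfl⟩
  exact ⟨a, A.pow_antitone hpq ha, f, rfl⟩

theorem tensorPow_eq_bot {p : ℕ} (hp : A.pow p = ⊥) (n : ℕ) : tensorPow P A p n = ⊥ := by
  rw [tensorPow, Submodule.span_eq_bot]
  rintro _ ⟨a, ha, f, rfl⟩
  rw [hp, Submodule.mem_bot] at ha
  rw [ha, TensorProduct.zero_tmul]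

variable {P}

theorem tensorComp_mem_tensorPow {p q a b c : ℕ} (h : a + b = c + 1) (i : Fin a)
    {F : A.carrier ⊗[k] P.Ob a} {G : A.carrier ⊗[k] P.Ob b} (hF : F ∈ tensorPow P A p a)
    (hG : G ∈ tensorPow P A q b) : tensorComp A P h i F G ∈ tensorPow P A (p + q + 1) c := by
  induction hF using Submodule.span_induction with
  | zero => simp
  | add u u' _ _ hu hu' =>
    rw [map_add, LinearMap.add_apply]; exact Submodule.add_mem _ hu hu'
  | smul t u _ hu => rw [map_smul, LinearMap.smul_apply]; exact Submodule.smul_mem _ _ hu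
  | mem u hu =>
    obtain ⟨x, hx, f, rfl⟩ := hu
    induction hG using Submodule.span_induction with
    | zero => simp
    | add u u' _ _ hu hu' => rw [map_add]; exact Submodule.add_mem _ hu hu'
    | smul t u _ hu => rw [map_smul]; exact Submodule.smul_mem _ _ hu
    | mem v hv =>
      obtain ⟨y, hy, g, rfl⟩ := hv
      simp only [tensorComp, LinearMap.sum_apply, TensorProduct.map₂_apply_tmul,
        LinearMap.comp_apply, TensorProduct.map_tmul, LinearMap.compl₂_apply, LinearMap.mul_apply']
      exact Submodule.sum_mem _ fun s _ =>
        Submodule.subset_span ⟨_, A.mul_mem_pow hx (A.hproj_mem_pow hy s), _, rfl⟩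

theorem tensorPerm_mem_tensorPow {p n : ℕ} (hS : S = true) (σ : Equiv.Perm (Fin n))
    {F : A.carrier ⊗[k] P.Ob n} (hF : F ∈ tensorPow P A p n) :
    TensorProduct.map LinearMap.id (P.perm hS σ) F ∈ tensorPow P A p n := by
  induction hF using Submodule.span_induction with
  | zero => simp
  | add u u' _ _ hu hu' => rw [map_add]; exact Submodule.add_mem _ hu hu'
  | smul t u _ hu => rw [map_smul]; exact Submodule.smul_mem _ _ hu
  | mem u hu =>
    obtain ⟨x, hx, f, rfl⟩ := hu
    rw [TensorProduct.map_tmul]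
    exact Submodule.subset_span ⟨x, hx, _, rfl⟩

/-- Each `x` brings one factor of `A`, so `w ≥ 1` occurrences give a product of at least `w`
factors, which has index `w - 1`. For `w = 0` the truncated subtraction gives the vacuous bound. At
a composition the extra `1` of `tensorComp_mem_tensorPow` makes up for subtracting `1` twice. -/
theorem evalMono_mem_tensorPow (μ : ∀ n, (tensorOperad A P).Ob (n + 1))
    (ξ : (tensorOperad A P).Ob 0) {n : ℕ} (f : Mono S X n) :
    evalMono (tensorOperad A P) μ ξ f ∈ tensorPow P A (f.wt - 1) n := by
  induction f with
  | m n => exact mem_tensorPow_zero (A := A) P (n := n + 1) (μ n)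
  | x h => exact mem_tensorPow_zero (A := A) P (n := 0) ξ
  | comp h i f g hf hg =>
    refine tensorPow_antitone P _ ?_ (tensorComp_mem_tensorPow h i hf hg)
    simp only [Mono.wt]
    omega
  | perm hS σ f hf => exact tensorPerm_mem_tensorPow hS σ hf

/-- Monomials with many occurrences of `x` vanish in `A ⊗ P`, for a nilpotent `A`. -/
theorem exists_evalMono_eq_zero (A : NilpotentCDGA.{u, v} k) (P : OperadData.{u, w} k S) :
    ∃ N : ℕ, ∀ (μ : ∀ n, (tensorOperad A P).Ob (n + 1)) (ξ : (tensorOperad A P).Ob 0) (X : Bool)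
      (n : ℕ) (f : Mono S X n), N ≤ f.wt → evalMono (tensorOperad A P) μ ξ f = 0 := by
  obtain ⟨p, hp⟩ := A.exists_pow_eq_bot
  refine ⟨p + 1, fun μ ξ X n f hf => ?_⟩
  have h := tensorPow_antitone P n (by omega : p ≤ f.wt - 1) (evalMono_mem_tensorPow μ ξ f)
  simp only [tensorPow_eq_bot P hp] at h
  exact (Submodule.mem_bot k).1 h

end Nilpotent

end MCOp

namespace MCOp

/-! ### The endomorphism operad: compositions -/

section End

variable {k : Type u} [Field k] {W : Type v} [AddCommGroup W] [Module k W] {D : DGStructure k W}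

theorem compArgs_of_lt {a b c : ℕ} (h : a + b = c + 1) (i : Fin a) (s : W →ₗ[k] W)
    (g : MultilinearMap k (fun _ : Fin b => W) W) (v : Fin c → W) {q : Fin a} (hq : q.val < i.val) :
    compArgs h i s g v q = s (v ⟨q.val, by omega⟩) := by
  simp [compArgs, hq]

theorem compArgs_self {a b c : ℕ} (h : a + b = c + 1) (i : Fin a) (s : W →ₗ[k] W)
    (g : MultilinearMap k (fun _ : Fin b => W) W) (v : Fin c → W) :
    compArgs h i s g v i = g (fun r : Fin b => v ⟨i.val + r.val, by omega⟩) := by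
  simp [compArgs]

theorem compArgs_of_gt {a b c : ℕ} (h : a + b = c + 1) (i : Fin a) (s : W →ₗ[k] W)
    (g : MultilinearMap k (fun _ : Fin b => W) W) (v : Fin c → W) {q : Fin a} (hq : i.val < q.val) :
    compArgs h i s g v q = v ⟨q.val + b - 1, by omega⟩ := by
  simp [compArgs, hq.not_gt, hq.ne']

theorem endPar_apply {n : ℕ} (f : MultilinearMap k (fun _ : Fin n => W) W) (v : Fin n → W) :
    endPar D f v = D.par (f fun r => D.par (v r)) := rfl

theorem endPar_endPar {n : ℕ} (f : MultilinearMap k (fun _ : Fin n => W) W) :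
    endPar D (endPar D f) = f := by
  ext v
  simp [endPar_apply, D.par_par]

theorem endPar_apply_par {n : ℕ} (f : MultilinearMap k (fun _ : Fin n => W) W) (v : Fin n → W) :
    endPar D f (fun r => D.par (v r)) = D.par (f v) := by
  simp [endPar_apply, D.par_par]

theorem apply_par_of_eq {n : ℕ} {g : MultilinearMap k (fun _ : Fin n => W) W} {t : ZMod 2}
    (hg : endPar D g = sg k t • g) (v : Fin n → W) :
    g (fun r => D.par (v r)) = sg k t • D.par (g v) := by
  rw [← endPar_apply_par, hg, smul_apply, smul_smul, sg_mul_self, one_smul]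

theorem apply_parPow_of_eq {n : ℕ} {g : MultilinearMap k (fun _ : Fin n => W) W} {t : ZMod 2}
    (hg : endPar D g = sg k t • g) (p : ZMod 2) (v : Fin n → W) :
    g (fun r => parPow D.par p (v r)) = sg k (p * t) • parPow D.par p (g v) := by
  rcases zmod_two_cases p with rfl | rfl
  · simp [parPow, sg_zero]
  · simpa [parPow] using apply_par_of_eq hg v

/-- The composition of `End(W)`. -/
noncomputable def endComp (D : DGStructure k W) {a b c : ℕ} (h : a + b = c + 1) (i : Fin a) :
    MultilinearMap k (fun _ : Fin a => W) W →ₗ[k]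
      MultilinearMap k (fun _ : Fin b => W) W →ₗ[k] MultilinearMap k (fun _ : Fin c => W) W :=
  ∑ p : ZMod 2, (insertAtₗ h i (parPow D.par p)).compl₂ (hproj (endPar D) p)

theorem insertAt_apply {a b c : ℕ} (h : a + b = c + 1) (i : Fin a) (s : W →ₗ[k] W)
    (f : MultilinearMap k (fun _ : Fin a => W) W) (g : MultilinearMap k (fun _ : Fin b => W) W)
    (v : Fin c → W) : insertAt h i s f g v = f (compArgs h i s g v) := rfl

theorem insertAt_smul {a b c : ℕ} (h : a + b = c + 1) (i : Fin a) (s : W →ₗ[k] W)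
    (f : MultilinearMap k (fun _ : Fin a => W) W) (x : k)
    (g : MultilinearMap k (fun _ : Fin b => W) W) :
    insertAt h i s f (x • g) = x • insertAt h i s f g := (insertAtₗ h i s f).map_smul x g

theorem endPar_insertAt {a b c : ℕ} (h : a + b = c + 1) (i : Fin a) (p : ZMod 2)
    (f : MultilinearMap k (fun _ : Fin a => W) W) (g : MultilinearMap k (fun _ : Fin b => W) W) :
    endPar D (insertAt h i (parPow D.par p) f g) =
      insertAt h i (parPow D.par p) (endPar D f) (endPar D g) := by
  ext v
  rw [endPar_apply, insertAt_apply, insertAt_apply, endPar_apply]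
  congr 2
  funext q
  rcases lt_trichotomy q i with hq | rfl | hq
  · rw [compArgs_of_lt _ _ _ _ _ hq, compArgs_of_lt _ _ _ _ _ hq, par_parPow]
  · rw [compArgs_self, compArgs_self, endPar_apply, D.par_par]
  · rw [compArgs_of_gt _ _ _ _ _ hq, compArgs_of_gt _ _ _ _ _ hq]

theorem endPar_insertAt_of_eq {a b c : ℕ} (h : a + b = c + 1) (i : Fin a) {s t : ZMod 2}
    {f : MultilinearMap k (fun _ : Fin a => W) W} {g : MultilinearMap k (fun _ : Fin b => W) W}
    (hf : endPar D f = sg k s • f) (hg : endPar D g = sg k t • g) :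
    endPar D (insertAt h i (parPow D.par t) f g) =
      sg k (s + t) • insertAt h i (parPow D.par t) f g := by
  rw [endPar_insertAt, hf, hg, insertAt_smul, sg_add, mul_comm, ← smul_smul]
  rfl

/-! #### The positions of the inputs of a composition -/

/-- The input of `f ∘ᵢ g` corresponding to an input of `g`. -/
def innerSlot {a b c : ℕ} (h : a + b = c + 1) (i : Fin a) (r : Fin b) : Fin c :=
  ⟨i.val + r.val, by omega⟩

/-- The input of `f ∘ᵢ g` corresponding to an input of `f` other than `i`. -/
def outerSlot {a b c : ℕ} (h : a + b = c + 1) (i : Fin a) (q : {q : Fin a // q ≠ i}) : Fin c :=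
  ⟨outerPos i.val b q.1.val, by
    have := Fin.val_ne_of_ne q.2
    unfold outerPos
    split_ifs <;> omega⟩

/-- Inputs of `f ∘ᵢ g` lie before, inside or after the block of `g`. The decomposition remains valid
for `b = 0`, when the block is empty. It is used to split sums over inputs into an outer and an
inner part. -/
theorem slot_bijective {a b c : ℕ} (h : a + b = c + 1) (i : Fin a) :
    Function.Bijective (Sum.elim (outerSlot h i) (innerSlot h i)) := by
  constructor
  · rintro (⟨q, hq⟩ | r) (⟨q', hq'⟩ | r') e
    all_goals
      have e' := congrArg Fin.val e
      simp only [Sum.elim_inl, Sum.elim_inr, outerSlot, innerSlot, outerPos] at e'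
    · have := Fin.val_ne_of_ne hq
      have := Fin.val_ne_of_ne hq'
      have : q = q' := by
        apply Fin.ext
        split_ifs at e' <;> omega
      subst this; rfl
    · have := Fin.val_ne_of_ne hq
      split_ifs at e' <;> omega
    · have := Fin.val_ne_of_ne hq'
      split_ifs at e' <;> omega
    · congr 1; apply Fin.ext; omega
  · intro u
    by_cases h1 : u.val < i.val
    · refine ⟨.inl ⟨⟨u.val, by omega⟩, fun e => ?_⟩, Fin.ext ?_⟩
      · have := congrArg Fin.val e; simp at this; omega
      · simp [outerSlot, outerPos, h1]
    · by_cases h2 : u.val < i.val + b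
      · exact ⟨.inr ⟨u.val - i.val, by omega⟩, Fin.ext (by simp [innerSlot]; omega)⟩
      · refine ⟨.inl ⟨⟨u.val + 1 - b, by omega⟩, fun e => ?_⟩, Fin.ext ?_⟩
        · have := congrArg Fin.val e; simp at this; omega
        · simp only [Sum.elim_inl, outerSlot, outerPos]
          split_ifs <;> omega

theorem sum_slots {M : Type*} [AddCommMonoid M] {a b c : ℕ} (h : a + b = c + 1) (i : Fin a)
    (F : Fin c → M) :
    ∑ u, F u = ∑ q : {q : Fin a // q ≠ i}, F (outerSlot h i q) + ∑ r, F (innerSlot h i r) := by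
  rw [← (Equiv.ofBijective _ (slot_bijective h i)).sum_comp F, Fintype.sum_sum_type]
  rfl

theorem compArgs_of_ne {a b c : ℕ} (h : a + b = c + 1) (i : Fin a) (s : W →ₗ[k] W)
    (g : MultilinearMap k (fun _ : Fin b => W) W) (v : Fin c → W) (q : {q : Fin a // q ≠ i}) :
    compArgs h i s g v q.1 = (if q.1 < i then s else LinearMap.id) (v (outerSlot h i q)) := by
  obtain ⟨q, hq⟩ := q
  rcases lt_or_gt_of_ne hq with hlt | hlt
  · have hlt' : q.val < i.val := hlt
    rw [compArgs_of_lt _ _ _ _ _ hlt, if_pos hlt]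
    simp [outerSlot, outerPos, hlt']
  · have hlt' : i.val < q.val := hlt
    rw [compArgs_of_gt _ _ _ _ _ hlt, if_neg hlt.not_gt]
    simp [outerSlot, outerPos, hlt'.not_gt]

theorem compArgs_inner {a b c : ℕ} (h : a + b = c + 1) (i : Fin a) (s : W →ₗ[k] W)
    (g : MultilinearMap k (fun _ : Fin b => W) W) (v : Fin c → W) :
    compArgs h i s g v i = g (fun r => v (innerSlot h i r)) := compArgs_self h i s g v

/-- The block of inputs of `g` stands where the slot `i` of `f` stood. This and the next three
comparisons therefore reduce the order on the inputs of `f ∘ᵢ g` to the orders on those of `f` and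
of `g`. -/
theorem outerSlot_lt_outerSlot {a b c : ℕ} (h : a + b = c + 1) (i : Fin a)
    (q q' : {q : Fin a // q ≠ i}) : outerSlot h i q < outerSlot h i q' ↔ q.1 < q'.1 := by
  obtain ⟨q, hq⟩ := q
  obtain ⟨q', hq'⟩ := q'
  have := Fin.val_ne_of_ne hq
  have := Fin.val_ne_of_ne hq'
  simp only [Fin.lt_def, outerSlot, outerPos]
  split_ifs <;> omega

theorem outerSlot_lt_innerSlot {a b c : ℕ} (h : a + b = c + 1) (i : Fin a)
    (q : {q : Fin a // q ≠ i}) (r : Fin b) : outerSlot h i q < innerSlot h i r ↔ q.1 < i := by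
  obtain ⟨q, hq⟩ := q
  have := Fin.val_ne_of_ne hq
  simp only [Fin.lt_def, outerSlot, innerSlot, outerPos]
  split_ifs <;> omega

theorem innerSlot_lt_outerSlot {a b c : ℕ} (h : a + b = c + 1) (i : Fin a)
    (q : {q : Fin a // q ≠ i}) (r : Fin b) : innerSlot h i r < outerSlot h i q ↔ i < q.1 := by
  obtain ⟨q, hq⟩ := q
  have := Fin.val_ne_of_ne hq
  simp only [Fin.lt_def, outerSlot, innerSlot, outerPos]
  split_ifs <;> omega

theorem innerSlot_lt_innerSlot {a b c : ℕ} (h : a + b = c + 1) (i : Fin a) (r r' : Fin b) :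
    innerSlot h i r < innerSlot h i r' ↔ r < r' := by
  simp only [Fin.lt_def, innerSlot]
  omega

/-! #### The differential -/

/-- The arguments of the term of `d f` in which `d` is applied to the argument `q`. -/
def diffArgs (D : DGStructure k W) {n : ℕ} (q : Fin n) (v : Fin n → W) : Fin n → W := fun r =>
  (if r < q then D.par else if r = q then D.d else LinearMap.id) (v r)

theorem diffArgs_of_lt {n : ℕ} {q r : Fin n} (v : Fin n → W) (h : r < q) :
    diffArgs D q v r = D.par (v r) := by simp [diffArgs, h]

theorem diffArgs_self {n : ℕ} (q : Fin n) (v : Fin n → W) :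
    diffArgs D q v q = D.d (v q) := by simp [diffArgs]

theorem diffArgs_of_gt {n : ℕ} {q r : Fin n} (v : Fin n → W) (h : q < r) :
    diffArgs D q v r = v r := by simp [diffArgs, h.not_gt, h.ne']

theorem endDiff_apply {n : ℕ} (f : MultilinearMap k (fun _ : Fin n => W) W) (v : Fin n → W) :
    endDiff D f v = D.d (f v) - ∑ q, endPar D f (diffArgs D q v) := by
  change (D.d.compMultilinearMap f - ∑ q : Fin n, (endPar D f).compLinearMap fun r =>
      if r < q then D.par else if r = q then D.d else LinearMap.id) v = _
  simp only [sub_apply, sum_apply]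
  rfl

/-- Conjugating by the involution changes only the argument to which `d` is applied, and changes it
by `-1`, because `d` is odd. -/
theorem endDiff_endPar {n : ℕ} (f : MultilinearMap k (fun _ : Fin n => W) W) :
    endDiff D (endPar D f) = -endPar D (endDiff D f) := by
  have hd : ∀ w, D.par (D.d (D.par w)) = -D.d w := fun w => by
    rw [D.d_par, map_neg, D.par_par]
  ext v
  have key : ∀ q, D.par (endPar D f (diffArgs D q fun r => D.par (v r))) =
      -f (diffArgs D q v) := fun q => by
    rw [endPar_apply, D.par_par]
    have : (fun r => D.par (diffArgs D q (fun r => D.par (v r)) r)) =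
        Function.update (diffArgs D q v) q ((-1 : k) • diffArgs D q v q) := by
      funext r
      rcases lt_trichotomy r q with hr | rfl | hr
      · rw [Function.update_of_ne hr.ne, diffArgs_of_lt _ hr, diffArgs_of_lt _ hr, D.par_par]
      · rw [Function.update_self, diffArgs_self, diffArgs_self, hd, neg_one_smul]
      · rw [Function.update_of_ne hr.ne', diffArgs_of_gt _ hr, diffArgs_of_gt _ hr, D.par_par]
    rw [this, MultilinearMap.map_update_smul, Function.update_eq_self, neg_one_smul]
  rw [endDiff_apply, endPar_endPar, neg_apply, endPar_apply, endPar_apply, endDiff_apply, map_sub,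
    map_sum, D.d_par, Finset.sum_congr rfl fun q _ => key q, Finset.sum_neg_distrib]
  abel

theorem endPar_endDiff_of_eq {n : ℕ} {f : MultilinearMap k (fun _ : Fin n => W) W} {t : ZMod 2}
    (hf : endPar D f = sg k t • f) : endPar D (endDiff D f) = sg k (t + 1) • endDiff D f :=
  odd_of_eq endDiff_endPar hf

/-- The terms of `d (f ∘ᵢ g)` at inputs of `f` match those of `d f ∘ᵢ g`, and the terms at inputs of
`g` match those of `f ∘ᵢ d g`. What is left over is `d` applied to the value of `g`. It occurs once
in each of the last two expressions, with opposite signs. -/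
theorem endDiff_insertAt {a b c : ℕ} (h : a + b = c + 1) (i : Fin a)
    (f : MultilinearMap k (fun _ : Fin a => W) W) {g : MultilinearMap k (fun _ : Fin b => W) W}
    {t : ZMod 2} (hg : endPar D g = sg k t • g) :
    endDiff D (insertAt h i (parPow D.par t) f g) =
      insertAt h i (parPow D.par t) (endDiff D f) g +
        insertAt h i (parPow D.par (t + 1)) (endPar D f) (endDiff D g) := by
  ext v
  rw [add_apply, insertAt_apply, insertAt_apply, endDiff_apply, endDiff_apply, endPar_insertAt,
    insertAt_apply, sum_slots h i, Fintype.sum_eq_add_sum_subtype_ne _ i]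
  have outer : ∀ q : {q : Fin a // q ≠ i},
      insertAt h i (parPow D.par t) (endPar D f) (endPar D g) (diffArgs D (outerSlot h i q) v) =
        endPar D f (diffArgs D q.1 (compArgs h i (parPow D.par t) g v)) := by
    rintro ⟨q, hq⟩
    rcases lt_or_gt_of_ne hq with hqi | hqi
    · rw [hg, insertAt_smul, smul_apply, insertAt_apply]
      set C := compArgs h i (parPow D.par t) g (diffArgs D (outerSlot h i ⟨q, hq⟩) v) with hC
      -- For `q` before the block, `d` has to pass `parPow t`. The resulting sign is the one that
      -- `endPar D g = sg k t • g` produces on the other side.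
      have hCq : diffArgs D q (compArgs h i (parPow D.par t) g v) =
          Function.update C q (sg k t • C q) := by
        funext r
        by_cases hri : r = i
        · subst hri
          rw [Function.update_of_ne hqi.ne', hC, compArgs_inner, diffArgs_of_gt _ hqi,
            compArgs_inner]
          congr 1
          funext l
          rw [diffArgs_of_gt _ ((outerSlot_lt_innerSlot h r ⟨q, hq⟩ l).2 hqi)]
        · have h1 := compArgs_of_ne h i (parPow D.par t) g v ⟨r, hri⟩
          have h2 := compArgs_of_ne h i (parPow D.par t) g
            (diffArgs D (outerSlot h i ⟨q, hq⟩) v) ⟨r, hri⟩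
          have h3 := outerSlot_lt_outerSlot h i ⟨r, hri⟩ ⟨q, hq⟩
          have h4 := outerSlot_lt_outerSlot h i ⟨q, hq⟩ ⟨r, hri⟩
          simp only at h1 h2 h3 h4
          rcases lt_trichotomy r q with hr | rfl | hr
          · rw [Function.update_of_ne hr.ne, diffArgs_of_lt _ hr, hC, h1, h2,
              diffArgs_of_lt _ (h3.2 hr), if_pos (hr.trans hqi), par_parPow]
          · rw [Function.update_self, diffArgs_self, hC, h1, h2, diffArgs_self, if_pos hqi,
              odd_parPow D.d_par]
          · rw [Function.update_of_ne hr.ne', diffArgs_of_gt _ hr, hC, h1, h2,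
              diffArgs_of_gt _ (h4.2 hr)]
      rw [hCq, MultilinearMap.map_update_smul, Function.update_eq_self]
    -- For `q` after the block, one side applies the involution to the value of `g` and the other to
    -- each of its inputs; `endPar D g` accounts for the difference.
    · rw [insertAt_apply]
      congr 1
      funext r
      by_cases hri : r = i
      · subst hri
        rw [diffArgs_of_lt _ hqi, compArgs_inner, compArgs_inner, ← endPar_apply_par]
        congr 1
        funext l
        rw [diffArgs_of_lt _ ((innerSlot_lt_outerSlot h r ⟨q, hq⟩ l).2 hqi)]
      · have h1 := compArgs_of_ne h i (parPow D.par t) g v ⟨r, hri⟩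
        have h2 := compArgs_of_ne h i (parPow D.par t) (endPar D g)
          (diffArgs D (outerSlot h i ⟨q, hq⟩) v) ⟨r, hri⟩
        have h3 := outerSlot_lt_outerSlot h i ⟨r, hri⟩ ⟨q, hq⟩
        have h4 := outerSlot_lt_outerSlot h i ⟨q, hq⟩ ⟨r, hri⟩
        simp only at h1 h2 h3 h4
        rcases lt_trichotomy r q with hr | rfl | hr
        · rw [diffArgs_of_lt _ hr, h1, h2, diffArgs_of_lt _ (h3.2 hr)]
          split_ifs
          · rw [par_parPow]
          · rfl
        · rw [diffArgs_self, h1, h2, diffArgs_self, if_neg (not_lt_of_gt hqi)]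
          rfl
        · rw [diffArgs_of_gt _ hr, h1, h2, diffArgs_of_gt _ (h4.2 hr)]
  -- All argument lists here agree off the slot `i`: `parPow (t + 1)` on the left is `parPow t`
  -- followed by the involution that `d`, acting further to the right, leaves on earlier arguments.
  -- The identity is then linearity of `endPar D f` in the slot `i`, applied to the definition of `d
  -- g`.
  have inner : endPar D f (compArgs h i (parPow D.par (t + 1)) (endDiff D g) v) =
      endPar D f (diffArgs D i (compArgs h i (parPow D.par t) g v)) -
      ∑ r, insertAt h i (parPow D.par t) (endPar D f) (endPar D g)
        (diffArgs D (innerSlot h i r) v) := by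
    set B := diffArgs D i (compArgs h i (parPow D.par t) g v) with hB
    set u : Fin b → W := fun r => v (innerSlot h i r) with hu
    have hBi : B i = D.d (g u) := by rw [hB, diffArgs_self, compArgs_inner]
    have hBlt : ∀ q : {q : Fin a // q ≠ i}, q.1 < i →
        B q.1 = D.par (parPow D.par t (v (outerSlot h i q))) := fun q hq => by
      rw [hB, diffArgs_of_lt _ hq, compArgs_of_ne, if_pos hq]
    have hBgt : ∀ q : {q : Fin a // q ≠ i}, i < q.1 → B q.1 = v (outerSlot h i q) :=
      fun q hq => by
        rw [hB, diffArgs_of_gt _ hq, compArgs_of_ne, if_neg hq.not_gt, LinearMap.id_apply]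
    have h1 : compArgs h i (parPow D.par (t + 1)) (endDiff D g) v =
        Function.update B i (endDiff D g u) := by
      funext q
      by_cases hq : q = i
      · subst hq
        rw [Function.update_self, compArgs_inner]
      · have e := compArgs_of_ne h i (parPow D.par (t + 1)) (endDiff D g) v ⟨q, hq⟩
        simp only at e
        rw [Function.update_of_ne hq, e]
        rcases lt_or_gt_of_ne hq with hqi | hqi
        · rw [if_pos hqi, hBlt ⟨q, hq⟩ hqi, add_comm, parPow_add D.par_par, parPow_one]
        · rw [if_neg hqi.not_gt, hBgt ⟨q, hq⟩ hqi, LinearMap.id_apply]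
    have h2 : ∀ r, compArgs h i (parPow D.par t) (endPar D g) (diffArgs D (innerSlot h i r) v) =
        Function.update B i (endPar D g (diffArgs D r u)) := by
      intro r
      funext q
      by_cases hq : q = i
      · subst hq
        rw [Function.update_self, compArgs_inner]
        congr 1
        funext l
        rcases lt_trichotomy l r with hl | rfl | hl
        · rw [diffArgs_of_lt _ hl, diffArgs_of_lt _ ((innerSlot_lt_innerSlot h q l r).2 hl)]
        · rw [diffArgs_self, diffArgs_self]
        · rw [diffArgs_of_gt _ hl, diffArgs_of_gt _ ((innerSlot_lt_innerSlot h q r l).2 hl)]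
      · have e := compArgs_of_ne h i (parPow D.par t) (endPar D g)
          (diffArgs D (innerSlot h i r) v) ⟨q, hq⟩
        simp only at e
        rw [Function.update_of_ne hq, e]
        rcases lt_or_gt_of_ne hq with hqi | hqi
        · rw [if_pos hqi, hBlt ⟨q, hq⟩ hqi,
            diffArgs_of_lt _ ((outerSlot_lt_innerSlot h i ⟨q, hq⟩ r).2 hqi), par_parPow]
        · rw [if_neg hqi.not_gt, hBgt ⟨q, hq⟩ hqi, LinearMap.id_apply,
            diffArgs_of_gt _ ((innerSlot_lt_outerSlot h i ⟨q, hq⟩ r).2 hqi)]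
    have h3 : B = Function.update B i (D.d (g u)) := by rw [← hBi, Function.update_eq_self]
    have h4 : ∀ w, endPar D f (Function.update B i w) = (endPar D f).toLinearMap B i w :=
      fun w => rfl
    simp only [insertAt_apply, h1, h2]
    conv_rhs => rw [h3]
    simp only [Function.update_idem, h4]
    rw [endDiff_apply, map_sub, map_sum]
  rw [inner, Finset.sum_congr rfl fun q _ => outer q]
  abel

variable [CharZero k]

theorem endComp_of_eq {a b c : ℕ} (h : a + b = c + 1) (i : Fin a)
    (f : MultilinearMap k (fun _ : Fin a => W) W) {g : MultilinearMap k (fun _ : Fin b => W) W}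
    {t : ZMod 2} (hg : endPar D g = sg k t • g) :
    endComp D h i f g = insertAt h i (parPow D.par t) f g := by
  simp only [endComp, LinearMap.sum_apply, LinearMap.compl₂_apply]
  rw [Finset.sum_eq_single t]
  · rw [hproj_of_eq hg]; rfl
  · intro p _ hp
    rw [hproj_of_ne hp hg, map_zero]
  · simp

theorem end_homogeneous_induction (D : DGStructure k W) {n : ℕ}
    {motive : MultilinearMap k (fun _ : Fin n => W) W → Prop}
    (g : MultilinearMap k (fun _ : Fin n => W) W)
    (add : ∀ a b, motive a → motive b → motive (a + b))
    (homog : ∀ s a, endPar D a = sg k s • a → motive a) : motive g :=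
  homogeneous_induction (par := endPar D) endPar_endPar g add homog

theorem endPar_endComp {a b c : ℕ} (h : a + b = c + 1) (i : Fin a)
    (f : MultilinearMap k (fun _ : Fin a => W) W) (g : MultilinearMap k (fun _ : Fin b => W) W) :
    endPar D (endComp D h i f g) = endComp D h i (endPar D f) (endPar D g) := by
  induction g using end_homogeneous_induction D with
  | add x y hx hy => simp only [map_add, hx, hy]
  | homog t g hg =>
    have hg' : endPar D (endPar D g) = sg k t • endPar D g := by rw [hg, map_smul, hg]
    rw [endComp_of_eq h i f hg, endComp_of_eq h i _ hg', endPar_insertAt]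

/-- The arguments before slot `i` are acted on by `parPow s` and `parPow t` on one side and by
`parPow (s + t)` on the other, since `g ∘ⱼ h` has parity `s + t`. Elsewhere only positions have to
be matched. -/
theorem endComp_seq {a b c e e' r : ℕ} (h₁ : a + b = e + 1)
    (h₂ : e + c = r + 1) (h₃ : b + c = e' + 1) (h₄ : a + e' = r + 1) (i : Fin a) (j : Fin b)
    (p : Fin e) (hp : p.val = i.val + j.val) (f : MultilinearMap k (fun _ : Fin a => W) W)
    (g : MultilinearMap k (fun _ : Fin b => W) W) (h : MultilinearMap k (fun _ : Fin c => W) W) :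
    endComp D h₂ p (endComp D h₁ i f g) h = endComp D h₄ i f (endComp D h₃ j g h) := by
  induction g using end_homogeneous_induction D with
  | add x y hx hy => simp only [map_add, LinearMap.add_apply, hx, hy]
  | homog s g hg =>
  induction h using end_homogeneous_induction D with
  | add x y hx hy => simp only [map_add, hx, hy]
  | homog t h hh =>
  rw [endComp_of_eq h₁ i f hg, endComp_of_eq h₂ p _ hh, endComp_of_eq h₃ j _ hh,
    endComp_of_eq h₄ i _ (endPar_insertAt_of_eq h₃ j hg hh)]
  ext v
  simp only [insertAt_apply]
  congr 1
  funext q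
  rcases lt_trichotomy q i with hq | rfl | hq
  · have hq' : q.val < i.val := hq
    rw [compArgs_of_lt _ _ _ _ _ hq, compArgs_of_lt _ _ _ _ _ hq,
      compArgs_of_lt _ _ _ _ _ (by simp only; omega), parPow_add D.par_par]
  · rw [compArgs_self, compArgs_self, insertAt_apply]
    congr 1
    funext r
    rcases lt_trichotomy r j with hr | rfl | hr
    · have hr' : r.val < j.val := hr
      rw [compArgs_of_lt _ _ _ _ _ hr, compArgs_of_lt _ _ _ _ _ (by simp only; omega)]
    · have : (⟨q.val + r.val, by omega⟩ : Fin e) = p := Fin.ext hp.symm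
      rw [this, compArgs_self, compArgs_self]
      congr 1
      funext l
      congr 1
      apply Fin.ext
      simp only
      omega
    · have hr' : j.val < r.val := hr
      rw [compArgs_of_gt _ _ _ _ _ hr, compArgs_of_gt _ _ _ _ _ (by simp only; omega)]
      congr 1
      apply Fin.ext
      simp only
      omega
  · have hq' : i.val < q.val := hq
    rw [compArgs_of_gt _ _ _ _ _ hq, compArgs_of_gt _ _ _ _ _ hq,
      compArgs_of_gt _ _ _ _ _ (by simp only; omega)]
    congr 1
    apply Fin.ext
    simp only
    omega

theorem endComp_par {a b c e e' r : ℕ} (h₁ : a + b = e + 1)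
    (h₂ : e + c = r + 1) (h₃ : a + c = e' + 1) (h₄ : e' + b = r + 1) (i j : Fin a) (hij : i < j)
    (p : Fin e) (hp : p.val + 1 = j.val + b) (q : Fin e') (hq : q.val = i.val)
    (f : MultilinearMap k (fun _ : Fin a => W) W)
    (g : MultilinearMap k (fun _ : Fin b => W) W) (h : MultilinearMap k (fun _ : Fin c => W) W)
    (s t : ZMod 2) (hg : endPar D g = sg k s • g) (hh : endPar D h = sg k t • h) :
    endComp D h₂ p (endComp D h₁ i f g) h =
      sg k (s * t) • endComp D h₄ q (endComp D h₃ j f h) g := by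
  have hij' : i.val < j.val := hij
  rw [endComp_of_eq h₁ i f hg, endComp_of_eq h₂ p _ hh, endComp_of_eq h₃ j _ hh,
    endComp_of_eq h₄ q _ hg]
  ext v
  simp only [insertAt_apply, smul_apply]
  set R := compArgs h₃ j (parPow D.par t) h (compArgs h₄ q (parPow D.par s) g v) with hR
  -- The sign arises in the slot `i` alone. On the left, the later insertion of `h` applies `parPow
  -- t` to the inputs of `g`; on the right it applies it to the value of `g`. The two differ by
  -- `(-1)^{st}`.
  have key : compArgs h₁ i (parPow D.par s) g (compArgs h₂ p (parPow D.par t) h v) =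
      Function.update R i (sg k (s * t) • R i) := by
    funext l
    rcases lt_trichotomy l i with hl | rfl | hl
    · have hl' : l.val < i.val := hl
      rw [Function.update_of_ne hl.ne, hR, compArgs_of_lt _ _ _ _ _ hl,
        compArgs_of_lt _ _ _ _ _ (hl.trans hij), compArgs_of_lt _ _ _ _ _ (by simp only; omega),
        compArgs_of_lt _ _ _ _ _ (by simp only; omega), parPow_comm]
    · rw [Function.update_self, hR, compArgs_of_lt _ _ _ _ _ hij, compArgs_self]
      have e1 : (⟨l.val, by omega⟩ : Fin e') = q := Fin.ext hq.symm
      rw [e1, compArgs_self, mul_comm, ← apply_parPow_of_eq hg]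
      congr 1
      funext r
      rw [compArgs_of_lt _ _ _ _ _ (by simp only; omega)]
      congr 2
      apply Fin.ext
      simp only
      omega
    · have hl' : i.val < l.val := hl
      rw [Function.update_of_ne hl.ne', hR, compArgs_of_gt _ _ _ _ _ hl]
      rcases lt_trichotomy l j with hj | rfl | hj
      · have hj' : l.val < j.val := hj
        rw [compArgs_of_lt _ _ _ _ _ hj, compArgs_of_lt _ _ _ _ _ (by simp only; omega),
          compArgs_of_gt _ _ _ _ _ (by simp only; omega)]
      · have e1 : (⟨l.val + b - 1, by omega⟩ : Fin e) = p := Fin.ext (by simp only; omega)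
        rw [e1, compArgs_self, compArgs_self]
        congr 1
        funext r
        rw [compArgs_of_gt _ _ _ _ _ (by simp only; omega)]
        congr 1
        apply Fin.ext
        simp only
        omega
      · have hj' : j.val < l.val := hj
        rw [compArgs_of_gt _ _ _ _ _ hj, compArgs_of_gt _ _ _ _ _ (by simp only; omega),
          compArgs_of_gt _ _ _ _ _ (by simp only; omega)]
        congr 1
        apply Fin.ext
        simp only
        omega
  rw [key, MultilinearMap.map_update_smul, Function.update_eq_self]

theorem endDiff_endComp {a b c : ℕ} (h : a + b = c + 1) (i : Fin a)
    (f : MultilinearMap k (fun _ : Fin a => W) W) (g : MultilinearMap k (fun _ : Fin b => W) W) :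
    endDiff D (endComp D h i f g) =
      endComp D h i (endDiff D f) g + endComp D h i (endPar D f) (endDiff D g) := by
  induction g using end_homogeneous_induction D with
  | add x y hx hy => simp only [map_add, hx, hy]; abel
  | homog t g hg =>
    rw [endComp_of_eq h i f hg, endComp_of_eq h i _ hg,
      endComp_of_eq h i _ (endPar_endDiff_of_eq hg), endDiff_insertAt h i f hg]

end End

end MCOp

namespace MCOp

/-! ### The endomorphism operad: permutations -/

/-! ### Exponents of Koszul signs in `ZMod 2`. -/

section Exponents

/-- The exponent of the Koszul sign. -/
def koszulExp {n : ℕ} (σ : Equiv.Perm (Fin n)) (p : Fin n → ZMod 2) : ZMod 2 :=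
  ∑ q, ∑ r, if q < r ∧ σ r < σ q then p (σ q) * p (σ r) else 0

/-- The total parity of the entries before `q`. -/
def preExp {n : ℕ} (q : Fin n) (p : Fin n → ZMod 2) : ZMod 2 :=
  ∑ r, if r < q then p r else 0

theorem sg_sum (k : Type u) [Field k] {ι : Type*} (s : Finset ι) (e : ι → ZMod 2) :
    sg k (∑ i ∈ s, e i) = ∏ i ∈ s, sg k (e i) := by
  induction s using Finset.cons_induction with
  | empty => simp [sg_zero]
  | cons i s hi ih => rw [Finset.sum_cons, Finset.prod_cons, sg_add, ih]

theorem koszulSign_eq (k : Type u) [Field k] {n : ℕ} (σ : Equiv.Perm (Fin n))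
    (p : Fin n → ZMod 2) : koszulSign k σ p = sg k (koszulExp σ p) := by
  simp only [koszulSign, koszulExp, sg_sum]
  refine Finset.prod_congr rfl fun q _ => Finset.prod_congr rfl fun r _ => ?_
  split_ifs
  · rfl
  · exact (sg_zero k).symm

theorem sum_sum_eq_zero_of_symm {n : ℕ} {G : Fin n → Fin n → ZMod 2} (h : ∀ q r, G q r = G r q)
    (h0 : ∀ q, G q q = 0) : ∑ q, ∑ r, G q r = 0 := by
  rw [← Finset.sum_product', Finset.univ_product_univ]
  refine Finset.sum_involution (fun x _ => x.swap) ?_ ?_ (fun _ _ => Finset.mem_univ _)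
    (fun _ _ => Prod.swap_swap _)
  · rintro ⟨q, r⟩ _
    simp only [Prod.swap, h r q]
    exact CharTwo.add_self_eq_zero _
  · rintro ⟨q, r⟩ _ hne e
    simp only [Prod.swap, Prod.mk.injEq] at e
    obtain ⟨rfl, _⟩ := e
    exact hne (h0 _)

theorem koszulExp_one {n : ℕ} (p : Fin n → ZMod 2) : koszulExp 1 p = 0 := by
  unfold koszulExp
  refine Finset.sum_eq_zero fun q _ => Finset.sum_eq_zero fun r _ => if_neg ?_
  rintro ⟨h, h'⟩
  exact lt_asymm h h'

/-- A pair is inverted by `σ * τ` exactly when one, but not both, of these happens: `τ` inverts it,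
or `σ` inverts its image. After reindexing by `τ`, the three sums together have a summand symmetric
in `q` and `r` and zero on the diagonal, so it cancels in pairs modulo `2`. -/
theorem koszulExp_mul {n : ℕ} (σ τ : Equiv.Perm (Fin n)) (p : Fin n → ZMod 2) :
    koszulExp (σ * τ) p = koszulExp σ p + koszulExp τ (p ∘ σ) := by
  have h1 : koszulExp σ p = ∑ q, ∑ r, if τ q < τ r ∧ σ (τ r) < σ (τ q) then
      p (σ (τ q)) * p (σ (τ r)) else 0 := by
    rw [koszulExp, ← Equiv.sum_comp τ]
    exact Finset.sum_congr rfl fun q _ => (Equiv.sum_comp τ _).symm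
  rw [← CharTwo.add_eq_zero, h1]
  simp only [koszulExp, ← Finset.sum_add_distrib]
  refine sum_sum_eq_zero_of_symm (fun q r => ?_) (fun q => by simp)
  have h2 : (1 : ZMod 2) + 1 = 0 := by decide
  rcases eq_or_ne q r with rfl | hqr
  · rfl
  have hτ : τ q ≠ τ r := τ.injective.ne hqr
  have hσ : σ (τ q) ≠ σ (τ r) := σ.injective.ne hτ
  simp only [Equiv.Perm.mul_apply, Function.comp]
  rw [mul_comm (p (σ (τ r)))]
  generalize p (σ (τ q)) * p (σ (τ r)) = x
  have hx : x + x = 0 := CharTwo.add_self_eq_zero x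
  rcases lt_or_gt_of_ne hqr with a1 | a1 <;> rcases lt_or_gt_of_ne hτ with a2 | a2 <;>
    rcases lt_or_gt_of_ne hσ with a3 | a3 <;>
    simp [a1, a2, a3, a1.not_gt, a2.not_gt, a3.not_gt, hx]

/-- The exponent changes by `x` times the parities of the entries inverted with the entry `σ i`.
These entries precede it in exactly one of the two orders, so modulo `2` their total parity is the
sum of the two prefix parities. -/
theorem koszulExp_update {n : ℕ} (σ : Equiv.Perm (Fin n)) (p : Fin n → ZMod 2) (i : Fin n)
    (x : ZMod 2) : koszulExp σ (Function.update p (σ i) (p (σ i) + x)) =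
      koszulExp σ p + x * (preExp (σ i) p + preExp i (p ∘ σ)) := by
  have hu : ∀ q, Function.update p (σ i) (p (σ i) + x) (σ q) =
      p (σ q) + if q = i then x else 0 := by
    intro q
    by_cases h : q = i
    · subst h; simp
    · rw [Function.update_of_ne (σ.injective.ne h), if_neg h, add_zero]
  have h1 : preExp (σ i) p = ∑ q, if σ q < σ i then p (σ q) else 0 :=
    (Equiv.sum_comp σ (fun r => if r < σ i then p r else 0)).symm
  -- Expansion of the product of the two changed entries. No `x * x` term appears, because an
  -- inverted pair has `q ≠ r`.
  have h2 : ∀ q r, (if q < r ∧ σ r < σ q then Function.update p (σ i) (p (σ i) + x) (σ q) *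
        Function.update p (σ i) (p (σ i) + x) (σ r) else 0) =
      (if q < r ∧ σ r < σ q then p (σ q) * p (σ r) else 0) +
      ((if q = i then (if q < r ∧ σ r < σ q then x * p (σ r) else 0) else 0) +
        (if r = i then (if q < r ∧ σ r < σ q then x * p (σ q) else 0) else 0)) := by
    intro q r
    rw [hu, hu]
    by_cases hqr : q < r ∧ σ r < σ q
    · simp only [if_pos hqr]
      have hne : ¬ (q = i ∧ r = i) := fun h => hqr.1.ne (h.1.trans h.2.symm)
      by_cases hq : q = i
      · have hr : r ≠ i := fun hr => hne ⟨hq, hr⟩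
        simp [hq, hr]; ring
      · by_cases hr : r = i
        · simp [hq, hr]; ring
        · simp [hq, hr]
    · simp [hqr]
  simp only [koszulExp, h2, Finset.sum_add_distrib]
  congr 1
  rw [Finset.sum_comm (f := fun q r => if q = i then _ else _)]
  simp only [Finset.sum_ite_eq', Finset.mem_univ, if_true]
  rw [h1, preExp, ← Finset.sum_add_distrib, ← Finset.sum_add_distrib, Finset.mul_sum]
  refine Finset.sum_congr rfl fun q _ => ?_
  have hx : ∀ y : ZMod 2, y + y = 0 := CharTwo.add_self_eq_zero
  rcases eq_or_ne q i with rfl | hq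
  · simp
  have hσ : σ q ≠ σ i := σ.injective.ne hq
  rcases lt_or_gt_of_ne hq with a1 | a1 <;> rcases lt_or_gt_of_ne hσ with a2 | a2 <;>
    simp [a1, a2, a1.not_gt, a2.not_gt, hx]

/-- The parities of the arguments of `f` in `f ∘ᵢ g`, where `g` has parity `t`. -/
def blockExp {a b c : ℕ} (h : a + b = c + 1) (i : Fin a) (t : ZMod 2) (p : Fin c → ZMod 2) :
    Fin a → ZMod 2 := fun q =>
  if hq : q ≠ i then p (outerSlot h i ⟨q, hq⟩) else ∑ r, p (innerSlot h i r) + t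

theorem blockExp_self {a b c : ℕ} (h : a + b = c + 1) (i : Fin a) (t : ZMod 2)
    (p : Fin c → ZMod 2) : blockExp h i t p i = ∑ r, p (innerSlot h i r) + t := by
  simp [blockExp]

theorem blockExp_of_ne {a b c : ℕ} (h : a + b = c + 1) (i : Fin a) (t : ZMod 2)
    (p : Fin c → ZMod 2) (q : {q : Fin a // q ≠ i}) :
    blockExp h i t p q.1 = p (outerSlot h i q) := by
  simp [blockExp, q.2]

theorem blockExp_eq_update {a b c : ℕ} (h : a + b = c + 1) (i : Fin a) (t : ZMod 2)
    (p : Fin c → ZMod 2) : blockExp h i t p =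
      Function.update (blockExp h i 0 p) i (blockExp h i 0 p i + t) := by
  funext q
  by_cases hq : q = i
  · subst hq
    rw [Function.update_self, blockExp_self, blockExp_self, add_zero]
  · rw [Function.update_of_ne hq]
    simp [blockExp, hq]

theorem IsBlockPerm.innerSlot {a b c : ℕ} {i : Fin a} {σ : Equiv.Perm (Fin a)}
    {τ : Equiv.Perm (Fin b)} {ρ : Equiv.Perm (Fin c)} (hρ : IsBlockPerm i σ τ ρ)
    (h : a + b = c + 1) (r : Fin b) :
    ρ (innerSlot h i r) = MCOp.innerSlot h (σ i) (τ r) := Fin.ext (hρ.1 r _ rfl)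

theorem IsBlockPerm.outerSlot {a b c : ℕ} {i : Fin a} {σ : Equiv.Perm (Fin a)}
    {τ : Equiv.Perm (Fin b)} {ρ : Equiv.Perm (Fin c)} (hρ : IsBlockPerm i σ τ ρ)
    (h : a + b = c + 1) (q : {q : Fin a // q ≠ i}) :
    ρ (outerSlot h i q) = MCOp.outerSlot h (σ i) ⟨σ q.1, σ.injective.ne q.2⟩ :=
  Fin.ext (hρ.2 q.1 _ q.2 rfl)

/-- Split the inversions of `ρ` by type. Inner pairs give the exponent of `τ`. Mixed pairs and outer
pairs give the exponent of `σ`, with the block counted as one entry whose parity is the sum of its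
entries. -/
theorem koszulExp_block {a b c : ℕ} {i : Fin a} {σ : Equiv.Perm (Fin a)}
    {τ : Equiv.Perm (Fin b)} {ρ : Equiv.Perm (Fin c)} (hρ : IsBlockPerm i σ τ ρ)
    (h : a + b = c + 1) (p : Fin c → ZMod 2) :
    koszulExp ρ p = koszulExp σ (blockExp h (σ i) 0 p) +
      koszulExp τ (fun r => p (innerSlot h (σ i) r)) := by
  have hB : ∀ q : {q : Fin a // q ≠ i}, blockExp h (σ i) 0 p (σ q.1) =
      p (outerSlot h (σ i) ⟨σ q.1, σ.injective.ne q.2⟩) := fun q =>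
    blockExp_of_ne h (σ i) 0 p ⟨σ q.1, σ.injective.ne q.2⟩
  have hBi : blockExp h (σ i) 0 p (σ i) = ∑ r, p (innerSlot h (σ i) (τ r)) := by
    rw [blockExp_self, add_zero, Equiv.sum_comp τ (fun r => p (innerSlot h (σ i) r))]
  have hite : ∀ (P : Prop) [Decidable P] (F : Fin b → ZMod 2),
      (if P then ∑ r, F r else 0) = ∑ r, if P then F r else 0 := by
    intro P _ F
    split_ifs <;> simp
  simp only [koszulExp, sum_slots h i, Fintype.sum_eq_add_sum_subtype_ne _ i, hρ.innerSlot h,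
    hρ.outerSlot h, outerSlot_lt_outerSlot, outerSlot_lt_innerSlot, innerSlot_lt_outerSlot,
    innerSlot_lt_innerSlot, hB, hBi, Finset.sum_add_distrib, Finset.mul_sum, Finset.sum_mul,
    lt_irrefl, false_and, if_false, Finset.sum_const_zero, zero_add, hite]
  rw [Finset.sum_comm (s := (Finset.univ : Finset (Fin b)))
    (t := (Finset.univ : Finset {q : Fin a // q ≠ i}))]
  abel

end Exponents

/-! ### Signed permutations and equivariance in the endomorphism operad. -/

section End

variable {k : Type u} [Field k] {W : Type v} [AddCommGroup W] [Module k W] {D : DGStructure k W}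

/-- The vectors `v q` are homogeneous of parities `p q`. -/
def IsHomog (D : DGStructure k W) {ι : Type*} (p : ι → ZMod 2) (v : ι → W) : Prop :=
  ∀ q, D.par (v q) = sg k (p q) • v q

theorem IsHomog.comp {ι κ : Type*} {p : ι → ZMod 2} {v : ι → W} (hv : IsHomog D p v) (φ : κ → ι) :
    IsHomog D (p ∘ φ) (v ∘ φ) := fun q => hv (φ q)

theorem apply_diffArgs_of_isHomog {n : ℕ} (f : MultilinearMap k (fun _ : Fin n => W) W)
    {p : Fin n → ZMod 2} {v : Fin n → W} (hv : IsHomog D p v) (q : Fin n) :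
    f (diffArgs D q v) = sg k (preExp q p) • f (Function.update v q (D.d (v q))) := by
  rw [preExp, sg_sum, ← MultilinearMap.map_smul_univ]
  congr 1
  funext r
  rcases lt_trichotomy r q with hr | rfl | hr
  · rw [diffArgs_of_lt _ hr, if_pos hr, Function.update_of_ne hr.ne, hv]
  · rw [diffArgs_self, if_neg (lt_irrefl _), Function.update_self, sg_zero, one_smul]
  · rw [diffArgs_of_gt _ hr, if_neg hr.not_gt, Function.update_of_ne hr.ne', sg_zero, one_smul]

/-- On homogeneous arguments `parPow` is a scalar, which multilinearity pulls out. The prefix stops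
before the slot `i`, so the parity assigned to the block does not matter, and `0` is taken for that
of `g`. -/
theorem insertAt_of_isHomog {a b c : ℕ} (h : a + b = c + 1) (i : Fin a)
    (f : MultilinearMap k (fun _ : Fin a => W) W) (g : MultilinearMap k (fun _ : Fin b => W) W)
    (t : ZMod 2) {p : Fin c → ZMod 2} {v : Fin c → W} (hv : IsHomog D p v) :
    insertAt h i (parPow D.par t) f g v =
      sg k (t * preExp i (blockExp h i 0 p)) • f (compArgs h i LinearMap.id g v) := by
  rw [insertAt_apply, preExp, Finset.mul_sum, sg_sum, ← MultilinearMap.map_smul_univ]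
  congr 1
  funext q
  by_cases hq : q = i
  · subst hq
    rw [compArgs_inner, compArgs_inner, if_neg (lt_irrefl _), mul_zero, sg_zero, one_smul]
  · have h1 := compArgs_of_ne h i (parPow D.par t) g v ⟨q, hq⟩
    have h2 := compArgs_of_ne h i LinearMap.id g v ⟨q, hq⟩
    have h3 := blockExp_of_ne h i 0 p ⟨q, hq⟩
    simp only at h1 h2 h3
    rw [h1, h2, h3]
    split_ifs
    · rw [parPow_of_eq t (hv _)]; rfl
    · rw [mul_zero, sg_zero, one_smul]

theorem par_apply_of_isHomog {n : ℕ} {g : MultilinearMap k (fun _ : Fin n => W) W} {t : ZMod 2}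
    (hg : endPar D g = sg k t • g) {p : Fin n → ZMod 2} {v : Fin n → W} (hv : IsHomog D p v) :
    D.par (g v) = sg k (∑ q, p q + t) • g v := by
  have h1 := apply_par_of_eq hg v
  have h2 : (fun r => D.par (v r)) = fun r => sg k (p r) • v r := funext hv
  rw [h2, MultilinearMap.map_smul_univ, ← sg_sum] at h1
  rw [sg_add, mul_comm, ← smul_smul, h1, smul_smul, sg_mul_self, one_smul]

variable [CharZero k]

/-- Splitting every argument into its even and odd parts expands both maps over all parity patterns.
-/
theorem multilinear_ext_homog (D : DGStructure k W) {n : ℕ}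
    {f g : MultilinearMap k (fun _ : Fin n => W) W}
    (h : ∀ (p : Fin n → ZMod 2) (v : Fin n → W), IsHomog D p v → f v = g v) : f = g := by
  ext v
  have hv : v = fun q => ∑ p : ZMod 2, hproj D.par p (v q) := funext fun q => (sum_hproj _ _).symm
  rw [hv, MultilinearMap.map_sum, MultilinearMap.map_sum]
  exact Finset.sum_congr rfl fun p _ => h p _ fun q => par_hproj D.par_par _ _

/-- For every other pattern of parities some argument is projected to zero, leaving the usual
formula with one Koszul sign. -/
theorem endPerm_apply {n : ℕ} (σ : Equiv.Perm (Fin n))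
    (f : MultilinearMap k (fun _ : Fin n => W) W) {p : Fin n → ZMod 2} {v : Fin n → W}
    (hv : IsHomog D p v) : endPerm D σ f v = sg k (koszulExp σ p) • f (v ∘ σ) := by
  change (∑ p : Fin n → ZMod 2, koszulSign k σ p •
    (f.domDomCongr σ).compLinearMap fun q => hproj D.par (p q)) v = _
  rw [sum_apply, Finset.sum_eq_single p]
  · rw [smul_apply, koszulSign_eq, MultilinearMap.compLinearMap_apply,
      MultilinearMap.domDomCongr_apply]
    congr 2
    funext q
    exact hproj_of_eq (hv (σ q))
  · intro p' _ hp
    obtain ⟨q, hq⟩ := Function.ne_iff.1 hp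
    rw [smul_apply, MultilinearMap.compLinearMap_apply,
      (f.domDomCongr σ).map_coord_zero q (hproj_of_ne hq (hv q)), smul_zero]
  · simp

theorem endPar_endPerm {n : ℕ} (σ : Equiv.Perm (Fin n))
    (f : MultilinearMap k (fun _ : Fin n => W) W) :
    endPar D (endPerm D σ f) = endPerm D σ (endPar D f) := by
  refine multilinear_ext_homog D fun p v hv => ?_
  have hv' : IsHomog D p fun q => D.par (v q) := fun q => by
    simp only [hv q, map_smul]
  rw [endPar_apply, endPerm_apply σ f hv', endPerm_apply σ _ hv, map_smul]
  rfl

theorem endPerm_one {n : ℕ} (f : MultilinearMap k (fun _ : Fin n => W) W) :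
    endPerm D 1 f = f := by
  refine multilinear_ext_homog D fun p v hv => ?_
  rw [endPerm_apply 1 f hv, koszulExp_one, sg_zero, one_smul]
  rfl

theorem endPerm_endPerm {n : ℕ} (σ τ : Equiv.Perm (Fin n))
    (f : MultilinearMap k (fun _ : Fin n => W) W) :
    endPerm D σ (endPerm D τ f) = endPerm D (σ * τ) f := by
  refine multilinear_ext_homog D fun p v hv => ?_
  rw [endPerm_apply σ _ hv, endPerm_apply τ f (hv.comp σ), endPerm_apply (σ * τ) f hv,
    koszulExp_mul, sg_add, smul_smul]
  rfl

/-- Matching terms have `d` at the argument `σ q` and at the argument `q` of the permuted list.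
Since `d` shifts the parity of that one entry by `1`, `koszulExp_update` with `x = 1` supplies the
difference between the two prefix signs. -/
theorem endDiff_endPerm {n : ℕ} (σ : Equiv.Perm (Fin n))
    (f : MultilinearMap k (fun _ : Fin n => W) W) :
    endDiff D (endPerm D σ f) = endPerm D σ (endDiff D f) := by
  refine multilinear_ext_homog D fun p v hv => ?_
  rw [endDiff_apply, endPar_endPerm, endPerm_apply σ f hv, endPerm_apply σ _ hv, endDiff_apply,
    smul_sub, map_smul, Finset.smul_sum]
  congr 1
  rw [← Equiv.sum_comp σ]
  refine Finset.sum_congr rfl fun q _ => ?_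
  have hv' : IsHomog D (Function.update p (σ q) (p (σ q) + 1))
      (Function.update v (σ q) (D.d (v (σ q)))) := by
    intro r
    by_cases hr : r = σ q
    · subst hr
      rw [Function.update_self, Function.update_self, odd_of_eq D.d_par (hv _)]
    · rw [Function.update_of_ne hr, Function.update_of_ne hr, hv]
  have hu : Function.update v (σ q) (D.d (v (σ q))) ∘ σ =
      Function.update (v ∘ σ) q (D.d (v (σ q))) := by
    funext r
    by_cases hr : r = q
    · subst hr; simp
    · rw [Function.comp_apply, Function.update_of_ne (σ.injective.ne hr), Function.update_of_ne hr,
        Function.comp_apply]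
  rw [apply_diffArgs_of_isHomog _ hv, apply_diffArgs_of_isHomog _ (hv.comp σ), endPerm_apply σ _ hv', hu,
    koszulExp_update, smul_smul, smul_smul, one_mul, sg_add, sg_add]
  congr 1
  linear_combination (sg k (koszulExp σ p) * sg k (preExp q (p ∘ σ))) *
    sg_mul_self k (preExp (σ q) p)

/-- Both sides evaluate `f` on the same vectors up to sign. The Koszul exponent of `ρ` splits by
`koszulExp_block`. The parity `t` of `g` shifts that of the block, and by `koszulExp_update` this
exchanges the prefix sign at `σ i` for the one at `i`. -/
theorem endComp_equivariant {a b c : ℕ} (h : a + b = c + 1) (i : Fin a)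
    (σ : Equiv.Perm (Fin a)) (τ : Equiv.Perm (Fin b)) (ρ : Equiv.Perm (Fin c))
    (hρ : IsBlockPerm i σ τ ρ) (f : MultilinearMap k (fun _ : Fin a => W) W)
    (g : MultilinearMap k (fun _ : Fin b => W) W) :
    endComp D h (σ i) (endPerm D σ f) (endPerm D τ g) = endPerm D ρ (endComp D h i f g) := by
  induction g using end_homogeneous_induction D with
  | add x y hx hy => simp only [map_add, hx, hy]
  | homog t g hg =>
  have hg' : endPar D (endPerm D τ g) = sg k t • endPerm D τ g := by
    rw [endPar_endPerm, hg, map_smul]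
  rw [endComp_of_eq h i f hg, endComp_of_eq h (σ i) _ hg']
  refine multilinear_ext_homog D fun p v hv => ?_
  have hargs : IsHomog D (blockExp h (σ i) t p)
      (compArgs h (σ i) LinearMap.id (endPerm D τ g) v) := by
    intro q
    by_cases hq : q = σ i
    · subst hq
      rw [compArgs_inner, blockExp_self]
      exact par_apply_of_isHomog hg' (hv.comp _)
    · have h1 := compArgs_of_ne h (σ i) LinearMap.id (endPerm D τ g) v ⟨q, hq⟩
      have h2 := blockExp_of_ne h (σ i) t p ⟨q, hq⟩
      simp only at h1 h2
      rw [h1, h2, ite_self]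
      exact hv _
  have hB : blockExp h (σ i) 0 p ∘ σ = blockExp h i 0 (p ∘ ρ) := by
    funext q
    by_cases hq : q = i
    · subst hq
      simp only [Function.comp_apply, blockExp_self, hρ.innerSlot h]
      rw [Equiv.sum_comp τ fun r => p (innerSlot h (σ q) r)]
    · have h1 := blockExp_of_ne h i 0 (p ∘ ρ) ⟨q, hq⟩
      have h2 := blockExp_of_ne h (σ i) 0 p ⟨σ q, σ.injective.ne hq⟩
      simp only [Function.comp_apply] at h1 h2 ⊢
      rw [h1, h2, hρ.outerSlot h]
  -- After reordering by `σ`, only the slot `i` is affected: it carries the Koszul sign of `τ` on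
  -- the inputs of `g`.
  have hA : compArgs h (σ i) LinearMap.id (endPerm D τ g) v ∘ σ =
      Function.update (compArgs h i LinearMap.id g (v ∘ ρ)) i
        (sg k (koszulExp τ fun r => p (innerSlot h (σ i) r)) •
          compArgs h i LinearMap.id g (v ∘ ρ) i) := by
    funext q
    by_cases hq : q = i
    · subst hq
      rw [Function.update_self, Function.comp_apply, compArgs_inner, compArgs_inner]
      refine (endPerm_apply τ g (hv.comp _)).trans ?_
      congr 2
      funext r
      exact congrArg v (hρ.innerSlot h r).symm
    · have h1 := compArgs_of_ne h (σ i) LinearMap.id (endPerm D τ g) v ⟨σ q, σ.injective.ne hq⟩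
      have h2 := compArgs_of_ne h i LinearMap.id g (v ∘ ρ) ⟨q, hq⟩
      simp only [ite_self] at h1 h2
      rw [Function.update_of_ne hq, Function.comp_apply, h1, h2, Function.comp_apply,
        hρ.outerSlot h]
  rw [insertAt_of_isHomog h (σ i) _ _ t hv, endPerm_apply σ f hargs, endPerm_apply ρ _ hv,
    insertAt_of_isHomog h i f g t (hv.comp ρ), hA, MultilinearMap.map_update_smul,
    Function.update_eq_self, blockExp_eq_update h (σ i) t, koszulExp_update,
    koszulExp_block hρ h p, hB]
  simp only [smul_smul, mul_add, sg_add]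
  congr 1
  linear_combination (sg k (koszulExp σ (blockExp h (σ i) 0 p)) *
    sg k (t * preExp i (blockExp h i 0 (p ∘ ρ))) *
      sg k (koszulExp τ fun r => p (innerSlot h (σ i) r))) *
    sg_mul_self k (t * preExp (σ i) (blockExp h (σ i) 0 p))

theorem isDGOperad_endOperad (D : DGStructure k W) (S : Bool) :
    IsDGOperad (endOperad D S) where
  par_par := endPar_endPar (D := D)
  d_par := endDiff_endPar (D := D)
  par_comp := endPar_endComp (D := D)
  par_perm _ _ σ f := endPar_endPerm σ f
  comp_seq := endComp_seq (D := D)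
  comp_par := endComp_par (D := D)
  leibniz := endDiff_endComp (D := D)
  comp_equivariant _ := endComp_equivariant (D := D)
  perm_mul _ _ σ τ f := endPerm_endPerm σ τ f
  perm_one _ _ f := endPerm_one f
  d_perm _ _ σ f := endDiff_endPerm σ f

end End

end MCOp

namespace MCOp

/-! ### Inverse limits of discrete operads -/

section Limit

open Topology

variable {k : Type u} [Field k] {S : Bool}

theorem OperadHom.ext {P : OperadData.{u, v} k S} {Q : OperadData.{u, w} k S} {f g : OperadHom P Q}
    (h : ∀ n x, f.app n x = g.app n x) : f = g := by
  have : f.app = g.app := funext fun n => LinearMap.ext (h n)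
  cases f
  cases g
  congr

variable {I : Type w} [Preorder I] {Φ : OperadSystem.{u, v, w} k S I}

/-- The projection from the inverse limit of a system of operads. -/
def OperadSystem.proj (Φ : OperadSystem.{u, v, w} k S I) (i : I) : OperadHom Φ.lim (Φ.obj i) where
  app n := (LinearMap.proj i).comp (Φ.limSpace n).subtype
  map_par _ := rfl
  map_d _ := rfl
  map_comp _ _ _ _ := rfl
  map_perm _ _ _ _ := rfl
  cont _ := continuous_iff_le_induced.2 (iInf_le _ i)

theorem OperadSystem.lim_ext {n : ℕ} {x y : Φ.lim.Ob n}
    (h : ∀ i, (Φ.proj i).app n x = (Φ.proj i).app n y) : x = y :=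
  Subtype.ext (funext h)

theorem OperadSystem.map_proj {n : ℕ} {i j : I} (h : i ≤ j) (x : Φ.lim.Ob n) :
    (Φ.map h).app n ((Φ.proj j).app n x) = (Φ.proj i).app n x := x.2 i j h

theorem OperadSystem.nhds_lim {n : ℕ} (x : Φ.lim.Ob n) :
    𝓝 x = ⨅ i, (𝓝 ((Φ.proj i).app n x)).comap ((Φ.proj i).app n) := by
  refine (nhds_iInf (t := fun i => TopologicalSpace.induced
    (fun f : Φ.limSpace n => f.1 i) ((Φ.obj i).top n))).trans ?_
  exact iInf_congr fun i => @nhds_induced _ _ ((Φ.obj i).top n) _ _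

/-- In the inverse limit topology convergence is tested componentwise, and the projections are
additive. With discrete components, the series of the theorem become finite sums in each of them. -/
theorem OperadSystem.hasSum_lim_iff {n : ℕ} {ι : Type*} {F : ι → Φ.lim.Ob n} {s : Φ.lim.Ob n} :
    HasSum F s ↔ ∀ i, HasSum (fun j => (Φ.proj i).app n (F j)) ((Φ.proj i).app n s) := by
  simp only [HasSum, OperadSystem.nhds_lim, Filter.tendsto_iInf, Filter.tendsto_comap_iff]
  refine forall_congr' fun i => ?_
  simp only [Function.comp_def, map_sum]

/-- All operads of the system carry the discrete topology. -/
def OperadSystem.IsDiscrete (Φ : OperadSystem.{u, v, w} k S I) : Prop :=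
  ∀ (i : I) (n : ℕ), DiscreteTopology ((Φ.obj i).Ob n)

/-- `OperadData` has no axiom making negation continuous; it is continuous here because the
components are discrete. Needed for the sign between `μ_n` and `φ(m_n)`. -/
theorem OperadSystem.IsDiscrete.hasSum_neg (hΦ : Φ.IsDiscrete) {n : ℕ} {ι : Type*}
    {F : ι → Φ.lim.Ob n} {s : Φ.lim.Ob n} (h : HasSum F s) : HasSum (fun j => -F j) (-s) := by
  rw [OperadSystem.hasSum_lim_iff] at h ⊢
  intro i
  have := hΦ i n
  simpa only [map_neg, Function.comp_def, negAddMonoidHom_apply, AddMonoidHom.coe_mk,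
    coe_negAddMonoidHom] using (h i).map (negAddMonoidHom (α := (Φ.obj i).Ob n))
      continuous_of_discreteTopology

end Limit

/-! ### The operads `O[[x]]` -/

section Completed

open Topology

variable {k : Type u} [Field k] {S : Bool}

theorem truncSystem_isDiscrete (k : Type u) [Field k] (S : Bool) : (truncSystem k S).IsDiscrete :=
  fun _ _ => ⟨rfl⟩

theorem evalMono_freeOperad {X : Bool} (N : ℕ∞) (hX : X = true) {n : ℕ} (f : Mono S X n) :
    evalMono (freeOperad k S X N) (fun n => (FreeOp.mk N (.m n) : FreeOp k S X N (n + 1)))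
      (FreeOp.mk N (.x hX) : FreeOp k S X N 0) f = (FreeOp.mk N f : FreeOp k S X N n) := by
  induction f with
  | m n => rfl
  | x h => rfl
  | comp h i f g hf hg =>
    exact (congrArg₂ (fun x y => (freeOperad k S X N).comp h i x y) hf hg).trans
      (FreeOp.comp_mk h i f g)
  | perm hS σ f hf =>
    exact (congrArg (fun x => (freeOperad k S X N).perm hS σ x) hf).trans (FreeOp.perm_mk hS σ f)

/-- The projection `O[[x]] → O[x]/(x)^N`. -/
noncomputable def projX (k : Type u) [Field k] (S : Bool) (N : ℕ) :
    OperadHom (infOperadX k S) (freeOperad k S true (N : ℕ∞)) := (truncSystem k S).proj N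

theorem projX_ext {n : ℕ} {x y : (infOperadX k S).Ob n}
    (h : ∀ N, (projX k S N).app n x = (projX k S N).app n y) : x = y :=
  OperadSystem.lim_ext (Φ := truncSystem k S) h

theorem inclMap_projX {n N N' : ℕ} (h : N ≤ N') (x : (infOperadX k S).Ob n) :
    FreeOp.inclMap id (by exact_mod_cast h) n ((projX k S N').app n x) =
      (projX k S N).app n x := x.2 N N' h

/-- A monomial as an element of `O[[x]]`. -/
noncomputable def monoX (k : Type u) [Field k] {S : Bool} {n : ℕ} (f : Mono S true n) :
    (infOperadX k S).Ob n :=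
  evalMono (infOperadX k S) (fun n => (inclX k S).app (n + 1) (genM k S n)) (genX k S) f

theorem projX_monoX (N : ℕ) {n : ℕ} (f : Mono S true n) :
    (projX k S N).app n (monoX k f) = (FreeOp.mk (N : ℕ∞) f : FreeOp k S true N n) := by
  refine ((projX k S N).map_evalMono _ _ f).trans ?_
  have h : (fun n => (projX k S N).app (n + 1) ((inclX k S).app (n + 1) (genM k S n))) =
      fun n => (FreeOp.mk (N : ℕ∞) (.m n) : FreeOp k S true N (n + 1)) :=
    funext fun n => FreeOp.inclMap_mk (fun _ => rfl) le_top _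
  rw [h]
  exact evalMono_freeOperad (N : ℕ∞) rfl f

theorem fill_genM_genX (n : ℕ) :
    (infOperadX k S).fill (n + 1) ((inclX k S).app (n + 1) (genM k S n)) (genX k S) =
      monoX k (Mono.fill (n + 1) (.m n) (.x rfl)) :=
  (evalMono_fill (P := infOperadX k S) (fun n => (inclX k S).app (n + 1) (genM k S n))
    (genX k S) (n + 1) (.m n) (.x rfl)).symm

theorem par_genX : (infOperadX k S).par 0 (genX k S) = genX k S := by
  refine projX_ext fun N => ?_
  refine (FreeOp.par_mk (Mono.x rfl)).trans ?_
  rw [Mono.deg, sg_zero, one_smul]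
  rfl

/-- Modulo `(x)^N` the term of index `n` contains `x` exactly `n + 1` times and vanishes for `n ≥
N`. The remaining finite sum is the definition of `d x` in the truncation. -/
theorem hasSum_d_genX : HasSum (fun n => FreeOp.coeff k S (n + 1) •
    (infOperadX k S).fill (n + 1) ((inclX k S).app (n + 1) (genM k S n)) (genX k S))
      ((infOperadX k S).d 0 (genX k S)) := by
  refine (OperadSystem.hasSum_lim_iff (Φ := truncSystem k S)).2 fun N => ?_
  have hd : (projX k S N).app 0 ((infOperadX k S).d 0 (genX k S)) =
      ∑ n ∈ Finset.range N, (projX k S N).app 0 (FreeOp.coeff k S (n + 1) •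
        monoX k (Mono.fill (n + 1) (.m n) (.x rfl))) := by
    simp only [map_smul, projX_monoX]
    exact FreeOp.diff_mk (Mono.x rfl)
  simp only [fill_genM_genX]
  change HasSum (fun n => (projX k S N).app 0 (FreeOp.coeff k S (n + 1) •
    monoX k (Mono.fill (n + 1) (.m n) (.x rfl)))) ((projX k S N).app 0 _)
  rw [hd]
  refine hasSum_sum_of_ne_finset_zero fun n hn => ?_
  rw [map_smul, projX_monoX]
  change FreeOp.coeff k S (n + 1) •
    (FreeOp.mk (N : ℕ∞) (Mono.fill (n + 1) (.m n) (.x rfl)) : FreeOp k S true N 0) = 0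
  rw [FreeOp.mk_wt, smul_zero]
  rw [FreeOp.wt_fill]
  simp only [Finset.mem_range, not_lt, Mono.wt] at hn ⊢
  norm_cast
  omega

/-- Density of the span of the monomials: it maps onto every truncation. -/
theorem exists_monoX_span (N : ℕ) {n : ℕ} (u : FreeOp k S true N n) :
    ∃ z ∈ Submodule.span k (Set.range (monoX k (S := S) (n := n))),
      (projX k S N).app n z = u := by
  induction u using FreeOp.induction with
  | zero => exact ⟨0, Submodule.zero_mem _, map_zero _⟩
  | add u u' hu hu' =>
    obtain ⟨z, hz, rfl⟩ := hu
    obtain ⟨z', hz', rfl⟩ := hu'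
    exact ⟨z + z', Submodule.add_mem _ hz hz', map_add _ _ _⟩
  | smul t u hu =>
    obtain ⟨z, hz, rfl⟩ := hu
    exact ⟨t • z, Submodule.smul_mem _ _ hz, map_smul _ _ _⟩
  | mk f => exact ⟨monoX k f, Submodule.subset_span ⟨f, rfl⟩, projX_monoX N f⟩

/-- The kernels of the projections form a decreasing family, because a higher truncation determines
the lower ones. Hence they are a basis of neighbourhoods of zero, with no need for finite
intersections. -/
theorem exists_projX_ker_subset {n : ℕ} {U : Set ((infOperadX k S).Ob n)} (hU : U ∈ 𝓝 0) :
    ∃ N : ℕ, ∀ z, (projX k S N).app n z = 0 → z ∈ U := by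
  have hn : 𝓝 (0 : (infOperadX k S).Ob n) =
      ⨅ N, Filter.principal {z | (projX k S N).app n z = 0} := by
    refine (OperadSystem.nhds_lim (Φ := truncSystem k S) (n := n) 0).trans (iInf_congr fun N => ?_)
    have := truncSystem_isDiscrete k S N n
    rw [map_zero, nhds_discrete, Filter.comap_pure]
    rfl
  rw [hn, Filter.mem_iInf_of_directed] at hU
  · exact hU
  · refine directed_of_isDirected_le fun N N' h => ?_
    refine Filter.principal_mono.2 fun z (hz : _ = _) => ?_
    change _ = _
    rw [← inclMap_projX h, hz]
    exact map_zero _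

variable {I : Type w} [Preorder I] {Φ : OperadSystem.{u, v, w} k S I}

/-- Continuity into a discrete component means that the map kills some power of `(x)`. -/
theorem exists_proj_factor (hΦ : Φ.IsDiscrete) (f : OperadHom (infOperadX k S) Φ.lim) (i : I)
    (n : ℕ) : ∃ N : ℕ, ∀ z : (infOperadX k S).Ob n, (projX k S N).app n z = 0 →
      (Φ.proj i).app n (f.app n z) = 0 := by
  have := hΦ i n
  have hc : Continuous ((Φ.proj i).app n ∘ f.app n) := ((Φ.proj i).cont n).comp (f.cont n)
  exact exists_projX_ker_subset
    (((isOpen_discrete ({0} : Set ((Φ.obj i).Ob n))).preimage hc).mem_nhds (by simp))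

/-- A map out of `O[[x]]` is determined by its values on `O` and on `x`. -/
theorem OperadHom.ext_infOperadX (hΦ : Φ.IsDiscrete) {f g : OperadHom (infOperadX k S) Φ.lim}
    (h : f.comp (inclX k S) = g.comp (inclX k S))
    (hx : f.app 0 (genX k S) = g.app 0 (genX k S)) : f = g := by
  have hmono : ∀ {n : ℕ} (F : Mono S true n), f.app n (monoX k F) = g.app n (monoX k F) := by
    intro n F
    have hm : ∀ n, f.app (n + 1) ((inclX k S).app (n + 1) (genM k S n)) =
        g.app (n + 1) ((inclX k S).app (n + 1) (genM k S n)) := fun n =>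
      congrArg (fun φ : OperadHom (infOperad k S) Φ.lim => φ.app (n + 1) (genM k S n)) h
    rw [monoX, f.map_evalMono, g.map_evalMono, hx, funext hm]
  refine OperadHom.ext fun n z => OperadSystem.lim_ext fun i => ?_
  obtain ⟨N, hN⟩ := exists_proj_factor hΦ f i n
  obtain ⟨N', hN'⟩ := exists_proj_factor hΦ g i n
  -- Here `y` is a combination of monomials agreeing with `z` to an order beyond which neither `f`
  -- nor `g` is visible in the component `i`. There `f z = f y = g y = g z`.
  obtain ⟨y, hy, hyz⟩ := exists_monoX_span (max N N')
    ((projX k S (max N N')).app n z)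
  have h0 : ∀ M ≤ max N N', (projX k S M).app n (z - y) = 0 := fun M hM => by
    rw [← inclMap_projX hM, map_sub, hyz, sub_self]
    exact map_zero _
  have e1 := hN _ (h0 N (le_max_left _ _))
  have e2 := hN' _ (h0 N' (le_max_right _ _))
  rw [map_sub, map_sub, sub_eq_zero] at e1 e2
  have e3 : f.app n y = g.app n y := by
    have : Submodule.span k (Set.range (monoX k (S := S) (n := n))) ≤
        LinearMap.eqLocus (f.app n) (g.app n) := by
      rw [Submodule.span_le]
      rintro _ ⟨F, rfl⟩
      exact hmono F
    exact this hy
  rw [e1, e2, e3]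

end Completed

/-! ### Extension of a map to `O[[x]]` -/

section Extension

variable {k : Type u} [Field k] {S : Bool} {I : Type w} [Preorder I]
  {Φ : OperadSystem.{u, v, w} k S I}

/-- In each operad of the system, the monomials with many occurrences of `x` vanish. -/
def OperadSystem.IsNilpotent (Φ : OperadSystem.{u, v, w} k S I) : Prop :=
  ∀ i, ∃ N : ℕ, ∀ (μ : ∀ n, (Φ.obj i).Ob (n + 1)) (ξ : (Φ.obj i).Ob 0) {n : ℕ}
    (f : Mono S true n), N ≤ f.wt → evalMono (Φ.obj i) μ ξ f = 0

/-- The element `ξ` is arbitrary, since no monomial of `O` contains `x`. -/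
theorem OperadHom.app_mk_infOperad {P : OperadData.{u, v} k S} (φ : OperadHom (infOperad k S) P)
    (ξ : P.Ob 0) {n : ℕ} (f : Mono S false n) :
    φ.app n (FreeOp.mk ⊤ f : FreeOp k S false ⊤ n) =
      evalMono P (fun n => φ.app (n + 1) (genM k S n)) ξ f := by
  induction f with
  | m n => rfl
  | x h => exact absurd h (by simp)
  | comp h i f g hf hg =>
    exact (congrArg (φ.app _) (FreeOp.comp_mk h i f g).symm).trans
      ((φ.map_comp h i _ _).trans (congrArg₂ (fun x y => P.comp h i x y) hf hg))
  | perm hS σ f hf =>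
    exact (congrArg (φ.app _) (FreeOp.perm_mk hS σ f).symm).trans
      ((φ.map_perm hS σ _).trans (congrArg (fun x => P.perm hS σ x) hf))

/-- The images of the `m_n` inherit oddness and symmetry from the generators through `φ`; only the
parity of `ξ` and the vanishing beyond `N` have to be supplied. -/
theorem OperadHom.isEvaluation {P : OperadData.{u, v} k S} (hP : IsDGOperad P)
    (φ : OperadHom (infOperad k S) P) {ξ : P.Ob 0} (hξ : P.par 0 ξ = ξ) (X : Bool) (N : ℕ∞)
    (hN : ∀ {n : ℕ} (f : Mono S X n), N ≤ (f.wt : ℕ∞) →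
      evalMono P (fun n => φ.app (n + 1) (genM k S n)) ξ f = 0) :
    IsEvaluation P X N (fun n => φ.app (n + 1) (genM k S n)) ξ where
  operad := hP
  odd n := by
    rw [← φ.map_par, ← map_neg]
    refine congrArg _ ((FreeOp.par_mk (Mono.m n)).trans ?_)
    rw [Mono.deg, sg_one, neg_one_smul]
    rfl
  even := hξ
  symm hS n σ := by
    rw [← φ.map_perm]
    refine congrArg _ ((FreeOp.perm_mk hS σ (Mono.m n)).trans ?_)
    rw [FreeOp.mk_rel (Rel.perm_m hS n σ), sg_zero, one_smul]
    rfl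
  vanish := hN

theorem IsEvaluation.eval_eq_app {P : OperadData.{u, v} k S} (φ : OperadHom (infOperad k S) P)
    {ξ : P.Ob 0} (hE : IsEvaluation P false ⊤ (fun n => φ.app (n + 1) (genM k S n)) ξ) {n : ℕ}
    (u : FreeOp k S false ⊤ n) : hE.eval n u = φ.app n u := by
  induction u using FreeOp.induction with
  | zero => exact (map_zero _).trans (map_zero (φ.app n)).symm
  | add u u' hu hu' => rw [map_add, hu, hu']; exact (map_add (φ.app n) u u').symm
  | smul t u hu => rw [map_smul, hu]; exact (map_smul (φ.app n) t u).symm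
  | mk f => rw [hE.eval_mk]; exact (φ.app_mk_infOperad ξ f).symm

/-- The expression for `d m_n` does not involve `x`, so it comes from `O`, where evaluation is `φ`
and `φ` commutes with `d`. -/
theorem IsEvaluation.eval_diffM {P : OperadData.{u, v} k S} (hP : IsDGOperad P)
    (φ : OperadHom (infOperad k S) P) {ξ : P.Ob 0} (hξ : P.par 0 ξ = ξ) {X : Bool} {N : ℕ∞}
    (hE : IsEvaluation P X N (fun n => φ.app (n + 1) (genM k S n)) ξ) (n : ℕ) :
    hE.eval (n + 1) (FreeOp.diffM k S X N n) = P.d (n + 1) (φ.app (n + 1) (genM k S n)) := by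
  have hE₀ := φ.isEvaluation hP hξ false ⊤ fun f hf => absurd hf (by simp)
  have h2 := FreeOp.inclMap_diff (X' := X) (N' := N) (by simp) le_top (by simp)
    (FreeOp.mk ⊤ (.m n) : FreeOp k S false ⊤ (n + 1))
  rw [FreeOp.inclMap_mk, FreeOp.diff_mk, Mono.incl, FreeOp.diff_mk] at h2
  change _ = FreeOp.diffM k S X N n at h2
  rw [← h2, hE₀.eval_inclMap hE, hE₀.eval_eq_app φ, ← φ.map_d]
  exact congrArg _ (FreeOp.diff_mk (Mono.m n)).symm

theorem OperadHom.exists_extension (hΦ : Φ.IsDiscrete) (hO : ∀ i, IsDGOperad (Φ.obj i))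
    (hN : Φ.IsNilpotent) (m : OperadHom (infOperad k S) Φ.lim)
    (ξ : Φ.lim.Ob 0) (hξ : Φ.lim.par 0 ξ = ξ)
    (hMC : HasSum (fun n => FreeOp.coeff k S (n + 1) •
      Φ.lim.fill (n + 1) (m.app (n + 1) (genM k S n)) ξ) (Φ.lim.d 0 ξ)) :
    ∃ f : OperadHom (infOperadX k S) Φ.lim, f.comp (inclX k S) = m ∧ f.app 0 (genX k S) = ξ := by
  -- `B i` is a power of `(x)` killed in the component `i`; evaluation there is defined on every
  -- truncation of level at least `B i`.
  choose B hB using hN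
  let φ : ∀ i, OperadHom (infOperad k S) (Φ.obj i) := fun i => (Φ.proj i).comp m
  have hξ' : ∀ i, (Φ.obj i).par 0 ((Φ.proj i).app 0 ξ) = (Φ.proj i).app 0 ξ := fun i => by
    rw [← (Φ.proj i).map_par, hξ]
  have hE : ∀ i (N : ℕ), B i ≤ N → IsEvaluation (Φ.obj i) true (N : ℕ∞)
      (fun n => (φ i).app (n + 1) (genM k S n)) ((Φ.proj i).app 0 ξ) := fun i N h =>
    (φ i).isEvaluation (hO i) (hξ' i) true N fun f hf =>
      hB i _ _ f (h.trans (by exact_mod_cast hf))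
  have stable : ∀ i (N : ℕ) (h : B i ≤ N) {n : ℕ} (u : (infOperadX k S).Ob n),
      (hE i N h).eval n (u.1 N) = (hE i (B i) le_rfl).eval n (u.1 (B i)) := fun i N h n u => by
    rw [← u.2 (B i) N h]
    exact ((hE i N h).eval_inclMap (hE i (B i) le_rfl) id (by exact_mod_cast h) (u.1 N)).symm
  have compat : ∀ {n : ℕ} (u : (infOperadX k S).Ob n) (i j : I) (h : i ≤ j),
      (Φ.map h).app n ((hE j (B j) le_rfl).eval n (u.1 (B j))) =
        (hE i (B i) le_rfl).eval n (u.1 (B i)) := by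
    intro n u i j h
    -- The bounds `B i` and `B j` need not be ordered in the same way as `i` and `j`, so both values
    -- are first computed at the common level `max (B i) (B j)`.
    rw [← stable j _ (le_max_right (B i) (B j)) u, ← stable i _ (le_max_left (B i) (B j)) u]
    generalize u.1 (max (B i) (B j)) = z
    change FreeOp k S true _ n at z
    induction z using FreeOp.induction with
    | zero => simp only [map_zero]
    | add u u' hu hu' => simp only [map_add, hu, hu']
    | smul t u hu => simp only [map_smul, hu]
    | mk f =>
      rw [IsEvaluation.eval_mk, IsEvaluation.eval_mk, (Φ.map h).map_evalMono]
      congr 1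
      · funext l
        exact Φ.map_proj h _
      · exact Φ.map_proj h _
  have hd : ∀ i {n : ℕ} (u : FreeOp k S true (B i) n),
      (hE i (B i) le_rfl).eval n (FreeOp.diff n u) =
        (Φ.obj i).d n ((hE i (B i) le_rfl).eval n u) := by
    intro i n u
    refine (hE i (B i) le_rfl).eval_diff ((hE i (B i) le_rfl).eval_diffM (hO i) (φ i) (hξ' i))
      (fun _ => ?_) u
    have hterm : ∀ n, (Φ.proj i).app 0 (FreeOp.coeff k S (n + 1) •
        Φ.lim.fill (n + 1) (m.app (n + 1) (genM k S n)) ξ) = FreeOp.coeff k S (n + 1) •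
          evalMono (Φ.obj i) (fun n => (φ i).app (n + 1) (genM k S n)) ((Φ.proj i).app 0 ξ)
            (Mono.fill (n + 1) (.m n) (.x rfl) : Mono S true 0) := fun n => by
      rw [map_smul, (Φ.proj i).map_fill, evalMono_fill]
      rfl
    have h1 := Φ.hasSum_lim_iff.1 hMC i
    simp only [hterm] at h1
    have := hΦ i 0
    -- The Maurer–Cartan series in the discrete component `i` has only its first `B i` terms
    -- possibly nonzero. By uniqueness of sums, `d ξ` there equals that finite sum, which is the
    -- value of `diffX`.
    rw [← (Φ.proj i).map_d, h1.unique (hasSum_sum_of_ne_finset_zero (s := Finset.range (B i)) ?_)]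
    · simp only [FreeOp.diffX, map_sum, map_smul, IsEvaluation.eval_mk, ENat.toNat_natCast]
    · intro n hn
      rw [hB i, smul_zero]
      rw [FreeOp.wt_fill]
      simp only [Finset.mem_range, not_lt, Mono.wt] at hn ⊢
      omega
  let app : ∀ n, (infOperadX k S).Ob n →ₗ[k] Φ.lim.Ob n := fun n =>
    { toFun := fun u => ⟨fun i => (hE i (B i) le_rfl).eval n (u.1 (B i)), compat u⟩
      map_add' := fun u u' => Subtype.ext (funext fun i =>
        ((hE i (B i) le_rfl).eval n).map_add (u.1 (B i)) (u'.1 (B i)))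
      map_smul' := fun c u => Subtype.ext (funext fun i =>
        ((hE i (B i) le_rfl).eval n).map_smul c (u.1 (B i))) }
  let f : OperadHom (infOperadX k S) Φ.lim :=
    { app := app
      map_par := fun u => Subtype.ext (funext fun i => (hE i (B i) le_rfl).eval_par (u.1 (B i)))
      map_d := fun u => Subtype.ext (funext fun i => hd i (u.1 (B i)))
      map_comp := fun h s u v => Subtype.ext (funext fun i =>
        (hE i (B i) le_rfl).eval_comp h s (u.1 (B i)) (v.1 (B i)))
      map_perm := fun hS _ σ u => Subtype.ext (funext fun i =>
        (hE i (B i) le_rfl).eval_perm hS σ (u.1 (B i)))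
      cont := fun n => by
        -- Each component factors through the discrete truncation at level `B i`, hence is
        -- continuous.
        refine continuous_iInf_rng.2 fun i => continuous_induced_rng.2 ?_
        have := truncSystem_isDiscrete k S (B i) n
        exact (continuous_of_discreteTopology (f := fun z : ((truncSystem k S).obj (B i)).Ob n =>
          (hE i (B i) le_rfl).eval n z)).comp (((truncSystem k S).proj (B i)).cont n) }
  refine ⟨f, OperadHom.ext fun n u => OperadSystem.lim_ext fun i => ?_,
    OperadSystem.lim_ext fun i => (hE i (B i) le_rfl).eval_mk (Mono.x rfl)⟩
  have hE₀ := (φ i).isEvaluation (hO i) (hξ' i) false ⊤ fun f hf => absurd hf (by simp)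
  exact (hE₀.eval_inclMap (hE i (B i) le_rfl) (fun _ => rfl) le_top u).trans
    (hE₀.eval_eq_app (φ i) u)

end Extension

end MCOp

namespace MCOp

/-! ### Maurer–Cartan elements as images of `x`. -/

section MaurerCartan

variable {k : Type u} [Field k] {V : Type v} [AddCommGroup V] [Module k V] {S : Bool}
  {A : FormalCDGA.{u, w, w'} k} {D : DGStructure k V}

theorem coeffSystem_isDiscrete {W : Type v} [AddCommGroup W] [Module k W]
    (A : FormalCDGA.{u, w, w'} k) (D : DGStructure k W) (S : Bool) :
    (coeffSystem A D S).IsDiscrete := fun _ _ => ⟨rfl⟩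

theorem coeffSystem_isNilpotent {W : Type v} [AddCommGroup W] [Module k W]
    (A : FormalCDGA.{u, w, w'} k) (D : DGStructure k W) (S : Bool) :
    (coeffSystem A D S).IsNilpotent := fun i => by
  obtain ⟨N, hN⟩ := exists_evalMono_eq_zero (A.alg i) (endOperad D S)
  exact ⟨N, fun μ ξ {n} f hf => hN μ ξ true n f hf⟩

/-- The Maurer–Cartan equation in terms of the images of the generators `m_n`. -/
theorem mem_MC_iff {m : LinearAlgebra (infOperad k S) A D}
    {ξ : (coeffOperad A D.parityShift S).Ob 0} :
    ξ ∈ MC m ↔ (coeffOperad A D.parityShift S).par 0 ξ = ξ ∧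
      HasSum (fun n : ℕ => FreeOp.coeff k S (n + 1) •
        (coeffOperad A D.parityShift S).fill (n + 1) (m.app (n + 1) (genM k S n)) ξ)
          ((coeffOperad A D.parityShift S).d 0 ξ) := by
  have hneg : ∀ {F : ℕ → (coeffOperad A D.parityShift S).Ob 0}
      {s : (coeffOperad A D.parityShift S).Ob 0}, HasSum F s → HasSum (fun j => -F j) (-s) :=
    (coeffSystem_isDiscrete A D.parityShift S).hasSum_neg
  have e : ∀ n : ℕ, -(FreeOp.coeff k S (n + 1) •
      (coeffOperad A D.parityShift S).fill (n + 1) (structureMap m n) ξ) =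
        FreeOp.coeff k S (n + 1) •
          (coeffOperad A D.parityShift S).fill (n + 1) (m.app (n + 1) (genM k S n)) ξ :=
    fun n => by rw [structureMap, OperadData.fill_neg, smul_neg, neg_neg]
  -- In the converse direction the sum of the Maurer–Cartan series has to be `-d ξ`, as fixed by
  -- `add_neg_cancel`.
  refine and_congr_right fun _ => ⟨?_, fun h => ⟨_, ?_, add_neg_cancel _⟩⟩
  · rintro ⟨s, hs, h⟩
    have h' := hneg hs
    rwa [← eq_neg_of_add_eq_zero_left h, show _ = _ from funext e] at h'
  · have h' := hneg h
    rwa [show _ = _ from funext fun n => (neg_eq_iff_eq_neg.1 (e n)).symm] at h'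

/-- A continuous linear map carries the convergent series for `d x` to a convergent series for `d (f
x)`, and compatibility with compositions identifies its terms. -/
theorem app_genX_mem_MC (f : LinearAlgebra (infOperadX k S) A D) :
    f.app 0 (genX k S) ∈ MC (f.comp (inclX k S)) := by
  refine mem_MC_iff.2 ⟨?_, ?_⟩
  · rw [← f.map_par, par_genX]
  · have h := hasSum_d_genX.map (f.app 0) (f.cont 0)
    rw [f.map_d] at h
    convert h using 2 with n
    rw [Function.comp_apply, map_smul, f.map_fill]
    rfl

variable [CharZero k]

theorem existsUnique_extension (m : LinearAlgebra (infOperad k S) A D)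
    {ξ : (coeffOperad A D.parityShift S).Ob 0} (hξ : ξ ∈ MC m) :
    ∃! f : LinearAlgebra (infOperadX k S) A D,
      f.comp (inclX k S) = m ∧ f.app 0 (genX k S) = ξ := by
  obtain ⟨hpar, hsum⟩ := mem_MC_iff.1 hξ
  have hd := coeffSystem_isDiscrete A D.parityShift S
  obtain ⟨f, hf, hfx⟩ := OperadHom.exists_extension hd
    (fun i => isDGOperad_tensorOperad (isDGOperad_endOperad D.parityShift S))
    (coeffSystem_isNilpotent A D.parityShift S) m ξ hpar hsum
  exact ⟨f, ⟨hf, hfx⟩, fun g ⟨hg, hgx⟩ =>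
    OperadHom.ext_infOperadX hd (hg.trans hf.symm) (hgx.trans hfx.symm)⟩

end MaurerCartan

end MCOp

theorem theorem2p2 {k : Type u} [Field k] [CharZero k] (A : MCOp.FormalCDGA.{u, w, w'} k)
    {V : Type v} [AddCommGroup V] [Module k V] (D : MCOp.DGStructure k V) :
    ((∀ f : MCOp.LinearAlgebra (MCOp.LInfX k) A D,
        f.app 0 (MCOp.genX k true) ∈ MCOp.MC (f.comp (MCOp.inclX k true))) ∧
      (∀ m : MCOp.LinearAlgebra (MCOp.LInf k) A D, ∀ ξ ∈ MCOp.MC m,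
        ∃! f : MCOp.LinearAlgebra (MCOp.LInfX k) A D,
          f.comp (MCOp.inclX k true) = m ∧ f.app 0 (MCOp.genX k true) = ξ)) ∧
    ((∀ f : MCOp.LinearAlgebra (MCOp.AInfX k) A D,
        f.app 0 (MCOp.genX k false) ∈ MCOp.MC (f.comp (MCOp.inclX k false))) ∧
      (∀ m : MCOp.LinearAlgebra (MCOp.AInf k) A D, ∀ ξ ∈ MCOp.MC m,
        ∃! f : MCOp.LinearAlgebra (MCOp.AInfX k) A D,
          f.comp (MCOp.inclX k false) = m ∧ f.app 0 (MCOp.genX k false) = ξ)) :=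

  ⟨⟨MCOp.app_genX_mem_MC, fun m _ hξ => MCOp.existsUnique_extension m hξ⟩,
    ⟨MCOp.app_genX_mem_MC, fun m _ hξ => MCOp.existsUnique_extension m hξ⟩⟩
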